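/- Let $d\ge 2$ and write $\hat g(\xi)=\int_{\mathbb R^d}e^{-2\pi i x\cdot\xi}g(x)\,dx$. Let $\chi\in C_c^\infty(\mathbb R^d)$ and $\varphi\in C_c^\infty(\mathbb R^d\setminus\{0\})$ be radial and nonnegative, with $\chi(\xi)+\sum_{q\ge 0}\varphi(2^{-q}\xi)=1$ for all $\xi$, with $\operatorname{supp}\chi\cap\operatorname{supp}\varphi(2^{-q}\cdot)=\varnothing$ for $q\ge 1$, and with $\operatorname{supp}\varphi(2^{-j}\cdot)\cap\operatorname{supp}\varphi(2^{-k}\cdot)=\varnothing$ for $j,k\in\mathbb Z$, $|j-k|\ge 2$. For a tempered distribution $u$ put $\Delta_{-1}u=\mathcal F^{-1}(\chi\,\hat u)$, $\Delta_q u=\mathcal F^{-1}(\varphi(2^{-q}\cdot)\,\hat u)$ for $q\ge 0$, and $$\|u\|_{B^s_{p,r}}=\Big\|\big(2^{qs}\|\Delta_q u\|_{L^p}\big)_{q\ge -1}\Big\|_{\ell^r}.$$ Let $\mathcal R=\partial_1/|D|$ be the Riesz transform, that is, the Fourier multiplier of symbol $i\xi_1/|\xi|$. For a smooth divergence-free vector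 field $v:\mathbb R^d\to\mathbb R^d$ let $\omega=(\partial_i v_j-\partial_j v_i)_{i,j}$ be its vorticity, with $|\omega|=\max_{i,j}|\omega_{ij}|$ (for $d=2$, $|\omega|=|\partial_1v_2-\partial_2v_1|$). For a smooth real function $\theta$, the commutator $[\mathcal R,v\cdot\nabla]\theta=\mathcal R(v\cdot\nabla\theta)-v\cdot\nabla(\mathcal R\theta)$ is understood in the sense of distributions (using $\operatorname{div}v=0$): for every $g\in C_c^\infty(\mathbb R^d)$, $$\big\langle[\mathcal R,v\cdot\nabla]\theta,g\big\rangle=\int\theta\; v\cdot\nabla(\mathcal R g)\,dx-\int\theta\;\mathcal R(v\cdot\nabla g)\,dx .$$ 1. For every $(p,r)\in[2,\infty)\times[1,\infty]$ there is a constant $C$, depending only on $p,r$ (and on $d,\chi,\varphi$), such that for every smooth divergence-free vector field $v$ with $\nabla v\in L^p$ and every smooth real function $\theta\in L^p\cap B^0_{\infty,r}$, both integrals above converge absolutely for every $g$, they define a tempered distribution $[\mathcal R,v\cdot\nabla]\theta$, and $$\|[\mathcal R,v\cdot\nabla]\theta\|_{B^0_{p,r}}\le C\,\|\nabla v\|_{L^p}\big(\|\theta\|_{B^0_{\infty,r}}+\|\theta\|_{L^p}\big).$$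 2. For every $(r,\rho)\in[1,\infty]\times(1,\infty)$ and every $\varepsilon>0$ there is a constant $C$, depending only on $r,\rho,\varepsilon$ (and on $d,\chi,\varphi$), such that for every smooth divergence-free vector field $v$ with $\nabla v\in L^\rho$ and $\omega\in L^\infty$ and every smooth real function $\theta\in L^\rho\cap B^\varepsilon_{\infty,r}$, both integrals above converge absolutely for every $g$, they define a tempered distribution $[\mathcal R,v\cdot\nabla]\theta$, and $$\|[\mathcal R,v\cdot\nabla]\theta\|_{B^0_{\infty,r}}\le C\,\big(\|\omega\|_{L^\infty}+\|\omega\|_{L^\rho}\big)\big(\|\theta\|_{B^\varepsilon_{\infty,r}}+\|\theta\|_{L^\rho}\big).$$ -/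

import Mathlib

open MeasureTheory
open scoped SchwartzMap FourierTransform ENNReal NNReal ContDiff

namespace RieszCommutator

/-- The Euclidean space `ℝ^d`. -/
abbrev E (d : ℕ) : Type := EuclideanSpace ℝ (Fin d)

/-! ### Littlewood-Paley decomposition and Besov norms -/

/-- The two cut-off functions of an inhomogeneous dyadic partition of unity on `ℝ^d`:
`χ ∈ 𝓓(ℝ^d)` and `φ ∈ 𝓓(ℝ^d ∖ {0})`, both radial and nonnegative. -/
structure DyadicPartition (d : ℕ) where
  χ : E d → ℝ
  φ : E d → ℝ
  χ_smooth : ContDiff ℝ ∞ χ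
  φ_smooth : ContDiff ℝ ∞ φ
  χ_compact : HasCompactSupport χ
  φ_compact : HasCompactSupport φ
  φ_away : (0 : E d) ∉ tsupport φ
  χ_nonneg : ∀ ξ, 0 ≤ χ ξ
  φ_nonneg : ∀ ξ, 0 ≤ φ ξ
  χ_radial : ∀ ξ η : E d, ‖ξ‖ = ‖η‖ → χ ξ = χ η
  φ_radial : ∀ ξ η : E d, ‖ξ‖ = ‖η‖ → φ ξ = φ η
  /-- `χ(ξ) + ∑_{q ≥ 0} φ(2^{-q} ξ) = 1`. -/
  partition : ∀ ξ : E d,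
    HasSum (fun q : ℕ => φ ((2 : ℝ) ^ (-(q : ℤ)) • ξ)) (1 - χ ξ)
  χ_disjoint : ∀ q : ℕ, 1 ≤ q →
    Disjoint (tsupport χ) (tsupport fun ξ : E d => φ ((2 : ℝ) ^ (-(q : ℤ)) • ξ))
  φ_disjoint : ∀ j k : ℤ, 2 ≤ |j - k| →
    Disjoint (tsupport fun ξ : E d => φ ((2 : ℝ) ^ (-j) • ξ))
      (tsupport fun ξ : E d => φ ((2 : ℝ) ^ (-k) • ξ))

/-- The symbol of the dyadic block `Δ_{n-1}`: the index is shifted by one, so that `n = 0` is the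
low frequency block `Δ_{-1} = χ(D)` and `n = q + 1` is `Δ_q = φ(2^{-q} D)`. Mathlib's Fourier
variable differs from the symbol variable of `D = -i∂` by the factor `2π`; this is immaterial, as
dilating a dyadic partition gives a dyadic partition, and everything below is stated for all of
them. -/
noncomputable def DyadicPartition.symbol {d : ℕ} (P : DyadicPartition d) : ℕ → E d → ℂ
  | 0 => fun ξ => (P.χ ξ : ℂ)
  | q + 1 => fun ξ => (P.φ ((2 : ℝ) ^ (-(q : ℤ)) • ξ) : ℂ)

/-- The dyadic block `Δ_{n-1} u = 𝓕⁻¹ (symbol · 𝓕 u)` of a tempered distribution `u`. -/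
noncomputable def DyadicPartition.block {d : ℕ} (P : DyadicPartition d) (n : ℕ)
    (u : 𝓢'(E d, ℂ)) : 𝓢'(E d, ℂ) :=
  TemperedDistribution.fourierMultiplierCLM ℂ (P.symbol n) u

/-- The tempered distribution `u` is the function `f`: every `f · g`, with `g` a Schwartz
function, is integrable, and `⟨u, g⟩ = ∫ f g`. -/
def IsFunction {d : ℕ} (u : 𝓢'(E d, ℂ)) (f : E d → ℂ) : Prop :=
  ∀ g : 𝓢(E d, ℂ), Integrable (fun x => f x * g x) ∧ u g = ∫ x, f x * g x

/-- The `L^p` norm of a tempered distribution: the `L^p` norm of the function of `L^p` that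
represents it (it is unique almost everywhere), and `∞` if there is none. -/
noncomputable def distLpNorm {d : ℕ} (p : ℝ≥0∞) (u : 𝓢'(E d, ℂ)) : ℝ≥0∞ :=
  ⨅ (f : E d → ℂ) (_ : MemLp f p volume) (_ : IsFunction u f), eLpNorm f p volume

open Classical in
/-- The `ℓ^r` norm of a sequence of extended nonnegative numbers, `r ∈ [1, ∞]`. -/
noncomputable def seqNorm (r : ℝ≥0∞) (a : ℕ → ℝ≥0∞) : ℝ≥0∞ :=
  if r = ⊤ then ⨆ n, a n else (∑' n, a n ^ r.toReal) ^ (1 / r.toReal)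

/-- The inhomogeneous Besov norm
`‖u‖_{B^s_{p,r}} = ‖ (2^{qs} ‖Δ_q u‖_{L^p})_{q ≥ -1} ‖_{ℓ^r}`, with `q = n - 1`. -/
noncomputable def besovNorm {d : ℕ} (P : DyadicPartition d) (s : ℝ) (p r : ℝ≥0∞)
    (u : 𝓢'(E d, ℂ)) : ℝ≥0∞ :=
  seqNorm r fun n =>
    ENNReal.ofReal ((2 : ℝ) ^ (((n : ℝ) - 1) * s)) * distLpNorm p (P.block n u)

/-! ### Vector fields -/

/-- The vector field `v` is divergence-free. -/
def DivergenceFree {d : ℕ} (v : E d → E d) : Prop :=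
  ∀ x, ∑ i : Fin d, (fderiv ℝ v x (EuclideanSpace.single i 1)) i = 0

/-- The vorticity `ω_{ij} = ∂_i v_j - ∂_j v_i`. The norm on its values is the largest absolute
value of an entry; in dimension two this is `|∂₁ v₂ - ∂₂ v₁|`. -/
noncomputable def vorticity {d : ℕ} (v : E d → E d) (x : E d) : Fin d → Fin d → ℝ :=
  fun i j => (fderiv ℝ v x (EuclideanSpace.single i 1)) j
    - (fderiv ℝ v x (EuclideanSpace.single j 1)) i

/-- `v · ∇ f`, for a differentiable function `f`. -/
noncomputable def convection {d : ℕ} (v : E d → E d) (f : E d → ℂ) (x : E d) : ℂ :=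
  fderiv ℝ f x (v x)

/-! ### The Riesz transform and the commutator -/

/-- The Riesz transform `R = ∂₁ / |D|` on test functions: the Fourier multiplier of symbol
`i ξ₁ / |ξ|`, where `ξ₁` is the coordinate of index `i₀`. -/
noncomputable def riesz {d : ℕ} (i₀ : Fin d) (f : E d → ℂ) : E d → ℂ :=
  𝓕⁻ (fun ξ : E d => Complex.I * ((ξ i₀ / ‖ξ‖ : ℝ) : ℂ) * 𝓕 f ξ)

/-- The tempered distribution `T` is `[R, v·∇] θ = R (v·∇θ) - v·∇(R θ)`, where `v` is smooth and
divergence-free. Both `R` and `v·∇` are skew-symmetric, and they act on distributions by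
`⟨R u, g⟩ = -⟨u, R g⟩` and `⟨v·∇u, g⟩ = -⟨u, v·∇g⟩`. Thus, for each test function `g ∈ 𝓓(ℝ^d)`,
* `⟨R (v·∇θ), g⟩ = -⟨v·∇θ, R g⟩ = ∫ θ (v·∇(R g))`,
* `⟨v·∇(R θ), g⟩ = -⟨R θ, v·∇g⟩ = ∫ θ R (v·∇g)`,
and both integrals have to converge absolutely. As `𝓓` is dense in `𝓢`, there is at most one
such `T`. -/
def IsCommutator {d : ℕ} (i₀ : Fin d) (v : E d → E d) (θ : E d → ℝ) (T : 𝓢'(E d, ℂ)) : Prop :=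
  ∀ g : 𝓢(E d, ℂ), HasCompactSupport (g : E d → ℂ) →
    Integrable (fun x => (θ x : ℂ) * convection v (riesz i₀ g) x) ∧
    Integrable (fun x => (θ x : ℂ) * riesz i₀ (convection v g) x) ∧
    T g = (∫ x, (θ x : ℂ) * convection v (riesz i₀ g) x)
        - ∫ x, (θ x : ℂ) * riesz i₀ (convection v g) x

end RieszCommutator

open RieszCommutator

/-! Both estimates rest on one double dyadic decomposition, without paraproducts. In the weak
formulation, θ is cut into homogeneous blocks of frequency 2^q and the test function into blocks of
frequency 2^n. Up to transposition and sign, the commutator becomes a double series of terms Δ_n R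
div(v Δ_q θ) − Δ_n div(v R Δ_q θ), the functions `piece`. All operators are correlations with
Schwartz kernels, so that v, which may grow at infinity, only has to be integrable against a
polynomial weight.

The commutator structure enters once. Writing v(y) = v(x) + (v(y) − v(x)) in both halves of a piece,
the v(x) terms agree, because all Fourier multipliers commute (`conv_ker_one_pd_riesz`,
`piece_eq_comm`). Only increments of v remain, and against a kernel of frequency 2^n an increment is
worth 2^(-n) |∇v|. If n ≥ q, the gradient is moved from the kernel to the block of θ, where it costs
2^q; no term in ∇v appears since div v = 0. If n ≤ q, the block of θ is written as 2^(-q) times a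
divergence, which is integrated by parts onto v and the kernel. Either way a piece is bounded in L^p
by 2^(-|n-q|) ‖∇v‖_p times a bound for the q-th block of θ in L^∞ (`exists_eLpNorm_piece_le`).

For the second estimate ∇v need not be bounded. Instead, v is Hölder continuous of exponent 1 − κ
for a small κ > 0, with constant controlled by ‖ω‖_∞ + ‖ω‖_ρ (`exists_enorm_sub_le_vortSize`): apply
Biot–Savart on each dyadic block and sum the blocks of an increment of v. The same scheme then gives
2^(-μ|n-q|) 2^(κq), with μ = min(κ, 1 − κ), and κ ≤ ε lets the Besov regularity of θ absorb 2^(κq)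
(`exists_eLpNorm_top_piece_le`).

For q ≥ 1 the blocks of θ are bounded by the Besov norm. For q ≤ 0, Bernstein's inequality and the
Lebesgue norm give a geometric series, which is folded into index 0 (`exists_seqNorm_fold_le`). A
block of the resulting distribution sees only neighbouring n, or n ≤ 0 for the low-frequency block,
so Young's inequality in ℓ^r concludes (`exists_besovNorm_le`).

It remains to sum the series to the two integrals of `IsCommutator` (`Admissible.isCommutator`).
This needs v·∇(R g) in the dual Lebesgue space: ∇(R g) decays almost like |x|^(-d-1), and the growth
of v is controlled by a radial average of ∇v, where p ≥ 2 is used, or by the Hölder bound. -/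

namespace RieszCommutator

/-! ### Minkowski's integral inequality and scaling of `L^p` norms -/

/-- Minkowski's integral inequality against a finite measure, for a uniform bound. -/
theorem eLpNorm_lintegral_le {X S : Type*} [MeasurableSpace X] [MeasurableSpace S]
    {μ : Measure X} {ν : Measure S} [SFinite μ] [IsFiniteMeasure ν] {p : ℝ≥0∞} (hp : 1 ≤ p)
    {F : X → S → ℝ≥0∞} (hF : Measurable (Function.uncurry F)) {A : ℝ≥0∞}
    (hA : ∀ s, eLpNorm (fun x => F x s) p μ ≤ A) :
    eLpNorm (fun x => ∫⁻ s, F x s ∂ν) p μ ≤ ν Set.univ * A := by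
  rcases eq_or_ne p ⊤ with rfl | hpt
  · have h1 : ∀ s, ∀ᵐ x ∂μ, F x s ≤ A := fun s => by
      have := hA s
      rw [eLpNorm_exponent_top] at this
      filter_upwards [enorm_ae_le_eLpNormEssSup (fun x => F x s) μ] with x hx
      exact le_trans (by simpa using hx) this
    have h2 : ∀ᵐ x ∂μ, ∀ᵐ s ∂ν, F x s ≤ A := by
      -- The exceptional set of x depends on s; Fubini exchanges the two quantifiers.
      rw [Measure.ae_ae_comm (p := fun x s => F x s ≤ A)
        (measurableSet_le hF measurable_const)]
      exact Filter.Eventually.of_forall h1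
    rw [eLpNorm_exponent_top]
    refine essSup_le_of_ae_le _ ?_
    filter_upwards [h2] with x hx
    calc ‖∫⁻ s, F x s ∂ν‖ₑ = ∫⁻ s, F x s ∂ν := by simp
      _ ≤ ∫⁻ _, A ∂ν := lintegral_mono_ae hx
      _ = ν Set.univ * A := by rw [lintegral_const, mul_comm]
  · have hp0 : p ≠ 0 := fun h => by simp [h] at hp
    have hpr : 0 < p.toReal := ENNReal.toReal_pos hp0 hpt
    -- Hölder in s against the finite measure, followed by Tonelli. Since the bound A is uniform in
    -- s, the powers of the total mass recombine to exactly ν(univ).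
    have h1 : ∀ x, (∫⁻ s, F x s ∂ν) ^ p.toReal ≤
        (∫⁻ s, F x s ^ p.toReal ∂ν) * (ν Set.univ ^ (1 - 1 / p.toReal)) ^ p.toReal := fun x => by
      have := eLpNorm_le_eLpNorm_mul_rpow_measure_univ (μ := ν) hp
        (f := fun s => F x s) (hF.of_uncurry_left).aestronglyMeasurable
      rw [eLpNorm_one_eq_lintegral_enorm, eLpNorm_eq_lintegral_rpow_enorm_toReal hp0 hpt] at this
      simp only [enorm_eq_self, ENNReal.toReal_one, div_one] at this
      refine (ENNReal.rpow_le_rpow this hpr.le).trans ?_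
      rw [ENNReal.mul_rpow_of_nonneg _ _ hpr.le, ← ENNReal.rpow_mul, one_div,
        inv_mul_cancel₀ hpr.ne', ENNReal.rpow_one]
    have h2 : ∀ s, ∫⁻ x, F x s ^ p.toReal ∂μ ≤ A ^ p.toReal := fun s => by
      have := hA s
      rw [eLpNorm_eq_lintegral_rpow_enorm_toReal hp0 hpt] at this
      simp only [enorm_eq_self] at this
      have h := ENNReal.rpow_le_rpow this hpr.le
      rwa [← ENNReal.rpow_mul, one_div, inv_mul_cancel₀ hpr.ne', ENNReal.rpow_one] at h
    rw [eLpNorm_eq_lintegral_rpow_enorm_toReal hp0 hpt]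
    simp only [enorm_eq_self]
    have hm : Measurable fun z : X × S => F z.1 z.2 ^ p.toReal :=
      ENNReal.continuous_rpow_const.measurable.comp hF
    have h3 : ∫⁻ x, (∫⁻ s, F x s ∂ν) ^ p.toReal ∂μ ≤
        (ν Set.univ * A ^ p.toReal) * (ν Set.univ ^ (1 - 1 / p.toReal)) ^ p.toReal := by
      refine (lintegral_mono h1).trans ?_
      rw [lintegral_mul_const _ hm.lintegral_prod_right', lintegral_lintegral_swap hm.aemeasurable]
      gcongr
      calc _ ≤ ∫⁻ _ : S, A ^ p.toReal ∂ν := lintegral_mono h2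
        _ = _ := by rw [lintegral_const, mul_comm]
    refine (ENNReal.rpow_le_rpow h3 (by positivity)).trans (le_of_eq ?_)
    rw [ENNReal.mul_rpow_of_nonneg _ _ (by positivity), ← ENNReal.rpow_mul, ← ENNReal.rpow_mul,
      ENNReal.mul_rpow_of_nonneg _ _ (by positivity), ← ENNReal.rpow_mul]
    have e : p.toReal * (1 / p.toReal) = 1 := by field_simp
    rw [e, mul_one, ENNReal.rpow_one, mul_right_comm,
      ← ENNReal.rpow_add_of_nonneg]
    · simp
    · positivity
    · have : 1 ≤ p.toReal := by
        have := ENNReal.toReal_mono hpt hp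
        simpa using this
      rw [sub_nonneg, div_le_one hpr]; exact this

variable {d : ℕ}

theorem eLpNorm_comp_add_smul {F : Type*} [NormedAddCommGroup F] {f : E d → F}
    (hf : AEStronglyMeasurable f volume) (p : ℝ≥0∞) (a : E d) {t : ℝ} (ht : 0 < t) :
    eLpNorm (fun x => f (a + t • x)) p volume
      = ENNReal.ofReal (t ^ (-((d : ℝ) / p.toReal))) * eLpNorm f p volume := by
  have h1 : Measure.map (fun x : E d => a + t • x) volume
      = ENNReal.ofReal (t ^ (-(d : ℝ))) • (volume : Measure (E d)) := by
    have : (fun x : E d => a + t • x) = (fun x => a + x) ∘ (fun x => t • x) := rfl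
    rw [this, ← Measure.map_map (measurable_const_add a) (measurable_const_smul t),
      Measure.map_addHaar_smul _ ht.ne', Measure.map_smul, map_add_left_eq_self]
    congr 2
    rw [Real.rpow_neg ht.le, abs_of_pos (by positivity)]
    simp
  have hme : Measurable fun x : E d => a + t • x := by fun_prop
  have h0 : ENNReal.ofReal (t ^ (-(d : ℝ))) ≠ 0 := by
    rw [Ne, ENNReal.ofReal_eq_zero, not_le]; positivity
  have h2 := eLpNorm_map_measure (μ := (volume : Measure (E d))) (p := p) (g := f)
    (f := fun x : E d => a + t • x) (by rw [h1]; exact hf.smul_measure _) hme.aemeasurable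
  change eLpNorm (f ∘ fun x : E d => a + t • x) p volume = _
  rw [← h2, h1, eLpNorm_smul_measure_of_ne_zero h0, smul_eq_mul,
    ENNReal.ofReal_rpow_of_pos (by positivity), ← Real.rpow_mul ht.le]
  congr 3
  rcases eq_or_ne p ⊤ with rfl | _ <;> simp [div_eq_mul_inv]

theorem eLpNorm_comp_const_add {F : Type*} [NormedAddCommGroup F] {f : E d → F}
    (hf : AEStronglyMeasurable f volume) (p : ℝ≥0∞) (a : E d) :
    eLpNorm (fun x => f (x + a)) p volume = eLpNorm f p volume :=
  eLpNorm_comp_measurePreserving hf (measurePreserving_add_right volume a)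

/-! ### Convolution of Schwartz functions -/

/-- Convolution of Schwartz functions. -/
noncomputable def conv (K g : 𝓢(E d, ℂ)) : 𝓢(E d, ℂ) :=
  SchwartzMap.convolution (ContinuousLinearMap.mul ℂ ℂ) K g

theorem fourier_conv (K g : 𝓢(E d, ℂ)) (ξ : E d) : 𝓕 (conv K g) ξ = 𝓕 K ξ * 𝓕 g ξ := by
  simp [conv, SchwartzMap.fourier_convolution]

theorem conv_apply (K g : 𝓢(E d, ℂ)) (x : E d) : conv K g x = ∫ y, K (x - y) * g y := by
  rw [conv, SchwartzMap.convolution_apply, convolution_eq_swap]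
  rfl

/-- Identities between kernels are mostly checked on the Fourier side, where convolution and
differentiation are multiplications. -/
theorem fourier_injective {f g : 𝓢(E d, ℂ)} (h : ∀ ξ, 𝓕 f ξ = 𝓕 g ξ) : f = g := by
  have : 𝓕 f = 𝓕 g := by ext ξ; exact h ξ
  rw [← FourierTransform.fourierInv_fourier_eq (E := 𝓢(E d, ℂ)) (F := 𝓢(E d, ℂ)) f, this,
    FourierTransform.fourierInv_fourier_eq]

theorem conv_comm (K g : 𝓢(E d, ℂ)) : conv K g = conv g K :=
  fourier_injective fun ξ => by rw [fourier_conv, fourier_conv, mul_comm]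

theorem conv_apply' (K g : 𝓢(E d, ℂ)) (x : E d) : conv K g x = ∫ y, K y * g (x - y) := by
  rw [conv_comm, conv_apply]; simp_rw [mul_comm]

theorem conv_sub_right (K g : 𝓢(E d, ℂ)) (a x : E d) :
    conv K (SchwartzMap.compSubConstCLM ℂ a g) x = conv K g (x - a) := by
  rw [conv_apply', conv_apply']
  refine integral_congr_ae (Filter.Eventually.of_forall fun y => ?_)
  simp [sub_right_comm]

/-- The `i`-th partial derivative of a Schwartz function. -/
noncomputable def pd (i : Fin d) (f : 𝓢(E d, ℂ)) : 𝓢(E d, ℂ) :=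
  LineDeriv.lineDerivOp (EuclideanSpace.single i (1 : ℝ)) f

theorem pd_apply (i : Fin d) (f : 𝓢(E d, ℂ)) (x : E d) :
    pd i f x = fderiv ℝ f x (EuclideanSpace.single i 1) :=
  SchwartzMap.lineDerivOp_apply_eq_fderiv _ _ _

theorem fourier_pd (i : Fin d) (f : 𝓢(E d, ℂ)) (ξ : E d) :
    𝓕 (pd i f) ξ = 2 * Real.pi * Complex.I * (ξ i : ℂ) * 𝓕 f ξ := by
  rw [pd, SchwartzMap.fourier_lineDerivOp_eq]
  rw [smul_apply, SchwartzMap.smulLeftCLM_apply_apply (by fun_prop)]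
  simp [EuclideanSpace.inner_single_right, mul_assoc]

theorem pd_conv_right (i : Fin d) (K g : 𝓢(E d, ℂ)) : pd i (conv K g) = conv K (pd i g) :=
  fourier_injective fun ξ => by simp only [fourier_conv, fourier_pd]; ring

theorem pd_conv_left (i : Fin d) (K g : 𝓢(E d, ℂ)) : pd i (conv K g) = conv (pd i K) g :=
  fourier_injective fun ξ => by simp only [fourier_conv, fourier_pd]; ring

theorem fderiv_eq_sum {F : Type*} [NormedAddCommGroup F] [NormedSpace ℝ F]
    (L : E d →L[ℝ] F) (w : E d) : L w = ∑ i, w i • L (EuclideanSpace.single i 1) := by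
  conv_lhs => rw [← (EuclideanSpace.basisFun (Fin d) ℝ).sum_repr w]
  simp

/-! ### Functions of temperate growth in the mean, and correlation with Schwartz kernels -/

theorem one_add_norm_le_mul (x y : E d) : 1 + ‖x‖ ≤ (1 + ‖x - y‖) * (1 + ‖y‖) := by
  have : ‖x‖ ≤ ‖x - y‖ + ‖y‖ := by simpa using norm_add_le (x - y) y
  nlinarith [norm_nonneg (x - y), norm_nonneg y]

theorem schwartz_decay {F : Type*} [NormedAddCommGroup F] [NormedSpace ℝ F] (K : 𝓢(E d, F))
    (N : ℕ) : ∃ C : ℝ, 0 ≤ C ∧ ∀ x, ‖K x‖ * (1 + ‖x‖) ^ N ≤ C := by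
  refine ⟨2 ^ N * (Finset.Iic (N, 0)).sup (fun m => SchwartzMap.seminorm ℝ m.1 m.2) K,
    by positivity, fun x => ?_⟩
  have := SchwartzMap.one_add_le_sup_seminorm_apply (𝕜 := ℝ) (m := (N, 0)) le_rfl le_rfl K x
  rw [norm_iteratedFDeriv_zero] at this
  rw [mul_comm]; exact this

/-- `f` is integrable against some weight `(1 + ‖x‖)^{-N}`. -/
def TemperateInt (f : E d → ℂ) : Prop :=
  ∃ N : ℕ, Integrable fun x => (((1 + ‖x‖) ^ N)⁻¹ : ℝ) • f x

theorem TemperateInt.aestronglyMeasurable {f : E d → ℂ} (hf : TemperateInt f) :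
    AEStronglyMeasurable f volume := by
  obtain ⟨N, hN⟩ := hf
  have h : Continuous fun x : E d => (1 + ‖x‖) ^ N := by fun_prop
  refine (h.aestronglyMeasurable.smul hN.1).congr (Filter.Eventually.of_forall fun x => ?_)
  have : (1 + ‖x‖) ^ N ≠ 0 := by positivity
  simp only [Pi.smul_apply', smul_smul, mul_inv_cancel₀ this, one_smul]

theorem TemperateInt.integrable_mul_of_decay {f G : E d → ℂ} (hf : TemperateInt f)
    (hG : AEStronglyMeasurable G volume)
    (hd : ∀ N : ℕ, ∃ C : ℝ, ∀ x, ‖G x‖ * (1 + ‖x‖) ^ N ≤ C) :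
    Integrable fun x => f x * G x := by
  have hm := hf.aestronglyMeasurable
  obtain ⟨N, hN⟩ := hf
  obtain ⟨C, hC⟩ := hd N
  refine (hN.norm.const_mul C).mono' (hm.mul hG) (Filter.Eventually.of_forall fun x => ?_)
  have hp : 0 < (1 + ‖x‖) ^ N := by positivity
  rw [norm_mul, norm_smul, Real.norm_of_nonneg (inv_nonneg.2 hp.le)]
  have h1 : ‖G x‖ ≤ C * ((1 + ‖x‖) ^ N)⁻¹ := by
    rw [← div_eq_mul_inv, le_div_iff₀ hp]; exact hC x
  calc ‖f x‖ * ‖G x‖ ≤ ‖f x‖ * (C * ((1 + ‖x‖) ^ N)⁻¹) := by gcongr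
    _ = _ := by ring

theorem TemperateInt.integrable_mul {f : E d → ℂ} (hf : TemperateInt f) (g : 𝓢(E d, ℂ)) :
    Integrable fun x => f x * g x :=
  hf.integrable_mul_of_decay g.continuous.aestronglyMeasurable fun N =>
    (schwartz_decay g N).imp fun _ h => h.2

theorem TemperateInt.mul_bounded {f G : E d → ℂ} (hf : TemperateInt f)
    (hG : AEStronglyMeasurable G volume) {C : ℝ} (hC : ∀ x, ‖G x‖ ≤ C) :
    TemperateInt fun x => G x * f x := by
  obtain ⟨N, hN⟩ := hf
  refine ⟨N, (hN.bdd_mul hG (Filter.Eventually.of_forall hC)).congr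
    (Filter.Eventually.of_forall fun x => ?_)⟩
  simp only [Complex.real_smul]; ring

/-- Hölder's inequality: a large negative power of 1 + ‖x‖ lies in the conjugate Lebesgue space. -/
theorem temperateInt_of_memLp {f : E d → ℂ} {p : ℝ≥0∞} (hp : 1 ≤ p) (hf : MemLp f p volume) :
    TemperateInt f := by
  have := ENNReal.HolderConjugate.inv_one_sub_inv' hp
  obtain ⟨k, hk⟩ := Measure.HasTemperateGrowth.exists_eLpNorm_lt_top (1 - p⁻¹)⁻¹
    (inferInstance : (volume : Measure (E d)).HasTemperateGrowth)
  refine ⟨k, ?_⟩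
  have hc : Continuous fun x : E d => (1 + ‖x‖) ^ (-k : ℝ) :=
    Continuous.rpow_const (by fun_prop) fun x => .inl (by positivity)
  have h : MemLp (fun x : E d => (1 + ‖x‖) ^ (-k : ℝ)) (1 - p⁻¹)⁻¹ volume :=
    ⟨hc.aestronglyMeasurable, hk⟩
  have h2 := MemLp.integrable_mul (q := p) (p := (1 - p⁻¹)⁻¹) h.ofReal hf (𝕜 := ℂ)
  refine h2.congr (Filter.Eventually.of_forall fun x => ?_)
  simp only [Pi.mul_apply, Complex.real_smul]
  rw [Real.rpow_neg (by positivity), Real.rpow_natCast]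
  rfl

/-- The correlation `y ↦ ∫ f(x) K(x - y) dx`, the transpose of the convolution with `K`. -/
noncomputable def corr (K : 𝓢(E d, ℂ)) (f : E d → ℂ) (y : E d) : ℂ := ∫ x, f x * K (x - y)

theorem corr_eq_integral_add (K : 𝓢(E d, ℂ)) (f : E d → ℂ) (y : E d) :
    corr K f y = ∫ z, f (y + z) * K z := by
  rw [corr, ← integral_add_left_eq_self _ y]; simp

theorem TemperateInt.integrable_mul_sub {f : E d → ℂ} (hf : TemperateInt f) (K : 𝓢(E d, ℂ))
    (y : E d) : Integrable fun x => f x * K (x - y) :=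
  hf.integrable_mul (SchwartzMap.compSubConstCLM ℂ y K)

/-- The inequality 1 + |x| ≤ (1 + |x − y|)(1 + |y|) distributes the weight that f lacks between K
and g, which decay faster than any power. -/
theorem TemperateInt.integrable_prod {f : E d → ℂ} (hf : TemperateInt f) (K g : 𝓢(E d, ℂ)) :
    Integrable fun z : E d × E d => f z.1 * K (z.1 - z.2) * g z.2 := by
  have hm := hf.aestronglyMeasurable
  obtain ⟨N, hN⟩ := hf
  obtain ⟨C, hC0, hC⟩ := schwartz_decay K N
  have hg : Integrable fun y : E d => (1 + ‖y‖) ^ N * ‖g y‖ := by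
    obtain ⟨k, hk⟩ := (inferInstance :
      (volume : Measure (E d)).HasTemperateGrowth).exists_integrable
    obtain ⟨D, hD0, hD⟩ := schwartz_decay g (N + k)
    refine (hk.const_mul D).mono' (by fun_prop) (Filter.Eventually.of_forall fun y => ?_)
    have hp : 0 < 1 + ‖y‖ := by positivity
    rw [Real.norm_of_nonneg (by positivity), Real.rpow_neg hp.le, Real.rpow_natCast,
      ← div_eq_mul_inv, le_div_iff₀ (by positivity)]
    calc _ = ‖g y‖ * (1 + ‖y‖) ^ (N + k) := by rw [pow_add]; ring
      _ ≤ D := hD y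
  refine ((hN.norm.mul_prod hg).const_mul C).mono' ?_ (Filter.Eventually.of_forall fun z => ?_)
  · refine ((hm.comp_quasiMeasurePreserving Measure.quasiMeasurePreserving_fst).mul
      (Continuous.aestronglyMeasurable ?_)).mul (Continuous.aestronglyMeasurable ?_) <;> fun_prop
  · have h1 : 0 < (1 + ‖z.1‖) ^ N := by positivity
    have h2 : ‖K (z.1 - z.2)‖ ≤ C * ((1 + ‖z.1‖) ^ N)⁻¹ * (1 + ‖z.2‖) ^ N := by
      rw [mul_right_comm, ← div_eq_mul_inv, le_div_iff₀ h1]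
      calc _ ≤ ‖K (z.1 - z.2)‖ * ((1 + ‖z.1 - z.2‖) * (1 + ‖z.2‖)) ^ N := by
            gcongr; exact one_add_norm_le_mul _ _
        _ = (‖K (z.1 - z.2)‖ * (1 + ‖z.1 - z.2‖) ^ N) * (1 + ‖z.2‖) ^ N := by
            rw [mul_pow]; ring
        _ ≤ _ := by gcongr; exact hC _
    rw [norm_mul, norm_mul, norm_smul, Real.norm_of_nonneg (inv_nonneg.2 h1.le)]
    calc _ ≤ ‖f z.1‖ * (C * ((1 + ‖z.1‖) ^ N)⁻¹ * (1 + ‖z.2‖) ^ N) * ‖g z.2‖ := by gcongr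
      _ = _ := by ring

theorem TemperateInt.integrable_corr_mul {f : E d → ℂ} (hf : TemperateInt f) (K g : 𝓢(E d, ℂ)) :
    Integrable fun y => corr K f y * g y := by
  have := (hf.integrable_prod K g).integral_prod_right
  refine this.congr (Filter.Eventually.of_forall fun y => ?_)
  simp only [corr, ← integral_mul_const]

/-- Correlation is the transpose of convolution. -/
theorem TemperateInt.integral_corr_mul {f : E d → ℂ} (hf : TemperateInt f) (K g : 𝓢(E d, ℂ)) :
    ∫ y, corr K f y * g y = ∫ x, f x * conv K g x := by
  have := integral_integral_swap (f := fun x y => f x * K (x - y) * g y) (hf.integrable_prod K g)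
  simp only [corr, ← integral_mul_const, conv_apply, ← integral_const_mul]
  simp only [mul_assoc] at this ⊢
  exact this.symm

/-- The transpose identity, tested against a translate of K. -/
theorem TemperateInt.corr_corr {f : E d → ℂ} (hf : TemperateInt f) (K L : 𝓢(E d, ℂ)) :
    corr K (corr L f) = corr (conv L K) f := by
  ext y
  have := hf.integral_corr_mul L (SchwartzMap.compSubConstCLM ℂ y K)
  simp only [conv_sub_right, SchwartzMap.compSubConstCLM_apply] at this
  exact this

theorem TemperateInt.hasFDerivAt_corr {f : E d → ℂ} (hf : TemperateInt f) (K : 𝓢(E d, ℂ))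
    (y : E d) :
    HasFDerivAt (corr K f) (∫ x, f x • (-(fderiv ℝ K (x - y)))) y := by
  have hm := hf.aestronglyMeasurable
  have hf' := hf
  obtain ⟨N, hN⟩ := hf
  have hdc : Continuous (fderiv ℝ K) := K.smooth'.continuous_fderiv (by simp)
  obtain ⟨C, hC0, hC⟩ := schwartz_decay (SchwartzMap.fderivCLM ℝ (E d) ℂ K) N
  refine hasFDerivAt_integral_of_dominated_of_fderiv_le (s := Metric.ball y 1)
    (bound := fun x => C * (2 + ‖y‖) ^ N * ‖(((1 + ‖x‖) ^ N)⁻¹ : ℝ) • f x‖)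
    (F' := fun y x => f x • (-(fderiv ℝ K (x - y))))
    (Metric.ball_mem_nhds _ one_pos) ?_ (hf'.integrable_mul_sub K y) ?_ ?_
    (hN.norm.const_mul _) ?_
  · exact Filter.Eventually.of_forall fun y' => (hf'.integrable_mul_sub K y').1
  · exact hm.smul (Continuous.aestronglyMeasurable (by fun_prop))
  · refine Filter.Eventually.of_forall fun x y' hy' => ?_
    have h1 : 0 < (1 + ‖x‖) ^ N := by positivity
    have h3 : 1 + ‖y'‖ ≤ 2 + ‖y‖ := by
      have : ‖y'‖ ≤ ‖y' - y‖ + ‖y‖ := by simpa using norm_add_le (y' - y) y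
      have h := mem_ball_iff_norm.1 hy'
      linarith
    have h2 : ‖fderiv ℝ K (x - y')‖ ≤ C * ((1 + ‖x‖) ^ N)⁻¹ * (2 + ‖y‖) ^ N := by
      rw [mul_right_comm, ← div_eq_mul_inv, le_div_iff₀ h1]
      have hx := hC (x - y')
      rw [SchwartzMap.fderivCLM_apply] at hx
      calc _ ≤ ‖fderiv ℝ K (x - y')‖ * ((1 + ‖x - y'‖) * (1 + ‖y'‖)) ^ N := by
            gcongr; exact one_add_norm_le_mul _ _
        _ = (‖fderiv ℝ K (x - y')‖ * (1 + ‖x - y'‖) ^ N) * (1 + ‖y'‖) ^ N := by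
            rw [mul_pow]; ring
        _ ≤ _ := by gcongr
    rw [norm_smul, norm_neg, norm_smul, Real.norm_of_nonneg (inv_nonneg.2 h1.le)]
    calc _ ≤ ‖f x‖ * (C * ((1 + ‖x‖) ^ N)⁻¹ * (2 + ‖y‖) ^ N) := by gcongr
      _ = _ := by ring
  · refine Filter.Eventually.of_forall fun x y' _ => ?_
    have h := (K.hasFDerivAt (x - y')).comp y' ((hasFDerivAt_id y').const_sub x)
    have h2 := h.const_mul (f x)
    convert! h2 using 1
    ext w
    simp

theorem TemperateInt.differentiable_corr {f : E d → ℂ} (hf : TemperateInt f) (K : 𝓢(E d, ℂ)) :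
    Differentiable ℝ (corr K f) := fun y => (hf.hasFDerivAt_corr K y).differentiableAt

theorem TemperateInt.fderiv_corr {f : E d → ℂ} (hf : TemperateInt f) (K : 𝓢(E d, ℂ))
    (y : E d) (i : Fin d) :
    fderiv ℝ (corr K f) y (EuclideanSpace.single i 1) = -corr (pd i K) f y := by
  have hint : Integrable fun x => f x • (-(fderiv ℝ K (x - y))) := by
    have hm := hf.aestronglyMeasurable
    have hdc : Continuous (fderiv ℝ K) := K.smooth'.continuous_fderiv (by simp)
    obtain ⟨N, hN⟩ := hf
    have h : Integrable fun x => f x *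
        ((‖(SchwartzMap.compSubConstCLM ℂ y (SchwartzMap.fderivCLM ℂ (E d) ℂ K)) x‖ : ℝ) : ℂ) := by
      refine TemperateInt.integrable_mul_of_decay ⟨N, hN⟩
        (Continuous.aestronglyMeasurable (by fun_prop)) fun M => ?_
      obtain ⟨C, _, hC⟩ := schwartz_decay
        (SchwartzMap.compSubConstCLM ℂ y (SchwartzMap.fderivCLM ℂ (E d) ℂ K)) M
      exact ⟨C, fun x => by simpa using hC x⟩
    refine h.mono (hm.smul (Continuous.aestronglyMeasurable (by fun_prop)))
      (Filter.Eventually.of_forall fun x => ?_)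
    simp [norm_smul]
  rw [(hf.hasFDerivAt_corr K y).fderiv, ContinuousLinearMap.integral_apply hint, corr,
    ← integral_neg]
  refine integral_congr_ae (Filter.Eventually.of_forall fun x => ?_)
  simp [pd_apply]

/-- Young's inequality for correlations. -/
theorem eLpNorm_corr_le {f : E d → ℂ} (hf : Measurable f) (K : 𝓢(E d, ℂ)) {p : ℝ≥0∞}
    (hp : 1 ≤ p) :
    eLpNorm (corr K f) p volume ≤ (∫⁻ z, ‖K z‖ₑ) * eLpNorm f p volume := by
  let ν : Measure (E d) := volume.withDensity fun z => ‖K z‖ₑ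
  have hKm : Measurable fun z => ‖K z‖ₑ := K.continuous.measurable.enorm
  have hν : ν Set.univ = ∫⁻ z, ‖K z‖ₑ := by simp [ν]
  have : IsFiniteMeasure ν := ⟨by rw [hν]; exact K.integrable.2⟩
  have h := eLpNorm_lintegral_le (μ := (volume : Measure (E d))) (ν := ν) hp
    (F := fun y z => ‖f (y + z)‖ₑ) (by fun_prop) (A := eLpNorm f p volume) (fun z => by
      rw [eLpNorm_enorm (fun y => f (y + z)), eLpNorm_comp_const_add hf.aestronglyMeasurable])
  rw [hν] at h
  refine le_trans (eLpNorm_mono_enorm fun y => ?_) h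
  rw [corr_eq_integral_add]
  refine (enorm_integral_le_lintegral_enorm _).trans (le_of_eq ?_)
  rw [lintegral_withDensity_eq_lintegral_mul _ hKm (by fun_prop), enorm_eq_self]
  simp [enorm_mul, mul_comm]

/-! ### The homogeneous dyadic kernels -/

/-- A symbol that is smooth away from the origin. -/
structure Sym (d : ℕ) where
  toFun : E d → ℂ
  smooth : ContDiffOn ℝ ∞ toFun {0}ᶜ

theorem Sym.contDiffAt (h : Sym d) {ξ : E d} (hξ : ξ ≠ 0) : ContDiffAt ℝ ∞ h.toFun ξ :=
  h.smooth.contDiffAt (isOpen_compl_singleton.mem_nhds hξ)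

theorem contDiff_coord_complex (i : Fin d) : ContDiff ℝ ∞ fun ξ : E d => ((ξ i : ℝ) : ℂ) := by
  have : ContDiff ℝ ∞ fun ξ : E d => ξ i := by fun_prop
  exact Complex.ofRealCLM.contDiff.comp this

/-- The constant symbol. -/
noncomputable def Sym.one : Sym d := ⟨fun _ => 1, contDiffOn_const⟩

/-- The symbol of the Riesz transform. -/
noncomputable def Sym.riesz (i₀ : Fin d) : Sym d :=
  ⟨fun ξ => Complex.I * ((ξ i₀ / ‖ξ‖ : ℝ) : ℂ), by
    refine contDiffOn_const.mul ?_
    refine Complex.ofRealCLM.contDiff.comp_contDiffOn ?_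
    refine ContDiffOn.div (by fun_prop) (fun ξ hξ => ?_) fun ξ hξ => norm_ne_zero_iff.2 hξ
    exact (contDiffAt_norm ℝ hξ).contDiffWithinAt⟩

/-- The symbol of the `i`-th partial derivative of a multiplier. -/
noncomputable def Sym.mulX (i : Fin d) (h : Sym d) : Sym d :=
  ⟨fun ξ => 2 * Real.pi * Complex.I * (ξ i : ℂ) * h.toFun ξ,
    (contDiffOn_const.mul (contDiff_coord_complex i).contDiffOn).mul h.smooth⟩

/-- The symbols of the components of a primitive of a multiplier. -/
noncomputable def Sym.divX (i : Fin d) (h : Sym d) : Sym d :=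
  ⟨fun ξ => (2 * Real.pi * Complex.I)⁻¹ * (ξ i : ℂ) * h.toFun ξ * (((‖ξ‖ ^ 2)⁻¹ : ℝ) : ℂ), by
    refine ((contDiffOn_const.mul (contDiff_coord_complex i).contDiffOn).mul h.smooth).mul ?_
    refine Complex.ofRealCLM.contDiff.comp_contDiffOn ?_
    refine ContDiffOn.inv (contDiff_norm_sq ℝ).contDiffOn fun ξ hξ => ?_
    exact pow_ne_zero _ (norm_ne_zero_iff.2 hξ)⟩

/-- The convolution kernel of the Fourier multiplier of symbol `m(2^{-n} ·)`. -/
noncomputable def dilKer (m : 𝓢(E d, ℂ)) (n : ℤ) : 𝓢(E d, ℂ) :=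
  𝓕⁻ (SchwartzMap.compCLMOfContinuousLinearEquiv ℂ
    (LinearEquiv.smulOfNeZero ℝ (E d) ((2 : ℝ) ^ (-n)) (by positivity)).toContinuousLinearEquiv m)

theorem fourier_dilKer (m : 𝓢(E d, ℂ)) (n : ℤ) (ξ : E d) :
    𝓕 (dilKer m n) ξ = m ((2 : ℝ) ^ (-n) • ξ) := by
  rw [dilKer, FourierTransform.fourier_fourierInv_eq]
  rfl

theorem dilKer_apply (m : 𝓢(E d, ℂ)) (n : ℤ) (x : E d) :
    dilKer m n x = (((2 : ℝ) ^ n) ^ d : ℝ) • dilKer m 0 ((2 : ℝ) ^ n • x) := by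
  have key : ∀ k : ℤ, ∀ y : E d, dilKer m k y = ∫ ξ : E d,
      Complex.exp ((↑(2 * Real.pi * inner ℝ ξ y) * Complex.I)) •
        m ((2 : ℝ) ^ (-k) • ξ) := fun k y => by
    rw [dilKer, SchwartzMap.fourierInv_coe, Real.fourierInv_eq']
    rfl
  rw [key, key]
  have := Measure.integral_comp_smul_of_nonneg (μ := (volume : Measure (E d)))
    (fun ξ : E d => Complex.exp ((↑(2 * Real.pi * inner ℝ ξ ((2 : ℝ) ^ n • x)) * Complex.I)) •
        m ((2 : ℝ) ^ (-0 : ℤ) • ξ)) ((2 : ℝ) ^ (-n)) (hR := by positivity)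
  have e : ((2 : ℝ) ^ n) ^ d = (((2 : ℝ) ^ (-n)) ^ d)⁻¹ := by rw [zpow_neg, inv_pow, inv_inv]
  simp only [finrank_euclideanSpace, Fintype.card_fin] at this
  rw [e, ← this]
  refine integral_congr_ae (Filter.Eventually.of_forall fun ξ => ?_)
  simp only [inner_smul_left, inner_smul_right, neg_zero, zpow_zero, one_smul]
  congr 4
  have h2 : (2 : ℂ) ^ n ≠ 0 := zpow_ne_zero _ two_ne_zero
  simp [zpow_neg]
  field_simp

/-- Scaling is the source of every power of 2: the L^1 norm of a dilated kernel does not depend on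
n, while a first moment or the increment of a field is taken at distance of order 2^(-n). -/
theorem lintegral_dilKer_mul (m : 𝓢(E d, ℂ)) (n : ℤ) {G : E d → ℝ≥0∞} (hG : Measurable G) :
    ∫⁻ z, ‖dilKer m n z‖ₑ * G z = ∫⁻ z, ‖dilKer m 0 z‖ₑ * G (((2 : ℝ) ^ (-n)) • z) := by
  have h2 : (2 : ℝ) ^ n ≠ 0 := by positivity
  have hm : Measurable fun z : E d => ‖dilKer m 0 z‖ₑ * G (((2 : ℝ) ^ (-n)) • z) :=
    (dilKer m 0).continuous.measurable.enorm.mul (hG.comp (measurable_const_smul _))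
  have e := Measure.map_addHaar_smul (volume : Measure (E d)) h2
  have e2 : ∫⁻ z, ‖dilKer m 0 z‖ₑ * G (((2 : ℝ) ^ (-n)) • z) ∂(Measure.map
      (fun z : E d => (2 : ℝ) ^ n • z) volume) = ∫⁻ z, ‖dilKer m 0 ((2 : ℝ) ^ n • z)‖ₑ * G z := by
    rw [lintegral_map hm (measurable_const_smul _)]
    simp only [smul_smul, ← zpow_add₀ (two_ne_zero (α := ℝ)), neg_add_cancel, zpow_zero, one_smul]
  have hpos : 0 < ((2 : ℝ) ^ n) ^ d := by positivity
  rw [show (fun z : E d => (2 : ℝ) ^ n • z) = ((2 : ℝ) ^ n • ·) from rfl, e,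
    lintegral_smul_measure, finrank_euclideanSpace, Fintype.card_fin, abs_of_pos (by positivity),
    ENNReal.ofReal_inv_of_pos hpos, smul_eq_mul] at e2
  have h0 : ENNReal.ofReal (((2 : ℝ) ^ n) ^ d) ≠ 0 := by
    rwa [Ne, ENNReal.ofReal_eq_zero, not_le]
  calc ∫⁻ z, ‖dilKer m n z‖ₑ * G z
      = ∫⁻ z, ENNReal.ofReal (((2 : ℝ) ^ n) ^ d) * (‖dilKer m 0 ((2 : ℝ) ^ n • z)‖ₑ * G z) := by
        refine lintegral_congr fun z => ?_
        rw [dilKer_apply m n, enorm_smul, Real.enorm_of_nonneg hpos.le, mul_assoc]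
    _ = ENNReal.ofReal (((2 : ℝ) ^ n) ^ d) * ∫⁻ z, ‖dilKer m 0 ((2 : ℝ) ^ n • z)‖ₑ * G z :=
        lintegral_const_mul' _ _ ENNReal.ofReal_ne_top
    _ = _ := by
        rw [← e2, ← mul_assoc, ENNReal.mul_inv_cancel h0 ENNReal.ofReal_ne_top, one_mul]

namespace DyadicPartition

variable (P : DyadicPartition d)

theorem φ_zero : P.φ 0 = 0 := by
  by_contra h
  exact P.φ_away (subset_tsupport _ h)

/-- The function `φ h` as a Schwartz function. -/
noncomputable def annular (h : Sym d) : 𝓢(E d, ℂ) :=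
  HasCompactSupport.toSchwartzMap (f := fun ξ => (P.φ ξ : ℂ) * h.toFun ξ)
    ((P.φ_compact.comp_left (g := fun x : ℝ => (x : ℂ)) rfl).mul_right) (by
      rw [contDiff_iff_contDiffAt]
      intro ξ
      rcases eq_or_ne ξ 0 with rfl | hξ
      · have h0 : (fun ξ => (P.φ ξ : ℂ) * h.toFun ξ) =ᶠ[nhds 0] fun _ => 0 := by
          filter_upwards [notMem_tsupport_iff_eventuallyEq.1 P.φ_away] with ξ hξ
          simp [hξ]
        exact contDiffAt_const.congr_of_eventuallyEq h0
      · exact (Complex.ofRealCLM.contDiff.comp P.φ_smooth).contDiffAt.mul (h.contDiffAt hξ))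

/-- The convolution kernel of the Fourier multiplier of symbol `(φ h)(2^{-n} ·)`. -/
noncomputable def ker (h : Sym d) (n : ℤ) : 𝓢(E d, ℂ) := dilKer (P.annular h) n

theorem fourier_ker (h : Sym d) (n : ℤ) (ξ : E d) :
    𝓕 (P.ker h n) ξ = (P.φ ((2 : ℝ) ^ (-n) • ξ) : ℂ) * h.toFun ((2 : ℝ) ^ (-n) • ξ) :=
  fourier_dilKer _ _ _

theorem ker_apply (h : Sym d) (n : ℤ) (x : E d) :
    P.ker h n x = (((2 : ℝ) ^ n) ^ d : ℝ) • P.ker h 0 ((2 : ℝ) ^ n • x) :=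
  dilKer_apply _ _ _

theorem φ_eq_zero_of_ne_zero {j k : ℤ} (hjk : 2 ≤ |j - k|) {ξ : E d}
    (h : P.φ ((2 : ℝ) ^ (-j) • ξ) ≠ 0) : P.φ ((2 : ℝ) ^ (-k) • ξ) = 0 := by
  by_contra h'
  exact Set.disjoint_left.1 (P.φ_disjoint j k hjk) (subset_tsupport _ h) (subset_tsupport _ h')

/-- The homogeneous partition follows from the inhomogeneous one by dilation. At the point 2^N ξ
with N large, χ vanishes, and so do all the terms φ(2^(-n) ξ) with n < −N that the sum over ℕ
misses. -/
theorem hasSum_φ {ξ : E d} (hξ : ξ ≠ 0) :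
    HasSum (fun n : ℤ => P.φ ((2 : ℝ) ^ (-n) • ξ)) 1 := by
  have hb : ∀ f : E d → ℝ, HasCompactSupport f →
      ∀ᶠ m : ℕ in Filter.atTop, ∀ k ≥ m, f ((2 : ℝ) ^ k • ξ) = 0 := fun f hf => by
    obtain ⟨R, hR⟩ := hf.isCompact.isBounded.subset_closedBall (0 : E d)
    have ht : Filter.Tendsto (fun m : ℕ => (2 : ℝ) ^ m * ‖ξ‖) Filter.atTop Filter.atTop :=
      (tendsto_pow_atTop_atTop_of_one_lt one_lt_two).atTop_mul_const (norm_pos_iff.2 hξ)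
    filter_upwards [ht.eventually_gt_atTop R] with m hm k hk
    refine image_eq_zero_of_notMem_tsupport fun hmem => ?_
    have h1 := mem_closedBall_zero_iff.1 (hR hmem)
    rw [norm_smul, Real.norm_of_nonneg (by positivity)] at h1
    have h2 : (2 : ℝ) ^ m * ‖ξ‖ ≤ (2 : ℝ) ^ k * ‖ξ‖ := by
      gcongr
      norm_num
    linarith
  obtain ⟨N, hN1, hN2⟩ := ((hb P.χ P.χ_compact).and (hb P.φ P.φ_compact)).exists
  have h1 := P.partition ((2 : ℝ) ^ N • ξ)
  rw [hN1 N le_rfl, sub_zero] at h1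
  have hinj : Function.Injective fun q : ℕ => (q : ℤ) - N := fun a b hab => by simpa using hab
  rw [← hinj.hasSum_iff]
  · convert h1 using 2 with q
    simp only [Function.comp, smul_smul]
    congr 2
    rw [← zpow_natCast, ← zpow_add₀ two_ne_zero]
    congr 1
    ring
  · intro n hn
    have hlt : n < -N := by
      by_contra hge
      push Not at hge
      exact hn ⟨(n + N).toNat, by
        have : 0 ≤ n + N := by omega
        simp [Int.toNat_of_nonneg this]⟩
    have := hN2 (-n).toNat (by omega)
    rwa [← zpow_natCast, Int.toNat_of_nonneg (by omega)] at this

/-- Where φ(2^(-n) ·) is nonzero, all but its two neighbours and itself vanish, so these three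
already sum to 1. Hence the sum of three consecutive blocks acts as the identity on the n-th one. -/
theorem sum_three_φ {ξ : E d} {n : ℤ} (h : P.φ ((2 : ℝ) ^ (-n) • ξ) ≠ 0) :
    ∑ i ∈ Finset.Icc (-1 : ℤ) 1, P.φ ((2 : ℝ) ^ (-(n + i)) • ξ) = 1 := by
  have hξ : ξ ≠ 0 := by
    rintro rfl
    exact h (by rw [smul_zero, P.φ_zero])
  have h1 := (Equiv.addLeft n).hasSum_iff.2 (P.hasSum_φ hξ)
  refine HasSum.unique (hasSum_sum_of_ne_finset_zero fun i hi => ?_) h1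
  refine P.φ_eq_zero_of_ne_zero ?_ h
  rw [Finset.mem_Icc] at hi
  rw [le_abs]
  omega

theorem conv_ker_ker_eq_zero (h h' : Sym d) {j k : ℤ} (hjk : 2 ≤ |j - k|) :
    conv (P.ker h j) (P.ker h' k) = 0 := by
  refine fourier_injective fun ξ => ?_
  rw [fourier_conv, fourier_ker, fourier_ker]
  have h0 : 𝓕 (0 : 𝓢(E d, ℂ)) ξ = 0 := by
    rw [show 𝓕 (0 : 𝓢(E d, ℂ)) = 0 from FourierTransform.fourier_zero]
    rfl
  rw [h0]
  by_cases hz : P.φ ((2 : ℝ) ^ (-j) • ξ) = 0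
  · simp only [hz, Complex.ofReal_zero, zero_mul]
  · rw [P.φ_eq_zero_of_ne_zero hjk hz]; simp

theorem fourier_sum {ι : Type*} (s : Finset ι) (f : ι → 𝓢(E d, ℂ)) (ξ : E d) :
    𝓕 (∑ i ∈ s, f i) ξ = ∑ i ∈ s, 𝓕 (f i) ξ := by
  rw [show 𝓕 (∑ i ∈ s, f i) = ∑ i ∈ s, 𝓕 (f i) from
    map_sum (FourierTransform.fourierCLM ℂ 𝓢(E d, ℂ)) _ _]
  simp

theorem fourier_real_smul (c : ℝ) (f : 𝓢(E d, ℂ)) (ξ : E d) : 𝓕 (c • f) ξ = c • 𝓕 f ξ := by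
  rw [show 𝓕 (c • f) = c • 𝓕 f from FourierTransform.fourier_smul _ _]
  rfl

theorem ker_eq_sum_conv (h : Sym d) (n : ℤ) :
    P.ker h n = ∑ i ∈ Finset.Icc (-1 : ℤ) 1, conv (P.ker h n) (P.ker Sym.one (n + i)) := by
  refine fourier_injective fun ξ => ?_
  rw [fourier_sum]
  simp only [fourier_conv, fourier_ker, ← Finset.mul_sum]
  by_cases hz : P.φ ((2 : ℝ) ^ (-n) • ξ) = 0
  · simp only [hz, Complex.ofReal_zero, zero_mul]
  · have := P.sum_three_φ hz
    simp only [Sym.one, mul_one]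
    rw [← Complex.ofReal_sum, this]
    simp

theorem pd_ker (i : Fin d) (h : Sym d) (n : ℤ) :
    pd i (P.ker h n) = ((2 : ℝ) ^ n) • P.ker (h.mulX i) n := by
  refine fourier_injective fun ξ => ?_
  rw [fourier_pd, fourier_real_smul, fourier_ker, fourier_ker]
  simp only [Sym.mulX, PiLp.smul_apply, smul_eq_mul, Complex.real_smul]
  have : ((2 : ℂ) ^ n) * (2 : ℂ) ^ (-n) = 1 := by
    rw [← zpow_add₀ two_ne_zero]; simp
  push_cast
  linear_combination (-(2 * Real.pi * Complex.I * (ξ i : ℂ) *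
    ((P.φ ((2 : ℝ) ^ (-n) • ξ) : ℂ) * h.toFun ((2 : ℝ) ^ (-n) • ξ)))) * this

/-- Since Σ ξ_i² / |ξ|² = 1, and the symbol vanishes near the origin, each kernel is a divergence.
This converts a frequency 2^n into a gain 2^(-n), at the price of one derivative on another factor.
-/
theorem ker_eq_sum_pd (h : Sym d) (n : ℤ) :
    P.ker h n = ((2 : ℝ) ^ (-n)) • ∑ i, pd i (P.ker (h.divX i) n) := by
  refine fourier_injective fun ξ => ?_
  rw [fourier_real_smul, fourier_sum]
  simp only [fourier_pd, fourier_ker, Sym.divX]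
  by_cases hz : P.φ ((2 : ℝ) ^ (-n) • ξ) = 0
  · simp only [hz, Complex.ofReal_zero, zero_mul, mul_zero, Finset.sum_const_zero, smul_zero]
  have hξ : ξ ≠ 0 := by
    rintro rfl
    exact hz (by rw [smul_zero, P.φ_zero])
  set η : E d := (2 : ℝ) ^ (-n) • ξ with hη
  have hη0 : η ≠ 0 := smul_ne_zero (by positivity) hξ
  have hs : ∑ i, (η i : ℂ) * (η i : ℂ) = ((‖η‖ ^ 2 : ℝ) : ℂ) := by
    rw [EuclideanSpace.norm_sq_eq]
    push_cast
    refine Finset.sum_congr rfl fun i _ => ?_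
    rw [← Complex.ofReal_pow, Real.norm_eq_abs, sq_abs]; push_cast; ring
  have hn : ((‖η‖ ^ 2 : ℝ) : ℂ) * (((‖η‖ ^ 2)⁻¹ : ℝ) : ℂ) = 1 := by
    rw [← Complex.ofReal_mul, mul_inv_cancel₀ (pow_ne_zero _ (norm_ne_zero_iff.2 hη0))]; simp
  have hpi : (2 * Real.pi * Complex.I : ℂ) * (2 * Real.pi * Complex.I : ℂ)⁻¹ = 1 :=
    mul_inv_cancel₀ (by simp [Real.pi_ne_zero])
  rw [Finset.smul_sum]
  have : ∀ i, ((2 : ℝ) ^ (-n)) • (2 * Real.pi * Complex.I * (ξ i : ℂ) * ((P.φ η : ℂ) *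
      ((2 * Real.pi * Complex.I)⁻¹ * (η i : ℂ) * h.toFun η * (((‖η‖ ^ 2)⁻¹ : ℝ) : ℂ)))) =
      (η i : ℂ) * (η i : ℂ) * ((P.φ η : ℂ) * h.toFun η * (((‖η‖ ^ 2)⁻¹ : ℝ) : ℂ)) := fun i => by
    have hi : (η i : ℂ) = (((2 : ℝ) ^ (-n) : ℝ) : ℂ) * (ξ i : ℂ) := by
      rw [hη]; simp
    rw [Complex.real_smul]
    linear_combination (-(((2 : ℝ) ^ (-n) : ℝ) : ℂ) * (ξ i : ℂ) * (P.φ η : ℂ) * η i * h.toFun η *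
        (((‖η‖ ^ 2)⁻¹ : ℝ) : ℂ)) * (-hpi) + (-(η i : ℂ) * ((P.φ η : ℂ) * h.toFun η *
        (((‖η‖ ^ 2)⁻¹ : ℝ) : ℂ))) * hi
  rw [Finset.sum_congr rfl fun i _ => this i, ← Finset.sum_mul, hs]
  linear_combination (-(P.φ η : ℂ) * h.toFun η) * hn

/-- The Riesz symbol is homogeneous of degree zero. -/
theorem riesz_toFun_smul (i₀ : Fin d) (n : ℤ) (ξ : E d) :
    (Sym.riesz i₀).toFun ((2 : ℝ) ^ n • ξ) = (Sym.riesz i₀).toFun ξ := by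
  simp only [Sym.riesz, PiLp.smul_apply, norm_smul, smul_eq_mul]
  congr 2
  rw [Real.norm_of_nonneg (by positivity), mul_div_mul_left _ _ (by positivity)]

/-- The cancellation behind the commutator estimate. The Riesz symbol has degree zero, so it is the
same in the dilated variables of the q-th and the n-th kernels and may be attached to either. -/
theorem conv_ker_one_pd_riesz (i₀ i : Fin d) (q n : ℤ) :
    conv (P.ker Sym.one q) (pd i (P.ker (Sym.riesz i₀) n)) =
      conv (P.ker (Sym.riesz i₀) q) (pd i (P.ker Sym.one n)) := by
  refine fourier_injective fun ξ => ?_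
  simp only [fourier_conv, fourier_pd, fourier_ker, riesz_toFun_smul]
  simp only [Sym.one]
  ring

theorem lintegral_ker_mul (h : Sym d) (n : ℤ) {G : E d → ℝ≥0∞} (hG : Measurable G) :
    ∫⁻ z, ‖P.ker h n z‖ₑ * G z = ∫⁻ z, ‖P.ker h 0 z‖ₑ * G (((2 : ℝ) ^ (-n)) • z) :=
  lintegral_dilKer_mul _ _ hG

end DyadicPartition

/-! ### Decay of the dyadic pieces of a Schwartz function -/

theorem schwartz_decay_rpow (K : 𝓢(E d, ℂ)) {s : ℝ} :
    ∃ C : ℝ, 0 ≤ C ∧ ∀ x, ‖K x‖ ≤ C * (1 + ‖x‖) ^ (-s) := by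
  obtain ⟨N, hN⟩ := exists_nat_ge s
  obtain ⟨C, hC0, hC⟩ := schwartz_decay K N
  refine ⟨C, hC0, fun x => ?_⟩
  have h1 : 1 ≤ 1 + ‖x‖ := by linarith [norm_nonneg x]
  rw [Real.rpow_neg (by positivity), ← div_eq_mul_inv, le_div_iff₀ (by positivity)]
  calc ‖K x‖ * (1 + ‖x‖) ^ s ≤ ‖K x‖ * (1 + ‖x‖) ^ (N : ℝ) := by gcongr
    _ = ‖K x‖ * (1 + ‖x‖) ^ N := by rw [Real.rpow_natCast]
    _ ≤ C := hC x

theorem integrable_one_add_norm_rpow_mul (K : 𝓢(E d, ℂ)) (s : ℝ) :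
    Integrable fun y => (1 + ‖y‖) ^ s * ‖K y‖ := by
  obtain ⟨k, hk⟩ := (inferInstance :
    (volume : Measure (E d)).HasTemperateGrowth).exists_integrable
  obtain ⟨C, hC0, hC⟩ := schwartz_decay_rpow K (s := s + k)
  have hc : ∀ t : ℝ, Continuous fun x : E d => (1 + ‖x‖) ^ t := fun t =>
    Continuous.rpow_const (by fun_prop) fun x => .inl (by positivity)
  refine (hk.const_mul C).mono' ((hc s).mul K.continuous.norm).aestronglyMeasurable
    (Filter.Eventually.of_forall fun y => ?_)
  rw [Real.norm_of_nonneg (by positivity)]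
  calc (1 + ‖y‖) ^ s * ‖K y‖ ≤ (1 + ‖y‖) ^ s * (C * (1 + ‖y‖) ^ (-(s + k))) := by
        gcongr; exact hC y
    _ = C * ((1 + ‖y‖) ^ s * (1 + ‖y‖) ^ (-(s + k))) := by ring
    _ = _ := by rw [← Real.rpow_add (by positivity)]; ring_nf

theorem one_add_norm_sub_rpow_le {s : ℝ} (hs : 0 ≤ s) (x y : E d) :
    (1 + ‖x - y‖) ^ (-s) ≤ (1 + ‖x‖) ^ (-s) * (1 + ‖y‖) ^ s := by
  rw [Real.rpow_neg (by positivity), Real.rpow_neg (by positivity), inv_mul_eq_div,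
    le_div_iff₀ (by positivity), inv_mul_le_iff₀ (by positivity), ← Real.mul_rpow (by positivity)
    (by positivity)]
  exact Real.rpow_le_rpow (by positivity) (one_add_norm_le_mul x y) hs

theorem two_zpow_rpow (n : ℤ) (t : ℝ) : ((2 : ℝ) ^ n) ^ t = (2 : ℝ) ^ ((n : ℝ) * t) := by
  rw [← Real.rpow_intCast, ← Real.rpow_mul (by norm_num)]

theorem summable_two_rpow_neg_abs {c : ℝ} (hc : 0 < c) :
    Summable fun n : ℤ => (2 : ℝ) ^ (-c * |(n : ℝ)|) := by
  have h : Summable fun n : ℕ => ((2 : ℝ) ^ (-c)) ^ n :=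
    summable_geometric_of_lt_one (by positivity)
      (Real.rpow_lt_one_of_one_lt_of_neg one_lt_two (by linarith))
  refine Summable.of_nat_of_neg (h.congr fun n => ?_) (h.congr fun n => ?_) <;>
  · rw [← Real.rpow_natCast, ← Real.rpow_mul (by norm_num)]
    simp

namespace DyadicPartition

variable (P : DyadicPartition d)

theorem integral_ker_mul (h : Sym d) (n : ℤ) (G : E d → ℝ) :
    ∫ z, ‖P.ker h n z‖ * G z = ∫ z, ‖P.ker h 0 z‖ * G (((2 : ℝ) ^ (-n)) • z) := by
  have hpos : 0 < ((2 : ℝ) ^ n) ^ d := by positivity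
  have := Measure.integral_comp_smul_of_nonneg (μ := (volume : Measure (E d)))
    (fun z => ‖P.ker h 0 z‖ * G (((2 : ℝ) ^ (-n)) • z)) ((2 : ℝ) ^ n) (hR := by positivity)
  simp only [smul_smul, ← zpow_add₀ (two_ne_zero (α := ℝ)), neg_add_cancel, zpow_zero, one_smul,
    finrank_euclideanSpace, Fintype.card_fin] at this
  rw [eq_inv_smul_iff₀ hpos.ne', smul_eq_mul, ← integral_const_mul] at this
  rw [← this]
  refine integral_congr_ae (Filter.Eventually.of_forall fun z => ?_)
  simp only []
  rw [P.ker_apply h n, norm_smul, Real.norm_of_nonneg hpos.le]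
  ring

/-- A kernel of frequency 2^n ≤ 1 has amplitude 2^(nd) and lives at scale 2^(-n). Comparing its
decay with (1 + |x|)^(-s) costs 2^(-ns), so the bounds are summable at n → −∞ when s < d. -/
theorem conv_ker_low (h : Sym d) (g : 𝓢(E d, ℂ)) {s : ℝ} (hs : 0 ≤ s) :
    ∃ C : ℝ, 0 ≤ C ∧ ∀ n : ℤ, n ≤ 0 → ∀ x,
      ‖conv (P.ker h n) g x‖ ≤ C * (2 : ℝ) ^ ((n : ℝ) * (d - s)) * (1 + ‖x‖) ^ (-s) := by
  obtain ⟨C, hC0, hC⟩ := schwartz_decay_rpow (P.ker h 0) (s := s)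
  have hI := integrable_one_add_norm_rpow_mul g s
  refine ⟨C * ∫ y, (1 + ‖y‖) ^ s * ‖g y‖,
    mul_nonneg hC0 (integral_nonneg fun y => by positivity), fun n hn x => ?_⟩
  have h2n : (2 : ℝ) ^ n ≤ 1 := zpow_le_one_of_nonpos₀ one_le_two hn
  have hker : ∀ w : E d, ‖P.ker h n w‖ ≤ C * (2 : ℝ) ^ ((n : ℝ) * (d - s)) * (1 + ‖w‖) ^ (-s) :=
    fun w => by
      rw [P.ker_apply h n, norm_smul, Real.norm_of_nonneg (by positivity)]
      have h1 : (1 + ‖(2 : ℝ) ^ n • w‖) ^ (-s) ≤ ((2 : ℝ) ^ n) ^ (-s) * (1 + ‖w‖) ^ (-s) := by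
        rw [← Real.mul_rpow (by positivity) (by positivity)]
        refine Real.rpow_le_rpow_of_nonpos (by positivity) ?_ (by linarith)
        rw [norm_smul, Real.norm_of_nonneg (by positivity)]
        nlinarith [norm_nonneg w]
      calc ((2 : ℝ) ^ n) ^ d * ‖P.ker h 0 ((2 : ℝ) ^ n • w)‖
          ≤ ((2 : ℝ) ^ n) ^ d * (C * (((2 : ℝ) ^ n) ^ (-s) * (1 + ‖w‖) ^ (-s))) := by
            gcongr; exact (hC _).trans (by gcongr)
        _ = C * (((2 : ℝ) ^ n) ^ (d : ℝ) * ((2 : ℝ) ^ n) ^ (-s)) * (1 + ‖w‖) ^ (-s) := by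
            rw [Real.rpow_natCast]; ring
        _ = _ := by rw [← Real.rpow_add (by positivity), two_zpow_rpow, sub_eq_add_neg]
  rw [conv_apply]
  calc ‖∫ y, P.ker h n (x - y) * g y‖
      ≤ ∫ y, (C * (2 : ℝ) ^ ((n : ℝ) * (d - s)) * (1 + ‖x‖) ^ (-s)) *
        ((1 + ‖y‖) ^ s * ‖g y‖) := by
        refine norm_integral_le_of_norm_le (hI.const_mul _) (Filter.Eventually.of_forall fun y => ?_)
        rw [norm_mul]
        calc _ ≤ (C * (2 : ℝ) ^ ((n : ℝ) * (d - s)) * ((1 + ‖x‖) ^ (-s) * (1 + ‖y‖) ^ s)) * ‖g y‖ := by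
              gcongr
              exact (hker _).trans (by gcongr; exact one_add_norm_sub_rpow_le hs x y)
          _ = _ := by ring
    _ = _ := by rw [integral_const_mul]; ring

/-- The bound without gain is uniform in n ≥ 0, because kernels of high frequency concentrate at the
origin. The factor 2^(-n) appears by writing the kernel as a divergence and moving the derivative to
g. -/
theorem conv_ker_high (h : Sym d) (g : 𝓢(E d, ℂ)) {s : ℝ} (hs : 0 ≤ s) :
    ∃ C : ℝ, 0 ≤ C ∧ ∀ n : ℤ, 0 ≤ n → ∀ x,
      ‖conv (P.ker h n) g x‖ ≤ C * (2 : ℝ) ^ (-(n : ℝ)) * (1 + ‖x‖) ^ (-s) := by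
  have base : ∀ (h : Sym d) (g : 𝓢(E d, ℂ)), ∃ C : ℝ, 0 ≤ C ∧ ∀ n : ℤ, 0 ≤ n → ∀ x,
      ‖conv (P.ker h n) g x‖ ≤ C * (1 + ‖x‖) ^ (-s) := fun h g => by
    obtain ⟨C, hC0, hC⟩ := schwartz_decay_rpow g (s := s)
    have hI0 := integrable_one_add_norm_rpow_mul (P.ker h 0) s
    refine ⟨C * ∫ z, (1 + ‖z‖) ^ s * ‖P.ker h 0 z‖,
      mul_nonneg hC0 (integral_nonneg fun y => by positivity), fun n hn x => ?_⟩
    have hI := integrable_one_add_norm_rpow_mul (P.ker h n) s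
    have h2n : (2 : ℝ) ^ (-n) ≤ 1 := zpow_le_one_of_nonpos₀ one_le_two (by omega)
    have h1 : ∫ z, (1 + ‖z‖) ^ s * ‖P.ker h n z‖ ≤ ∫ z, (1 + ‖z‖) ^ s * ‖P.ker h 0 z‖ := by
      have e := P.integral_ker_mul h n fun z => (1 + ‖z‖) ^ s
      simp only [mul_comm ‖P.ker h _ _‖] at e
      rw [e]
      refine integral_mono_of_nonneg (Filter.Eventually.of_forall fun z => by positivity) hI0
        (Filter.Eventually.of_forall fun z => ?_)
      simp only []
      gcongr
      rw [norm_smul, Real.norm_of_nonneg (by positivity)]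
      nlinarith [norm_nonneg z]
    rw [conv_apply']
    calc ‖∫ y, P.ker h n y * g (x - y)‖
        ≤ ∫ y, (C * (1 + ‖x‖) ^ (-s)) * ((1 + ‖y‖) ^ s * ‖P.ker h n y‖) := by
          refine norm_integral_le_of_norm_le (hI.const_mul _)
            (Filter.Eventually.of_forall fun y => ?_)
          rw [norm_mul]
          calc _ ≤ ‖P.ker h n y‖ * (C * ((1 + ‖x‖) ^ (-s) * (1 + ‖y‖) ^ s)) := by
                gcongr
                exact (hC _).trans (by gcongr; exact one_add_norm_sub_rpow_le hs x y)
            _ = _ := by ring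
      _ = (C * (1 + ‖x‖) ^ (-s)) * ∫ y, (1 + ‖y‖) ^ s * ‖P.ker h n y‖ := integral_const_mul _ _
      _ ≤ (C * (1 + ‖x‖) ^ (-s)) * ∫ y, (1 + ‖y‖) ^ s * ‖P.ker h 0 y‖ := by gcongr
      _ = _ := by ring
  choose C hC0 hC using fun i : Fin d => base (h.divX i) (pd i g)
  refine ⟨∑ i, C i, Finset.sum_nonneg fun i _ => hC0 i, fun n hn x => ?_⟩
  have e : conv (P.ker h n) g = ((2 : ℝ) ^ (-n)) • ∑ i, conv (P.ker (h.divX i) n) (pd i g) := by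
    refine fourier_injective fun ξ => ?_
    conv_lhs => rw [P.ker_eq_sum_pd h n]
    simp only [fourier_conv, fourier_real_smul, fourier_sum, fourier_pd, smul_mul_assoc,
      Finset.sum_mul]
    congr 1
    exact Finset.sum_congr rfl fun i _ => by ring
  have e2 : conv (P.ker h n) g x
      = ((2 : ℝ) ^ (-n)) • ∑ i, conv (P.ker (h.divX i) n) (pd i g) x := by
    rw [e]
    simp
  have e3 : (2 : ℝ) ^ (-n) = (2 : ℝ) ^ (-(n : ℝ)) := by
    rw [← Real.rpow_intCast]; simp
  rw [e2, norm_smul, Real.norm_of_nonneg (by positivity), e3]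
  calc _ ≤ (2 : ℝ) ^ (-(n : ℝ)) * ∑ i, C i * (1 + ‖x‖) ^ (-s) := by
        gcongr
        exact (norm_sum_le _ _).trans (Finset.sum_le_sum fun i _ => hC i n hn x)
    _ = _ := by rw [← Finset.sum_mul]; ring

theorem exists_conv_ker_le (h : Sym d) (g : 𝓢(E d, ℂ)) {s : ℝ} (hs : 0 ≤ s) (hsd : s < d) :
    ∃ u : ℤ → ℝ, Summable u ∧ ∀ n x, ‖conv (P.ker h n) g x‖ ≤ u n * (1 + ‖x‖) ^ (-s) := by
  obtain ⟨A, hA0, hA⟩ := P.conv_ker_low h g hs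
  obtain ⟨B, hB0, hB⟩ := P.conv_ker_high h g hs
  have hc : 0 < min ((d : ℝ) - s) 1 := lt_min (by linarith) one_pos
  refine ⟨fun n => (A + B) * (2 : ℝ) ^ (-(min ((d : ℝ) - s) 1) * |(n : ℝ)|),
    (summable_two_rpow_neg_abs hc).mul_left _, fun n x => ?_⟩
  rcases le_total n 0 with hn | hn
  · refine (hA n hn x).trans ?_
    have hn' : (n : ℝ) ≤ 0 := by exact_mod_cast hn
    refine mul_le_mul_of_nonneg_right (mul_le_mul (by linarith)
      (Real.rpow_le_rpow_of_exponent_le one_le_two ?_) (by positivity) (by linarith)) (by positivity)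
    rw [abs_of_nonpos hn']
    nlinarith [min_le_left ((d : ℝ) - s) 1]
  · refine (hB n hn x).trans ?_
    have hn' : 0 ≤ (n : ℝ) := by exact_mod_cast hn
    refine mul_le_mul_of_nonneg_right (mul_le_mul (by linarith)
      (Real.rpow_le_rpow_of_exponent_le one_le_two ?_) (by positivity) (by linarith)) (by positivity)
    rw [abs_of_nonneg hn']
    nlinarith [min_le_right ((d : ℝ) - s) 1]

theorem pd_conv_ker_apply (i : Fin d) (h : Sym d) (g : 𝓢(E d, ℂ)) (n : ℤ) (x : E d) :
    pd i (conv (P.ker h n) g) x = ((2 : ℝ) ^ n) • conv (P.ker (h.mulX i) n) g x := by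
  have : pd i (conv (P.ker h n) g) = ((2 : ℝ) ^ n) • conv (P.ker (h.mulX i) n) g := by
    refine fourier_injective fun ξ => ?_
    rw [pd_conv_left, fourier_conv, P.pd_ker, fourier_real_smul, fourier_real_smul, fourier_conv,
      smul_mul_assoc]
  rw [this]; rfl

/-- For n ≤ 0 the derivative falls on the kernel and gains 2^n, which raises the admissible decay
from s < d to s < d + 1; for n ≥ 0 it falls on g. Summed over n, this is the decay of ∇(R g), just
short of |x|^(-d-1). -/
theorem exists_pd_conv_ker_le (i : Fin d) (h : Sym d) (g : 𝓢(E d, ℂ)) {s : ℝ} (hs : 0 ≤ s)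
    (hsd : s < d + 1) :
    ∃ u : ℤ → ℝ, Summable u ∧
      ∀ n x, ‖pd i (conv (P.ker h n) g) x‖ ≤ u n * (1 + ‖x‖) ^ (-s) := by
  obtain ⟨A, hA0, hA⟩ := P.conv_ker_low (h.mulX i) g hs
  obtain ⟨B, hB0, hB⟩ := P.conv_ker_high h (pd i g) hs
  have hc : 0 < min ((d : ℝ) + 1 - s) 1 := lt_min (by linarith) one_pos
  refine ⟨fun n => (A + B) * (2 : ℝ) ^ (-(min ((d : ℝ) + 1 - s) 1) * |(n : ℝ)|),
    (summable_two_rpow_neg_abs hc).mul_left _, fun n x => ?_⟩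
  rcases le_total n 0 with hn | hn
  · have hn' : (n : ℝ) ≤ 0 := by exact_mod_cast hn
    rw [P.pd_conv_ker_apply, norm_smul, Real.norm_of_nonneg (by positivity)]
    have e : (2 : ℝ) ^ n * (2 : ℝ) ^ ((n : ℝ) * (d - s)) = (2 : ℝ) ^ ((n : ℝ) * (d + 1 - s)) := by
      rw [← Real.rpow_intCast, ← Real.rpow_add two_pos]; ring_nf
    calc _ ≤ (2 : ℝ) ^ n * (A * (2 : ℝ) ^ ((n : ℝ) * (d - s)) * (1 + ‖x‖) ^ (-s)) := by
          gcongr; exact hA n hn x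
      _ = A * (2 : ℝ) ^ ((n : ℝ) * (d + 1 - s)) * (1 + ‖x‖) ^ (-s) := by rw [← e]; ring
      _ ≤ _ := by
          refine mul_le_mul_of_nonneg_right (mul_le_mul (by linarith)
            (Real.rpow_le_rpow_of_exponent_le one_le_two ?_) (by positivity) (by linarith)) (by positivity)
          rw [abs_of_nonpos hn']
          nlinarith [min_le_left ((d : ℝ) + 1 - s) 1]
  · rw [pd_conv_right]
    refine (hB n hn x).trans ?_
    have hn' : 0 ≤ (n : ℝ) := by exact_mod_cast hn
    refine mul_le_mul_of_nonneg_right (mul_le_mul (by linarith)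
      (Real.rpow_le_rpow_of_exponent_le one_le_two ?_) (by positivity) (by linarith)) (by positivity)
    rw [abs_of_nonneg hn']
    nlinarith [min_le_right ((d : ℝ) + 1 - s) 1]

end DyadicPartition

/-! ### Summation of the dyadic pieces of a homogeneous multiplier -/

/-- Dominated convergence for series bounded by a summable sequence times an integrable function. -/
theorem hasSum_integral_of_summable_bound {ι X : Type*} [Countable ι] [MeasurableSpace X]
    {μ : Measure X} {F : ι → X → ℂ} {f : X → ℂ} {G : X → ℝ} {u : ι → ℝ}
    (hF : ∀ n, AEStronglyMeasurable (F n) μ) (hu : Summable u) (hG : Integrable G μ)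
    (hb : ∀ n x, ‖F n x‖ ≤ u n * G x) (hs : ∀ᵐ x ∂μ, HasSum (fun n => F n x) (f x)) :
    Integrable f μ ∧ HasSum (fun n => ∫ x, F n x ∂μ) (∫ x, f x ∂μ) := by
  refine ⟨?_, hasSum_integral_of_dominated_convergence (fun n x => u n * G x) hF
    (fun n => Filter.Eventually.of_forall (hb n))
    (Filter.Eventually.of_forall fun x => hu.mul_right _) ?_ hs⟩
  · have hm : AEStronglyMeasurable f μ :=
      aestronglyMeasurable_of_tendsto_ae Filter.atTop
        (f := fun (s : Finset ι) x => ∑ n ∈ s, F n x)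
        (fun s => by
          have := Finset.aestronglyMeasurable_sum s fun n _ => hF n
          refine this.congr (Filter.Eventually.of_forall fun x => ?_)
          simp) hs
    refine (hG.const_mul (∑' n, u n)).mono' hm ?_
    filter_upwards [hs] with x hx
    rw [← hx.tsum_eq]
    have h := hu.mul_right (G x)
    rw [← tsum_mul_right]
    exact tsum_of_norm_bounded h.hasSum fun n => hb n x
  · simp_rw [tsum_mul_right]
    exact hG.const_mul _

theorem norm_clm_le_sum {F : Type*} [NormedAddCommGroup F] [NormedSpace ℝ F]
    (L : E d →L[ℝ] F) : ‖L‖ ≤ ∑ i, ‖L (EuclideanSpace.single i 1)‖ := by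
  refine L.opNorm_le_bound (Finset.sum_nonneg fun i _ => norm_nonneg _) fun w => ?_
  rw [fderiv_eq_sum L w, Finset.sum_mul]
  refine (norm_sum_le _ _).trans (Finset.sum_le_sum fun i _ => ?_)
  rw [norm_smul, mul_comm]
  gcongr
  exact PiLp.norm_apply_le w i

theorem convection_eq_sum (v : E d → E d) (f : 𝓢(E d, ℂ)) (x : E d) :
    convection v f x = ∑ i, (v x i : ℂ) * pd i f x := by
  rw [convection, fderiv_eq_sum]
  simp [pd_apply]

/-! ### Homogeneous symbols and their multipliers -/

namespace Sym

/-- A bounded symbol that is invariant under dyadic dilations. -/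
structure IsHomogeneous (h : Sym d) : Prop where
  smul : ∀ (n : ℤ) ξ, h.toFun ((2 : ℝ) ^ n • ξ) = h.toFun ξ
  norm_le : ∀ ξ, ‖h.toFun ξ‖ ≤ 1
  measurable : Measurable h.toFun

theorem isHomogeneous_one : (one : Sym d).IsHomogeneous :=
  ⟨fun _ _ => rfl, fun _ => by simp [one], measurable_const⟩

theorem isHomogeneous_riesz (i₀ : Fin d) : (riesz i₀).IsHomogeneous :=
  ⟨fun n ξ => DyadicPartition.riesz_toFun_smul i₀ n ξ, fun ξ => by
    simp only [riesz, norm_mul, Complex.norm_I, one_mul, Complex.norm_real, norm_div, norm_norm]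
    exact div_le_one_of_le₀ (PiLp.norm_apply_le ξ i₀) (norm_nonneg _), by
    unfold riesz
    fun_prop⟩

/-- The Fourier multiplier of a symbol, on Schwartz functions. -/
noncomputable def mult (h : Sym d) (g : 𝓢(E d, ℂ)) : E d → ℂ :=
  𝓕⁻ fun ξ : E d => h.toFun ξ * 𝓕 g ξ

theorem mult_riesz (i₀ : Fin d) (g : 𝓢(E d, ℂ)) :
    (riesz i₀).mult g = RieszCommutator.riesz i₀ g := rfl

theorem mult_one (g : 𝓢(E d, ℂ)) : (one : Sym d).mult g = g := by
  simp only [mult, one, one_mul]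
  rw [← SchwartzMap.fourierInv_coe, FourierTransform.fourierInv_fourier_eq]

end Sym

namespace DyadicPartition

variable (P : DyadicPartition d)

/-- Dominated convergence on the Fourier side. As φ ≥ 0, the dominating series sums exactly to |𝓕
g|. The partition fails only at ξ = 0, a null set because the dimension is positive. -/
theorem hasSum_conv_ker [Nonempty (Fin d)] {h : Sym d} (hh : h.IsHomogeneous) (g : 𝓢(E d, ℂ))
    (x : E d) : HasSum (fun n : ℤ => conv (P.ker h n) g x) (h.mult g x) := by
  have h1 : ∀ n : ℤ, conv (P.ker h n) g x = ∫ ξ : E d,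
      Complex.exp ((↑(2 * Real.pi * inner ℝ ξ x) * Complex.I)) •
        ((P.φ ((2 : ℝ) ^ (-n) • ξ) : ℂ) * (h.toFun ξ * 𝓕 g ξ)) := fun n => by
    rw [← FourierTransform.fourierInv_fourier_eq (E := 𝓢(E d, ℂ)) (F := 𝓢(E d, ℂ))
      (conv (P.ker h n) g), SchwartzMap.fourierInv_coe, Real.fourierInv_eq']
    refine integral_congr_ae (Filter.Eventually.of_forall fun ξ => ?_)
    simp only [fourier_conv, fourier_ker, hh.smul, mul_assoc]
  have hexp : ∀ ξ : E d, ‖Complex.exp ((↑(2 * Real.pi * inner ℝ ξ x) * Complex.I))‖ = 1 :=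
    fun ξ => Complex.norm_exp_ofReal_mul_I _
  simp_rw [h1]
  rw [Sym.mult, Real.fourierInv_eq']
  have hφ : ∀ᵐ ξ : E d, HasSum (fun n : ℤ => P.φ ((2 : ℝ) ^ (-n) • ξ)) 1 := by
    filter_upwards [(measure_singleton (μ := (volume : Measure (E d))) 0 :
      volume {(0 : E d)} = 0) |> fun h => (measure_eq_zero_iff_ae_notMem.1 h)] with ξ hξ
    exact P.hasSum_φ hξ
  have hg := (𝓕 g).integrable (μ := volume) |>.norm
  refine hasSum_integral_of_dominated_convergence
    (fun n ξ => P.φ ((2 : ℝ) ^ (-n) • ξ) * ‖𝓕 g ξ‖) (fun n => ?_) (fun n => ?_) ?_ ?_ ?_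
  · have c1 : Continuous fun ξ : E d => Complex.exp ((↑(2 * Real.pi * inner ℝ ξ x) * Complex.I)) := by
      fun_prop
    have c2 : Continuous fun ξ : E d => (P.φ ((2 : ℝ) ^ (-n) • ξ) : ℂ) := by
      have := P.φ_smooth.continuous
      fun_prop
    have c3 : Continuous ⇑(𝓕 g : 𝓢(E d, ℂ)) := (𝓕 g : 𝓢(E d, ℂ)).continuous
    exact (c1.measurable.smul (c2.measurable.mul
      (hh.measurable.mul c3.measurable))).aestronglyMeasurable
  · refine Filter.Eventually.of_forall fun ξ => ?_
    rw [norm_smul, hexp, one_mul, norm_mul, norm_mul, Complex.norm_real,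
      Real.norm_of_nonneg (P.φ_nonneg _)]
    have := mul_le_mul_of_nonneg_right (hh.norm_le ξ) (norm_nonneg (𝓕 g ξ))
    rw [one_mul] at this
    exact mul_le_mul_of_nonneg_left this (P.φ_nonneg _)
  · filter_upwards [hφ] with ξ hξ
    exact hξ.summable.mul_right _
  · refine hg.congr ?_
    filter_upwards [hφ] with ξ hξ
    rw [tsum_mul_right, hξ.tsum_eq, one_mul]
  · filter_upwards [hφ] with ξ hξ
    have := (Complex.hasSum_ofReal.2 hξ).mul_right (h.toFun ξ * 𝓕 g ξ)
    rw [Complex.ofReal_one, one_mul] at this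
    exact this.const_smul _

theorem exists_fderiv_conv_ker_le (h : Sym d) (g : 𝓢(E d, ℂ)) {s : ℝ} (hs : 0 ≤ s)
    (hsd : s < d + 1) :
    ∃ u : ℤ → ℝ, Summable u ∧
      ∀ n x, ‖fderiv ℝ (conv (P.ker h n) g) x‖ ≤ u n * (1 + ‖x‖) ^ (-s) := by
  choose u hu hb using fun i => P.exists_pd_conv_ker_le i h g hs hsd
  refine ⟨fun n => ∑ i, u i n, summable_sum fun i _ => hu i, fun n x => ?_⟩
  rw [Finset.sum_mul]
  refine (norm_clm_le_sum _).trans (Finset.sum_le_sum fun i _ => ?_)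
  rw [← pd_apply]
  exact hb i n x

/-- With s = 0 the previous bound says that the series of derivatives converges uniformly, which
allows termwise differentiation. -/
theorem hasSum_fderiv_conv_ker [Nonempty (Fin d)] {h : Sym d} (hh : h.IsHomogeneous)
    (g : 𝓢(E d, ℂ)) (x : E d) :
    HasSum (fun n : ℤ => fderiv ℝ (conv (P.ker h n) g) x) (fderiv ℝ (h.mult g) x) := by
  obtain ⟨u, hu, hb⟩ := P.exists_fderiv_conv_ker_le h g le_rfl (by positivity)
  have hb' : ∀ n x, ‖fderiv ℝ (conv (P.ker h n) g) x‖ ≤ u n := fun n x => by simpa using hb n x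
  have e : h.mult g = fun x => ∑' n : ℤ, conv (P.ker h n) g x :=
    funext fun x => (P.hasSum_conv_ker hh g x).tsum_eq.symm
  have := hasFDerivAt_tsum hu (fun n x => (conv (P.ker h n) g).hasFDerivAt x) hb'
    (P.hasSum_conv_ker hh g 0).summable x
  rw [e, this.fderiv]
  exact (Summable.of_norm_bounded hu fun n => hb' n x).hasSum

theorem exists_convection_conv_ker_le (h : Sym d) (g : 𝓢(E d, ℂ)) {s : ℝ} (hs : 0 ≤ s)
    (hsd : s < d + 1) (v : E d → E d) :
    ∃ u : ℤ → ℝ, Summable u ∧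
      ∀ n x, ‖convection v (conv (P.ker h n) g) x‖ ≤ u n * (‖v x‖ * (1 + ‖x‖) ^ (-s)) := by
  obtain ⟨u, hu, hb⟩ := P.exists_fderiv_conv_ker_le h g hs hsd
  refine ⟨u, hu, fun n x => ?_⟩
  calc _ ≤ ‖fderiv ℝ (conv (P.ker h n) g) x‖ * ‖v x‖ := ContinuousLinearMap.le_opNorm _ _
    _ ≤ (u n * (1 + ‖x‖) ^ (-s)) * ‖v x‖ := by gcongr; exact hb n x
    _ = _ := by ring

theorem hasSum_convection_conv_ker [Nonempty (Fin d)] {h : Sym d} (hh : h.IsHomogeneous)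
    (g : 𝓢(E d, ℂ)) (v : E d → E d) (x : E d) :
    HasSum (fun n : ℤ => convection v (conv (P.ker h n) g) x) (convection v (h.mult g) x) :=
  (P.hasSum_fderiv_conv_ker hh g x).mapL (ContinuousLinearMap.apply ℝ ℂ (v x))

end DyadicPartition

/-! ### The Littlewood-Paley decomposition in `L^p`, tested against `L^{p'}` -/

theorem memLp_one_add_norm_rpow {q : ℝ≥0∞} (hq : q ≠ ⊤) (hq0 : q ≠ 0) {s : ℝ}
    (h : d < s * q.toReal) : MemLp (fun x : E d => (1 + ‖x‖) ^ (-s)) q volume := by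
  have hc : Continuous fun x : E d => (1 + ‖x‖) ^ (-s) :=
    Continuous.rpow_const (by fun_prop) fun x => .inl (by positivity)
  rw [← integrable_norm_rpow_iff hc.aestronglyMeasurable hq0 hq]
  have := integrable_one_add_norm (E := E d) (μ := volume) (r := s * q.toReal) (by simpa using h)
  refine this.congr (Filter.Eventually.of_forall fun x => ?_)
  simp only []
  rw [Real.norm_of_nonneg (by positivity), ← Real.rpow_mul (by positivity), neg_mul]

theorem one_lt_conjExponent_toReal {p p' : ℝ≥0∞} [hpp : p.HolderConjugate p'] (hp : 1 < p)
    (hpt : p ≠ ⊤) : p' ≠ ⊤ ∧ 1 < p'.toReal := by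
  have hpp' : p'.HolderConjugate p := ENNReal.HolderTriple.symm
  have hp'1 : 1 ≤ p' := ENNReal.HolderConjugate.one_le p' p
  have hp't : p' ≠ ⊤ := fun h =>
    hp.ne' ((ENNReal.HolderConjugate.eq_top_iff_eq_one p' p).1 h)
  refine ⟨hp't, ?_⟩
  rw [← ENNReal.toReal_one, ENNReal.toReal_lt_toReal (by simp) hp't]
  exact lt_of_le_of_ne hp'1 fun h =>
    hpt ((ENNReal.HolderConjugate.eq_top_iff_eq_one p p').2 h.symm)

theorem exists_memLp_one_add_norm_rpow (hd : 0 < d) {p p' : ℝ≥0∞} [p.HolderConjugate p']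
    (hp : 1 < p) (hpt : p ≠ ⊤) :
    ∃ s : ℝ, 0 ≤ s ∧ s < d ∧ MemLp (fun x : E d => (1 + ‖x‖) ^ (-s)) p' volume := by
  obtain ⟨hp't, hp'r⟩ := one_lt_conjExponent_toReal (p' := p') hp hpt
  have hd' : (0 : ℝ) < d := by exact_mod_cast hd
  have : (d : ℝ) / p'.toReal < d := div_lt_self hd' hp'r
  obtain ⟨s, h1, h2⟩ := exists_between this
  refine ⟨s, le_trans (by positivity) h1.le, h2, memLp_one_add_norm_rpow hp't ?_ ?_⟩
  · rintro rfl
    simp at hp'r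
    linarith
  · rwa [div_lt_iff₀ (by linarith)] at h1

theorem enorm_integral_mul_le {p p' : ℝ≥0∞} [p.HolderConjugate p'] {f g : E d → ℂ}
    (hf : AEStronglyMeasurable f volume) (hg : AEStronglyMeasurable g volume) :
    ‖∫ x, f x * g x‖ₑ ≤ eLpNorm f p volume * eLpNorm g p' volume := by
  have h := eLpNorm_smul_le_mul_eLpNorm (p := p) (q := p') (r := 1) hg hf
  rw [eLpNorm_one_eq_lintegral_enorm] at h
  exact (enorm_integral_le_lintegral_enorm _).trans h

theorem tendsto_Ico_neg_atTop :
    Filter.Tendsto (fun Q : ℕ => Finset.Ico (-(Q : ℤ)) Q) Filter.atTop Filter.atTop := by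
  refine Filter.tendsto_atTop_finset_of_monotone (fun a b hab x hx => ?_) fun x => ?_
  · rw [Finset.mem_Ico] at hx ⊢
    omega
  · exact ⟨x.natAbs + 1, by rw [Finset.mem_Ico]; omega⟩

theorem TemperateInt.corr_sum {ι : Type*} {f : E d → ℂ} (hf : TemperateInt f) (s : Finset ι)
    (K : ι → 𝓢(E d, ℂ)) (y : E d) :
    corr (∑ i ∈ s, K i) f y = ∑ i ∈ s, corr (K i) f y := by
  simp only [corr, sum_apply, Finset.mul_sum]
  exact integral_finsetSum _ fun i _ => hf.integrable_mul_sub (K i) y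

theorem memLp_corr {f : E d → ℂ} (hf : Continuous f) {p : ℝ≥0∞} (hp : 1 ≤ p)
    (hfp : MemLp f p volume) (K : 𝓢(E d, ℂ)) : MemLp (corr K f) p volume :=
  ⟨((temperateInt_of_memLp hp hfp).differentiable_corr K).continuous.aestronglyMeasurable,
    (eLpNorm_corr_le hf.measurable K hp).trans_lt (ENNReal.mul_lt_top K.integrable.2 hfp.2)⟩

theorem lintegral_dilKer (m : 𝓢(E d, ℂ)) (n : ℤ) :
    ∫⁻ z, ‖dilKer m n z‖ₑ = ∫⁻ z, ‖dilKer m 0 z‖ₑ := by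
  simpa using lintegral_dilKer_mul m n (G := fun _ => 1) measurable_const

namespace DyadicPartition

variable (P : DyadicPartition d)

/-- The low frequency cut-off as a Schwartz function. -/
noncomputable def lowSym : 𝓢(E d, ℂ) :=
  HasCompactSupport.toSchwartzMap (f := fun ξ => (P.χ ξ : ℂ))
    (P.χ_compact.comp_left (g := fun x : ℝ => (x : ℂ)) rfl)
    (Complex.ofRealCLM.contDiff.comp P.χ_smooth)

/-- Compare the partition of unity at ξ and at ξ/2. Consequently sums of consecutive blocks
telescope to a difference of two low-frequency cut-offs. -/
theorem φ_eq_χ_sub (ξ : E d) : P.φ ξ = P.χ ((2 : ℝ)⁻¹ • ξ) - P.χ ξ := by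
  have h1 := (P.partition ξ).tsum_eq
  have h2 := (P.partition ((2 : ℝ)⁻¹ • ξ)).tsum_eq
  rw [(P.partition ξ).summable.tsum_eq_zero_add] at h1
  have e : ∀ q : ℕ, (2 : ℝ) ^ (-(q : ℤ)) • (2 : ℝ)⁻¹ • ξ = (2 : ℝ) ^ (-((q + 1 : ℕ) : ℤ)) • ξ :=
    fun q => by
      rw [smul_smul, ← zpow_neg_one, ← zpow_add₀ two_ne_zero]
      congr 2
      push_cast
      ring
  simp_rw [e] at h2
  rw [h2] at h1
  simp only [Nat.cast_zero, neg_zero, zpow_zero, one_smul] at h1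
  linarith

theorem ker_one_eq_sub (q : ℤ) :
    P.ker Sym.one q = dilKer P.lowSym (q + 1) - dilKer P.lowSym q := by
  refine fourier_injective fun ξ => ?_
  rw [show 𝓕 (dilKer P.lowSym (q + 1) - dilKer P.lowSym q)
    = 𝓕 (dilKer P.lowSym (q + 1)) - 𝓕 (dilKer P.lowSym q) from
    map_sub (FourierTransform.fourierCLM ℂ 𝓢(E d, ℂ)) _ _, sub_apply, fourier_dilKer,
    fourier_dilKer, fourier_ker]
  have := P.φ_eq_χ_sub ((2 : ℝ) ^ (-q) • ξ)
  rw [smul_smul, ← zpow_neg_one, ← zpow_add₀ two_ne_zero] at this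
  rw [this, show -(q + 1) = -1 + -q by ring]
  simp only [Sym.one, mul_one, Complex.ofReal_sub]
  rfl

theorem sum_ker_one (Q : ℕ) : ∑ q ∈ Finset.Ico (-(Q : ℤ)) Q, P.ker Sym.one q
    = dilKer P.lowSym Q - dilKer P.lowSym (-Q) := by
  induction Q with
  | zero => simp
  | succ Q ih =>
    have : Finset.Ico (-((Q + 1 : ℕ) : ℤ)) ((Q + 1 : ℕ) : ℤ)
        = insert (-((Q : ℤ) + 1)) (insert (Q : ℤ) (Finset.Ico (-(Q : ℤ)) Q)) := by
      ext x
      simp only [Finset.mem_Ico, Finset.mem_insert]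
      push_cast
      omega
    rw [this, Finset.sum_insert (by simp), Finset.sum_insert (by simp), ih,
      P.ker_one_eq_sub, P.ker_one_eq_sub]
    push_cast
    rw [show -((Q : ℤ) + 1) + 1 = -Q by ring]
    abel

/-- For a Schwartz function in place of f the series converges absolutely; the general case follows
by density in L^p', since the telescoped partial sums are bounded on L^p uniformly in Q. Finiteness
of p gives p' > 1, hence a weight in L^p' with s < d; p > 1 gives p' < ∞, hence the density. -/
theorem tendsto_sum_integral_corr_mul [Nonempty (Fin d)] {p p' : ℝ≥0∞} [hpp : p.HolderConjugate p']
    (hp : 1 < p) (hpt : p ≠ ⊤) {θ f : E d → ℂ} (hθc : Continuous θ) (hθ : MemLp θ p volume)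
    (hf : MemLp f p' volume) :
    Filter.Tendsto (fun Q : ℕ => ∑ q ∈ Finset.Ico (-(Q : ℤ)) Q,
      ∫ x, corr (P.ker Sym.one q) θ x * f x) Filter.atTop (nhds (∫ x, θ x * f x)) := by
  have hpp' : p'.HolderConjugate p := ENNReal.HolderTriple.symm
  have hT := temperateInt_of_memLp hp.le hθ
  have hp'1 : 1 ≤ p' := ENNReal.HolderConjugate.one_le p' p
  obtain ⟨hp't, hp'r⟩ := one_lt_conjExponent_toReal (p' := p') hp hpt
  have hd : 0 < d := Fin.pos_iff_nonempty.2 inferInstance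
  let S : ℕ → (E d → ℂ) → ℂ := fun Q f => ∑ q ∈ Finset.Ico (-(Q : ℤ)) Q,
      ∫ x, corr (P.ker Sym.one q) θ x * f x
  have hint : ∀ (K : 𝓢(E d, ℂ)) {g : E d → ℂ}, MemLp g p' volume →
      Integrable fun x => corr K θ x * g x := fun K g hg =>
    MemLp.integrable_mul (p := p) (q := p') (memLp_corr hθc hp.le hθ K) hg
  set B : ℝ≥0∞ := 2 * (∫⁻ z, ‖dilKer P.lowSym 0 z‖ₑ) * eLpNorm θ p volume with hBdef
  have hBt : B ≠ ⊤ := ENNReal.mul_ne_top (ENNReal.mul_ne_top (by simp)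
    (dilKer P.lowSym 0).integrable.2.ne) hθ.2.ne
  have hbound : ∀ Q {g : E d → ℂ}, MemLp g p' volume → ‖S Q g‖ₑ ≤ B * eLpNorm g p' volume :=
    fun Q g hg => by
      -- Telescoping: the partial sum costs the L^1 norms of two kernels, both equal to that at
      -- scale 1, whence the factor 2 in B.
      have e : S Q g = ∫ x, corr (dilKer P.lowSym Q - dilKer P.lowSym (-Q)) θ x * g x := by
        simp only [S]
        rw [← integral_finsetSum _ fun q _ => hint _ hg]
        refine integral_congr_ae (Filter.Eventually.of_forall fun x => ?_)
        simp only []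
        rw [← Finset.sum_mul, ← hT.corr_sum, P.sum_ker_one]
      rw [e]
      refine (enorm_integral_mul_le (p := p) (p' := p')
        (memLp_corr hθc hp.le hθ _).1 hg.1).trans ?_
      gcongr
      refine (eLpNorm_corr_le hθc.measurable _ hp.le).trans ?_
      rw [hBdef]
      gcongr
      calc _ ≤ ∫⁻ z, (‖dilKer P.lowSym Q z‖ₑ + ‖dilKer P.lowSym (-Q) z‖ₑ) :=
            lintegral_mono fun z => enorm_sub_le
        _ = _ := by
            rw [lintegral_add_left (dilKer P.lowSym Q).continuous.measurable.enorm,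
              lintegral_dilKer, lintegral_dilKer _ (-Q : ℤ), two_mul]
  have hdense : ∀ g : 𝓢(E d, ℂ), Filter.Tendsto (fun Q => S Q g) Filter.atTop
      (nhds (∫ x, θ x * g x)) := fun g => by
    obtain ⟨s, hs0, hsd, hsp⟩ := exists_memLp_one_add_norm_rpow (p' := p') hd hp hpt
    obtain ⟨u, hu, hb⟩ := P.exists_conv_ker_le Sym.one g hs0 hsd
    have hG : Integrable fun x => ‖θ x‖ * (1 + ‖x‖) ^ (-s) :=
      MemLp.integrable_mul (p := p) (q := p') hθ.norm hsp
    have h := (hasSum_integral_of_summable_bound (μ := volume)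
      (F := fun (q : ℤ) x => θ x * conv (P.ker Sym.one q) g x) (f := fun x => θ x * g x)
      (fun q => hθ.1.mul (conv (P.ker Sym.one q) g).continuous.aestronglyMeasurable) hu hG
      (fun q x => by
        rw [norm_mul]
        calc _ ≤ ‖θ x‖ * (u q * (1 + ‖x‖) ^ (-s)) := by gcongr; exact hb q x
          _ = _ := by ring)
      (Filter.Eventually.of_forall fun x => by
        have := P.hasSum_conv_ker Sym.isHomogeneous_one g x
        rw [Sym.mult_one] at this
        exact this.mul_left _)).2
    refine (h.comp tendsto_Ico_neg_atTop).congr fun Q => ?_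
    simp only [S, Function.comp]
    exact Finset.sum_congr rfl fun q _ => (hT.integral_corr_mul _ g).symm
  rw [EMetric.tendsto_atTop]
  intro ε hε
  obtain ⟨δ, hδ0, hδ⟩ : ∃ δ : ℝ, 0 < δ ∧
      (B + eLpNorm θ p volume) * ENNReal.ofReal δ < ε / 2 := by
    have ht : Filter.Tendsto (fun δ : ℝ => (B + eLpNorm θ p volume) * ENNReal.ofReal δ)
        (nhdsWithin 0 (Set.Ioi 0)) (nhds 0) := by
      have h1 : Filter.Tendsto (fun δ : ℝ => ENNReal.ofReal δ) (nhdsWithin 0 (Set.Ioi 0))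
          (nhds 0) := by
        have := (ENNReal.continuous_ofReal.tendsto 0).mono_left
          (nhdsWithin_le_nhds (s := Set.Ioi (0 : ℝ)))
        simpa using this
      simpa using ENNReal.Tendsto.const_mul h1
        (Or.inr (ENNReal.add_ne_top.2 ⟨hBt, hθ.2.ne⟩))
    have h2 := (ht.eventually_lt_const (ENNReal.half_pos hε.ne')).and self_mem_nhdsWithin
    obtain ⟨δ, h3, h4⟩ := h2.exists
    exact ⟨δ, h4, h3⟩
  obtain ⟨g, hgc, hgs, hg⟩ := MemLp.exist_eLpNorm_sub_le hp't hp'1 hf hδ0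
  let g' : 𝓢(E d, ℂ) := hgc.toSchwartzMap hgs
  have hg' : MemLp g p' volume := g'.memLp p' volume
  obtain ⟨N, hN⟩ := EMetric.tendsto_atTop.1 (hdense g') (ε / 2) (ENNReal.half_pos hε.ne')
  refine ⟨N, fun Q hQ => ?_⟩
  have e1 : S Q f = S Q (f - g) + S Q g := by
    simp only [S]
    rw [← Finset.sum_add_distrib]
    refine Finset.sum_congr rfl fun q _ => ?_
    rw [← integral_add (hint _ (hf.sub hg')) (hint _ hg')]
    refine integral_congr_ae (Filter.Eventually.of_forall fun x => ?_)
    simp only [Pi.sub_apply]; ring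
  have e2 : ∫ x, θ x * f x = (∫ x, θ x * (f - g) x) + ∫ x, θ x * g x := by
    have h := integral_add (μ := volume) (f := fun x => θ x * (f - g) x) (g := fun x => θ x * g x)
      (MemLp.integrable_mul (p := p) (q := p') hθ (hf.sub hg'))
      (MemLp.integrable_mul (p := p) (q := p') hθ hg')
    rw [← h]
    refine integral_congr_ae (Filter.Eventually.of_forall fun x => ?_)
    simp only [Pi.sub_apply]; ring
  change edist (S Q f) _ < ε
  rw [e1, e2, edist_eq_enorm_sub]
  have h3 : ‖S Q g - ∫ x, θ x * g x‖ₑ < ε / 2 := by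
    rw [← edist_eq_enorm_sub]; exact hN Q hQ
  calc _ = ‖(S Q (f - g) - ∫ x, θ x * (f - g) x) + (S Q g - ∫ x, θ x * g x)‖ₑ := by
        congr 1; ring
    _ ≤ (‖S Q (f - g)‖ₑ + ‖∫ x, θ x * (f - g) x‖ₑ) + ‖S Q g - ∫ x, θ x * g x‖ₑ :=
        (enorm_add_le _ _).trans (by gcongr; exact enorm_sub_le)
    _ ≤ (B * ENNReal.ofReal δ + eLpNorm θ p volume * ENNReal.ofReal δ)
          + ‖S Q g - ∫ x, θ x * g x‖ₑ := by
        gcongr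
        · exact (hbound Q (hf.sub hg')).trans (by gcongr)
        · exact (enorm_integral_mul_le (p := p) (p' := p') hθ.1 (hf.sub hg').1).trans (by gcongr)
    _ < ε / 2 + ε / 2 := by
        rw [← add_mul]
        exact ENNReal.add_lt_add hδ h3
    _ = ε := ENNReal.add_halves ε

end DyadicPartition

/-! ### Commutators of a vector field with the gradient of a kernel -/

theorem temperateInt_const (c : ℂ) : TemperateInt fun _ : E d => c :=
  temperateInt_of_memLp (p := ⊤) le_top (memLp_top_const c)

theorem TemperateInt.sub {f g : E d → ℂ} (hf : TemperateInt f) (hg : TemperateInt g) :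
    TemperateInt fun x => f x - g x := by
  obtain ⟨N, hN⟩ := hf
  obtain ⟨M, hM⟩ := hg
  have key : ∀ {f : E d → ℂ} {N M : ℕ}, N ≤ M →
      (Integrable fun x => (((1 + ‖x‖) ^ N)⁻¹ : ℝ) • f x) →
      Integrable fun x => (((1 + ‖x‖) ^ M)⁻¹ : ℝ) • f x := fun {f N M} h hN => by
    have hm := TemperateInt.aestronglyMeasurable ⟨N, hN⟩
    have hc : Continuous fun x : E d => ((1 + ‖x‖) ^ M)⁻¹ :=
      Continuous.inv₀ (by fun_prop) fun x => by positivity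
    refine hN.mono (hc.aestronglyMeasurable.smul hm) (Filter.Eventually.of_forall fun x => ?_)
    rw [norm_smul, norm_smul, norm_inv, norm_inv]
    have h1 : 1 ≤ 1 + ‖x‖ := by simp
    have h2 : ‖(1 + ‖x‖) ^ N‖ ≤ ‖(1 + ‖x‖) ^ M‖ := by
      rw [Real.norm_of_nonneg (by positivity), Real.norm_of_nonneg (by positivity)]
      exact pow_le_pow_right₀ h1 h
    have h3 : 0 < ‖(1 + ‖x‖) ^ N‖ := norm_pos_iff.2 (by positivity)
    gcongr
  refine ⟨max N M, ((key (le_max_left N M) hN).sub (key (le_max_right N M) hM)).congr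
    (Filter.Eventually.of_forall fun x => ?_)⟩
  simp only [Pi.sub_apply, smul_sub]

/-- The `i`-th component of a vector field, as a complex function. -/
noncomputable def comp (v : E d → E d) (i : Fin d) (x : E d) : ℂ := ((v x i : ℝ) : ℂ)

theorem norm_comp_sub_le (v : E d → E d) (i : Fin d) (x y : E d) :
    ‖comp v i x - comp v i y‖ ≤ ‖v x - v y‖ := by
  rw [comp, comp, ← Complex.ofReal_sub, Complex.norm_real, ← PiLp.sub_apply]
  exact PiLp.norm_apply_le _ _

theorem hasFDerivAt_comp {v : E d → E d} {x : E d} (hv : DifferentiableAt ℝ v x) (i : Fin d) :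
    HasFDerivAt (comp v i)
      (Complex.ofRealCLM ∘L (EuclideanSpace.proj i : E d →L[ℝ] ℝ) ∘L fderiv ℝ v x) x :=
  (Complex.ofRealCLM.hasFDerivAt.comp x
    ((EuclideanSpace.proj i : E d →L[ℝ] ℝ).hasFDerivAt.comp x hv.hasFDerivAt))

theorem fderiv_comp_apply {v : E d → E d} {x : E d} (hv : DifferentiableAt ℝ v x) (i : Fin d)
    (w : E d) : fderiv ℝ (comp v i) x w = ((fderiv ℝ v x w i : ℝ) : ℂ) := by
  rw [(hasFDerivAt_comp hv i).fderiv]; rfl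

/-- Integration by parts against a translated Schwartz function. -/
theorem integral_fderiv_mul_mul {f W : E d → ℂ} (hf : Differentiable ℝ f) (hW : Differentiable ℝ W)
    {A B : ℝ} (hA : ∀ x, ‖f x‖ ≤ A) (j : Fin d)
    (hfm : AEStronglyMeasurable (fun y => fderiv ℝ f y (EuclideanSpace.single j 1)) volume)
    (hB : ∀ x, ‖fderiv ℝ f x (EuclideanSpace.single j 1)‖ ≤ B)
    (hW1 : TemperateInt W) (hW2 : TemperateInt fun y => fderiv ℝ W y (EuclideanSpace.single j 1))
    (L : 𝓢(E d, ℂ)) (x : E d) :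
    ∫ y, fderiv ℝ f y (EuclideanSpace.single j 1) * W y * L (y - x) =
      -(∫ y, f y * fderiv ℝ W y (EuclideanSpace.single j 1) * L (y - x))
        - ∫ y, f y * W y * pd j L (y - x) := by
  set e : E d := EuclideanSpace.single j 1
  set L' := SchwartzMap.compSubConstCLM ℂ x L
  have hL' : ∀ y, fderiv ℝ L' y e = pd j L (y - x) := fun y => by
    rw [pd_apply]
    have : (L' : E d → ℂ) = fun y => L (y - x) := rfl
    rw [this, fderiv_comp_sub]
  have hg : ∀ y, fderiv ℝ (fun y => W y * L' y) y e =
      fderiv ℝ W y e * L (y - x) + W y * pd j L (y - x) := fun y => by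
    have := (hW y).hasFDerivAt.mul (L'.differentiableAt (x := y)).hasFDerivAt
    rw [show (fun y => W y * L' y) = W * L' from rfl, this.fderiv, ← hL']
    simp only [add_apply, smul_apply, smul_eq_mul]
    have : L' y = L (y - x) := rfl
    rw [this]; ring
  have i1 := (hW1.mul_bounded hfm hB).integrable_mul_sub L x
  have i2 := (hW2.mul_bounded hf.continuous.aestronglyMeasurable hA).integrable_mul_sub L x
  have i3 := (hW1.mul_bounded hf.continuous.aestronglyMeasurable hA).integrable_mul_sub (pd j L) x
  have i4 := (hW1.mul_bounded hf.continuous.aestronglyMeasurable hA).integrable_mul_sub L x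
  have h := integral_mul_fderiv_eq_neg_fderiv_mul_of_integrable (𝕜 := ℂ) (μ := volume) (f := f)
    (g := fun y => W y * L' y) (v := e)
    (i1.congr (Filter.Eventually.of_forall fun y => mul_assoc _ _ _))
    ((i2.add i3).congr (Filter.Eventually.of_forall fun y => by
      simp only [Pi.add_apply, hg]; ring))
    (i4.congr (Filter.Eventually.of_forall fun y => mul_assoc _ _ _))
    (fun y _ => hf y) (fun y _ => (hW y).mul L'.differentiableAt)
  have e1 : ∫ y, f y * fderiv ℝ (fun y => W y * L' y) y e =
      (∫ y, f y * fderiv ℝ W y e * L (y - x)) + ∫ y, f y * W y * pd j L (y - x) := by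
    rw [← integral_add i2 i3]
    refine integral_congr_ae (Filter.Eventually.of_forall fun y => ?_)
    simp only [hg]; ring
  have e2 : ∫ y, fderiv ℝ f y e * (W y * L' y) = ∫ y, fderiv ℝ f y e * W y * L (y - x) :=
    integral_congr_ae (Filter.Eventually.of_forall fun y => (mul_assoc _ _ _).symm)
  rw [e1, e2] at h
  linear_combination h

/-- The commutator of `v·∇` with the correlation with `K`. -/
noncomputable def comm (v : E d → E d) (f : E d → ℂ) (K : 𝓢(E d, ℂ)) (x : E d) : ℂ :=
  ∑ i, ∫ y, f y * (comp v i y - comp v i x) * pd i K (y - x)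

/-- The oscillation of a vector field, averaged with a kernel. -/
noncomputable def osc (v : E d → E d) (K : 𝓢(E d, ℂ)) (x : E d) : ℝ≥0∞ :=
  ∫⁻ z, ‖K z‖ₑ * ‖v (x + z) - v x‖ₑ

/-- The gradient of a vector field, averaged with a kernel. -/
noncomputable def grad (v : E d → E d) (K : 𝓢(E d, ℂ)) (x : E d) : ℝ≥0∞ :=
  ∫⁻ z, ‖K z‖ₑ * ‖fderiv ℝ v (x + z)‖ₑ

theorem enorm_integral_mul_osc_le (v : E d → E d) {f : E d → ℂ} {S : ℝ≥0∞} (hS : S ≠ ⊤)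
    (hf : ∀ y, ‖f y‖ₑ ≤ S)
    (K : 𝓢(E d, ℂ)) (i : Fin d) (x : E d) :
    ‖∫ y, f y * (comp v i y - comp v i x) * K (y - x)‖ₑ ≤ S * osc v K x := by
  refine (enorm_integral_le_lintegral_enorm _).trans ?_
  rw [← lintegral_add_left_eq_self _ x, osc, ← lintegral_const_mul' _ _ hS]
  refine lintegral_mono fun z => ?_
  rw [enorm_mul, enorm_mul, add_sub_cancel_left, mul_comm ‖K z‖ₑ, ← mul_assoc]
  gcongr
  · exact hf _
  · exact enorm_le_iff_norm_le.2 (norm_comp_sub_le v i _ _)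

theorem enorm_integral_mul_grad_le {v : E d → E d} (hv : Differentiable ℝ v) {f : E d → ℂ}
    {S : ℝ≥0∞} (hS : S ≠ ⊤) (hf : ∀ y, ‖f y‖ₑ ≤ S) (K : 𝓢(E d, ℂ)) (i j : Fin d) (x : E d) :
    ‖∫ y, f y * fderiv ℝ (comp v i) y (EuclideanSpace.single j 1) * K (y - x)‖ₑ
      ≤ S * grad v K x := by
  refine (enorm_integral_le_lintegral_enorm _).trans ?_
  rw [← lintegral_add_left_eq_self _ x, grad, ← lintegral_const_mul' _ _ hS]
  refine lintegral_mono fun z => ?_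
  rw [enorm_mul, enorm_mul, add_sub_cancel_left, mul_comm ‖K z‖ₑ, ← mul_assoc]
  gcongr
  · exact hf _
  · refine enorm_le_iff_norm_le.2 ?_
    rw [fderiv_comp_apply (hv _), Complex.norm_real]
    refine (PiLp.norm_apply_le _ _).trans ((ContinuousLinearMap.le_opNorm _ _).trans ?_)
    simp

theorem corr_smul (c : ℝ) (K : 𝓢(E d, ℂ)) (f : E d → ℂ) (y : E d) :
    corr (c • K) f y = c • corr K f y := by
  rw [corr, corr, ← integral_smul]
  refine integral_congr_ae (Filter.Eventually.of_forall fun x => ?_)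
  simp only [smul_apply, Complex.real_smul]; ring

/-! ### Pointwise bounds for the commutator with one block of θ -/

namespace DyadicPartition

variable (P : DyadicPartition d)

/-- The crude bound, with the gradient left on the kernel at cost 2^n. It is enough for n ≤ q when v
is only Hölder continuous. -/
theorem enorm_comm_le_osc_mulX (v : E d → E d) {f : E d → ℂ} {S : ℝ≥0∞} (hS : S ≠ ⊤)
    (hf : ∀ y, ‖f y‖ₑ ≤ S) (k : Sym d) (n : ℤ) (x : E d) :
    ‖comm v f (P.ker k n) x‖ₑ ≤
      ENNReal.ofReal ((2 : ℝ) ^ n) * S * ∑ i, osc v (P.ker (k.mulX i) n) x := by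
  rw [comm, Finset.mul_sum]
  refine (enorm_sum_le _ _).trans (Finset.sum_le_sum fun i _ => ?_)
  have : ∫ y, f y * (comp v i y - comp v i x) * pd i (P.ker k n) (y - x) =
      ((2 : ℝ) ^ n) • ∫ y, f y * (comp v i y - comp v i x) * P.ker (k.mulX i) n (y - x) := by
    rw [pd_ker, ← integral_smul]
    refine integral_congr_ae (Filter.Eventually.of_forall fun y => ?_)
    simp only [smul_apply, Complex.real_smul]; ring
  rw [this, enorm_smul, Real.enorm_of_nonneg (by positivity), mul_assoc]
  gcongr
  exact enorm_integral_mul_osc_le v hS hf _ i x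

theorem fderiv_corr_ker {θ : E d → ℂ} (hθ : TemperateInt θ) (h : Sym d) (q : ℤ) (j : Fin d)
    (y : E d) : fderiv ℝ (corr (P.ker h q) θ) y (EuclideanSpace.single j 1)
      = -(((2 : ℝ) ^ q) • corr (P.ker (h.mulX j) q) θ y) := by
  rw [hθ.fderiv_corr, pd_ker, corr_smul]

theorem corr_ker_eq_sum_divX {θ : E d → ℂ} (hθ : TemperateInt θ) (h : Sym d) (q : ℤ) (y : E d) :
    corr (P.ker h q) θ y =
    ∑ j, corr (P.ker ((h.divX j).mulX j) q) θ y := by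
  conv_lhs => rw [P.ker_eq_sum_pd h q, corr_smul, hθ.corr_sum, Finset.smul_sum]
  refine Finset.sum_congr rfl fun j _ => ?_
  rw [pd_ker, corr_smul, smul_smul, ← zpow_add₀ two_ne_zero, neg_add_cancel, zpow_zero, one_smul]

section

variable {v : E d → E d} (hv : ContDiff ℝ ∞ v) (hT : ∀ i, TemperateInt (comp v i))
  (hT' : ∀ i j, TemperateInt fun y => fderiv ℝ (comp v i) y (EuclideanSpace.single j 1))
  {θ : E d → ℂ} (hθ : TemperateInt θ) {S : ℝ≥0∞} (hS : S ≠ ⊤)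

include hv hT hT' hθ hS

/-- The derivative of a block of θ, worth 2^q, is traded for one derivative on v plus one on the
kernel L. Read from right to left it serves n ≥ q, from left to right n ≤ q. -/
theorem integral_corr_ker_parts (h : Sym d) (q : ℤ) (hS1 : ∀ y, ‖corr (P.ker h q) θ y‖ₑ ≤ S)
    (hS2 : ∀ j y, ‖corr (P.ker (h.mulX j) q) θ y‖ₑ ≤ S) (L : 𝓢(E d, ℂ)) (i j : Fin d) (x : E d) :
    ((2 : ℝ) ^ q) • ∫ y, corr (P.ker (h.mulX j) q) θ y * (comp v i y - comp v i x) * L (y - x) =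
      (∫ y, corr (P.ker h q) θ y * fderiv ℝ (comp v i) y (EuclideanSpace.single j 1) * L (y - x))
        + ∫ y, corr (P.ker h q) θ y * (comp v i y - comp v i x) * pd j L (y - x) := by
  have hvd : Differentiable ℝ v := hv.differentiable (by simp)
  have hc : Differentiable ℝ (comp v i) := fun y => (hasFDerivAt_comp (hvd y) i).differentiableAt
  have hb : ∀ {z : ℂ}, ‖z‖ₑ ≤ S → ‖z‖ ≤ S.toReal := fun {z} hz => by
    rw [← toReal_enorm]
    exact ENNReal.toReal_mono hS hz
  have hfd : ∀ y, fderiv ℝ (fun y => comp v i y - comp v i x) y = fderiv ℝ (comp v i) y :=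
    fun y => fderiv_sub_const _
  have := integral_fderiv_mul_mul (hθ.differentiable_corr (P.ker h q))
    (W := fun y => comp v i y - comp v i x) (hc.sub_const _) (fun y => hb (hS1 y)) j
    (B := (2 : ℝ) ^ q * S.toReal)
    (by
      simp only [P.fderiv_corr_ker hθ]
      exact ((hθ.differentiable_corr (P.ker (h.mulX j) q)).continuous.const_smul
        ((2 : ℝ) ^ q)).neg.aestronglyMeasurable)
    (fun y => by
      rw [P.fderiv_corr_ker hθ, norm_neg, norm_smul, Real.norm_of_nonneg (by positivity)]
      gcongr
      exact hb (hS2 j y))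
    ((hT i).sub (temperateInt_const _)) (by simpa only [hfd] using hT' i j) L x
  simp only [hfd] at this
  rw [← integral_smul]
  have e : ∫ y, (2 : ℝ) ^ q • (corr (P.ker (h.mulX j) q) θ y * (comp v i y - comp v i x)
      * L (y - x)) = -∫ y, fderiv ℝ (corr (P.ker h q) θ) y (EuclideanSpace.single j 1) *
        (comp v i y - comp v i x) * L (y - x) := by
    rw [← integral_neg]
    refine integral_congr_ae (Filter.Eventually.of_forall fun y => ?_)
    simp only [P.fderiv_corr_ker hθ, Complex.real_smul]; ring
  rw [e, this]; ring

/-- Useful for n ≥ q: integrating by parts sends the gradient of the kernel to the block of θ, so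
that the cost is 2^q and not 2^n. The terms with ∂_i v_i add up to the divergence and vanish. -/
theorem enorm_comm_corr_le_osc (hdiv : DivergenceFree v) (h : Sym d) (q : ℤ)
    (hS1 : ∀ y, ‖corr (P.ker h q) θ y‖ₑ ≤ S)
    (hS2 : ∀ j y, ‖corr (P.ker (h.mulX j) q) θ y‖ₑ ≤ S) (K : 𝓢(E d, ℂ)) (x : E d) :
    ‖comm v (corr (P.ker h q) θ) K x‖ₑ ≤
      ENNReal.ofReal ((2 : ℝ) ^ q) * S * (d * osc v K x) := by
  have hvd : Differentiable ℝ v := hv.differentiable (by simp)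
  have hb : ∀ y, ‖corr (P.ker h q) θ y‖ ≤ S.toReal := fun y => by
    rw [← toReal_enorm]
    exact ENNReal.toReal_mono hS (hS1 y)
  have h0 : ∑ i, ∫ y, corr (P.ker h q) θ y *
      fderiv ℝ (comp v i) y (EuclideanSpace.single i 1) * K (y - x) = 0 := by
    rw [← integral_finsetSum _ fun i _ => ((hT' i i).mul_bounded
      (hθ.differentiable_corr _).continuous.aestronglyMeasurable hb).integrable_mul_sub K x]
    rw [← integral_zero (E d) ℂ]
    refine integral_congr_ae (Filter.Eventually.of_forall fun y => ?_)
    beta_reduce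
    rw [← Finset.sum_mul, ← Finset.mul_sum]
    simp only [fderiv_comp_apply (hvd _)]
    rw [← Complex.ofReal_sum, hdiv y]; simp
  have e : comm v (corr (P.ker h q) θ) K x = ∑ i, ((2 : ℝ) ^ q) •
      ∫ y, corr (P.ker (h.mulX i) q) θ y * (comp v i y - comp v i x) * K (y - x) := by
    rw [Finset.sum_congr rfl fun i _ => P.integral_corr_ker_parts hv hT hT' hθ hS h q hS1 hS2 K i i x,
      Finset.sum_add_distrib, h0, zero_add]
    rfl
  rw [e]
  refine (enorm_sum_le _ _).trans ?_
  calc _ ≤ ∑ i : Fin d, ENNReal.ofReal ((2 : ℝ) ^ q) * (S * osc v K x) := by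
        refine Finset.sum_le_sum fun i _ => ?_
        rw [enorm_smul, Real.enorm_of_nonneg (by positivity)]
        gcongr
        exact enorm_integral_mul_osc_le v hS (hS2 i) K i x
    _ = _ := by
        rw [Finset.sum_const, Finset.card_univ, Fintype.card_fin, nsmul_eq_mul]; ring

/-- Useful for n ≤ q: the block of θ is 2^(-q) times a divergence, and the derivative is moved onto
v, giving `grad`, or onto the kernel, giving a second factor 2^n against `osc`. As `osc` is worth
2^(-n) |∇v|, both terms are of size 2^(n-q) |∇v|. -/
theorem enorm_comm_corr_le_grad (h : Sym d) (q : ℤ)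
    (hS1 : ∀ j y, ‖corr (P.ker (h.divX j) q) θ y‖ₑ ≤ S)
    (hS2 : ∀ j i y, ‖corr (P.ker ((h.divX j).mulX i) q) θ y‖ₑ ≤ S) (k : Sym d) (n : ℤ) (x : E d) :
    ‖comm v (corr (P.ker h q) θ) (P.ker k n) x‖ₑ ≤ ENNReal.ofReal ((2 : ℝ) ^ (-q)) * S *
      ∑ i, ∑ j, (ENNReal.ofReal ((2 : ℝ) ^ n) * grad v (P.ker (k.mulX i) n) x
        + ENNReal.ofReal ((2 : ℝ) ^ n) * ENNReal.ofReal ((2 : ℝ) ^ n) *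
          osc v (P.ker ((k.mulX i).mulX j) n) x) := by
  have hvd : Differentiable ℝ v := hv.differentiable (by simp)
  have hb : ∀ {z : ℂ}, ‖z‖ₑ ≤ S → ‖z‖ ≤ S.toReal := fun {z} hz => by
    rw [← toReal_enorm]
    exact ENNReal.toReal_mono hS hz
  have e : comm v (corr (P.ker h q) θ) (P.ker k n) x = ∑ i, ∑ j, ((2 : ℝ) ^ (-q)) •
      ((∫ y, corr (P.ker (h.divX j) q) θ y *
          fderiv ℝ (comp v i) y (EuclideanSpace.single j 1) * pd i (P.ker k n) (y - x))
        + ∫ y, corr (P.ker (h.divX j) q) θ y * (comp v i y - comp v i x) *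
          pd j (pd i (P.ker k n)) (y - x)) := by
    rw [comm]
    refine Finset.sum_congr rfl fun i _ => ?_
    have : ∀ y, corr (P.ker h q) θ y * (comp v i y - comp v i x) * pd i (P.ker k n) (y - x) =
        ∑ j, corr (P.ker ((h.divX j).mulX j) q) θ y * (comp v i y - comp v i x) *
          pd i (P.ker k n) (y - x) := fun y => by
      rw [P.corr_ker_eq_sum_divX hθ, Finset.sum_mul, Finset.sum_mul]
    simp only [this]
    rw [integral_finsetSum _ fun j _ => (((hT i).sub (temperateInt_const _)).mul_bounded
      (hθ.differentiable_corr _).continuous.aestronglyMeasurable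
      fun y => hb (hS2 j j y)).integrable_mul_sub _ x]
    refine Finset.sum_congr rfl fun j _ => ?_
    rw [← P.integral_corr_ker_parts hv hT hT' hθ hS (h.divX j) q (hS1 j) (hS2 j) _ i j x, smul_smul,
      ← zpow_add₀ two_ne_zero, neg_add_cancel, zpow_zero, one_smul]
  have hpd : ∀ i j, pd j (pd i (P.ker k n)) =
      ((2 : ℝ) ^ n * (2 : ℝ) ^ n) • P.ker ((k.mulX i).mulX j) n := fun i j => by
    rw [pd_ker, show pd j ((2 : ℝ) ^ n • P.ker (k.mulX i) n)
      = (2 : ℝ) ^ n • pd j (P.ker (k.mulX i) n) from ?_, pd_ker, smul_smul]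
    refine SchwartzMap.ext fun y => ?_
    rw [smul_apply, pd_apply, pd_apply]
    have : ((2 : ℝ) ^ n • P.ker (k.mulX i) n : 𝓢(E d, ℂ)) = fun y => (2 : ℝ) ^ n • (P.ker (k.mulX i) n) y := rfl
    rw [this, fderiv_fun_const_smul (SchwartzMap.differentiableAt _)]
    rfl
  have hI : ∀ (G : E d → ℂ) (c : ℝ) (L : 𝓢(E d, ℂ)), ∫ y, G y * (c • L) (y - x) =
      c • ∫ y, G y * L (y - x) := fun G c L => by
    rw [← integral_smul]
    refine integral_congr_ae (Filter.Eventually.of_forall fun y => ?_)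
    simp only [smul_apply, Complex.real_smul]; ring
  rw [e, Finset.mul_sum]
  refine (enorm_sum_le _ _).trans (Finset.sum_le_sum fun i _ => ?_)
  rw [Finset.mul_sum]
  refine (enorm_sum_le _ _).trans (Finset.sum_le_sum fun j _ => ?_)
  rw [enorm_smul, Real.enorm_of_nonneg (by positivity), mul_assoc]
  gcongr
  refine (enorm_add_le _ _).trans ?_
  rw [hpd, pd_ker, hI, hI, enorm_smul, enorm_smul, Real.enorm_of_nonneg (by positivity),
    Real.enorm_of_nonneg (by positivity), ENNReal.ofReal_mul (by positivity), mul_add,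
    mul_left_comm S, mul_left_comm S]
  gcongr
  · exact enorm_integral_mul_grad_le hvd hS (hS1 j) _ i j x
  · exact enorm_integral_mul_osc_le v hS (hS1 j) _ i x

end

/-- The `(n, q)`-th dyadic piece of the commutator with the Riesz transform. -/
noncomputable def piece (i₀ : Fin d) (v : E d → E d) (θ : E d → ℂ) (n q : ℤ) (x : E d) : ℂ :=
  ∑ i, corr (pd i (P.ker (Sym.riesz i₀) n)) (fun y => corr (P.ker Sym.one q) θ y * comp v i y) x
  - ∑ i, corr (pd i (P.ker Sym.one n)) (fun y => corr (P.ker (Sym.riesz i₀) q) θ y * comp v i y) x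

/-! ### Duality with the test function, and the cancellation inside a piece -/

section

variable {v : E d → E d} (hT : ∀ i, TemperateInt (comp v i))
  {θ : E d → ℂ} (hθ : TemperateInt θ)
  {A : ℝ} {q : ℤ}

include hT hθ

theorem temperateInt_corr_mul_comp {h : Sym d} (hA : ∀ y, ‖corr (P.ker h q) θ y‖ ≤ A)
    (i : Fin d) : TemperateInt fun y => corr (P.ker h q) θ y * comp v i y :=
  (hT i).mul_bounded (hθ.differentiable_corr _).continuous.aestronglyMeasurable hA

/-- The left side is the transpose of g ↦ v·∇(K * g), applied to a block of θ; this is how the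
pieces represent the weak formulation. -/
theorem integral_corr_mul_convection {h : Sym d} (hA : ∀ y, ‖corr (P.ker h q) θ y‖ ≤ A)
    (K g : 𝓢(E d, ℂ)) :
    Integrable (fun x => (∑ i, corr (pd i K) (fun y => corr (P.ker h q) θ y * comp v i y) x)
      * g x) ∧
    ∫ x, (∑ i, corr (pd i K) (fun y => corr (P.ker h q) θ y * comp v i y) x) * g x =
      ∫ x, corr (P.ker h q) θ x * convection v (conv K g) x := by
  have ht := fun i => P.temperateInt_corr_mul_comp hT hθ hA i
  simp only [Finset.sum_mul]
  refine ⟨integrable_finsetSum _ fun i _ => (ht i).integrable_corr_mul _ g, ?_⟩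
  rw [integral_finsetSum _ fun i _ => (ht i).integrable_corr_mul _ g]
  simp only [(ht _).integral_corr_mul]
  rw [← integral_finsetSum _ fun i _ => (ht i).integrable_mul _]
  refine integral_congr_ae (Filter.Eventually.of_forall fun x => ?_)
  simp only [convection_eq_sum, Finset.mul_sum, pd_conv_left]
  refine Finset.sum_congr rfl fun i _ => ?_
  simp only [comp]; ring

theorem integral_piece_mul (i₀ : Fin d) (hA : ∀ y, ‖corr (P.ker Sym.one q) θ y‖ ≤ A)
    (hA' : ∀ y, ‖corr (P.ker (Sym.riesz i₀) q) θ y‖ ≤ A) (n : ℤ) (g : 𝓢(E d, ℂ)) :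
    Integrable (fun x => P.piece i₀ v θ n q x * g x) ∧
    ∫ x, P.piece i₀ v θ n q x * g x =
      (∫ x, corr (P.ker Sym.one q) θ x * convection v (conv (P.ker (Sym.riesz i₀) n) g) x) -
      ∫ x, corr (P.ker (Sym.riesz i₀) q) θ x * convection v (conv (P.ker Sym.one n) g) x := by
  have h1 := P.integral_corr_mul_convection hT hθ hA (P.ker (Sym.riesz i₀) n) g
  have h2 := P.integral_corr_mul_convection hT hθ hA' (P.ker Sym.one n) g
  simp only [piece, sub_mul]
  exact ⟨h1.1.sub h2.1, by rw [integral_sub h1.1 h2.1, h1.2, h2.2]⟩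

theorem continuous_piece (i₀ : Fin d) (hA : ∀ y, ‖corr (P.ker Sym.one q) θ y‖ ≤ A)
    (hA' : ∀ y, ‖corr (P.ker (Sym.riesz i₀) q) θ y‖ ≤ A) (n : ℤ) :
    Continuous (P.piece i₀ v θ n q) :=
  (continuous_finsetSum _ fun i _ => ((P.temperateInt_corr_mul_comp hT hθ hA
    i).differentiable_corr _).continuous).sub
  (continuous_finsetSum _ fun i _ => ((P.temperateInt_corr_mul_comp hT hθ hA'
    i).differentiable_corr _).continuous)

/-- Add and subtract v(x): the increment gives `comm`, and the remainder is v(x) times a pure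
Fourier multiplier of θ. -/
theorem sum_corr_pd_eq {h : Sym d} (hA : ∀ y, ‖corr (P.ker h q) θ y‖ ≤ A) (K : 𝓢(E d, ℂ))
    (x : E d) : ∑ i, corr (pd i K) (fun y => corr (P.ker h q) θ y * comp v i y) x =
      comm v (corr (P.ker h q) θ) K x + ∑ i, comp v i x * corr (conv (P.ker h q) (pd i K)) θ x := by
  have ht := fun i => P.temperateInt_corr_mul_comp hT hθ hA i
  have hc : TemperateInt (corr (P.ker h q) θ) := by
    simpa using (temperateInt_const (d := d) 1).mul_bounded
      (hθ.differentiable_corr _).continuous.aestronglyMeasurable hA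
  rw [comm, ← Finset.sum_add_distrib]
  refine Finset.sum_congr rfl fun i _ => ?_
  rw [← hθ.corr_corr, corr, corr, ← integral_const_mul,
    ← integral_add]
  · refine integral_congr_ae (Filter.Eventually.of_forall fun y => ?_)
    simp only []; ring
  · exact (((hT i).sub (temperateInt_const _)).mul_bounded
      (hθ.differentiable_corr _).continuous.aestronglyMeasurable hA).integrable_mul_sub _ x
  · exact (hc.integrable_mul_sub _ x).const_mul _

/-- The two remainders carry the same multiplier by `conv_ker_one_pd_riesz` and cancel. -/
theorem piece_eq_comm (i₀ : Fin d) (hA : ∀ y, ‖corr (P.ker Sym.one q) θ y‖ ≤ A)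
    (hA' : ∀ y, ‖corr (P.ker (Sym.riesz i₀) q) θ y‖ ≤ A) (n : ℤ) (x : E d) :
    P.piece i₀ v θ n q x = comm v (corr (P.ker Sym.one q) θ) (P.ker (Sym.riesz i₀) n) x
      - comm v (corr (P.ker (Sym.riesz i₀) q) θ) (P.ker Sym.one n) x := by
  rw [piece, P.sum_corr_pd_eq hT hθ hA, P.sum_corr_pd_eq hT hθ hA']
  simp only [P.conv_ker_one_pd_riesz]
  ring

end

end DyadicPartition

/-! ### Averages of the oscillation of a vector field with integrable gradient -/

theorem enorm_sub_le_lintegral {v : E d → E d} (hv : ContDiff ℝ 1 v) (x w : E d) :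
    ‖v (x + w) - v x‖ₑ ≤ ∫⁻ t in Set.Ioc (0 : ℝ) 1, ‖fderiv ℝ v (x + t • w)‖ₑ * ‖w‖ₑ := by
  have hd : ∀ t : ℝ, HasDerivAt (fun t : ℝ => v (x + t • w)) (fderiv ℝ v (x + t • w) w) t :=
    fun t => by
      have h1 : HasDerivAt (fun t : ℝ => x + t • w) w t := by
        simpa using ((hasDerivAt_id t).smul_const w).const_add x
      exact ((hv.differentiable (by simp)) _).hasFDerivAt.comp_hasDerivAt t h1
  have hc : Continuous (fderiv ℝ v) := hv.continuous_fderiv (by simp)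
  have hc' : Continuous fun t : ℝ => fderiv ℝ v (x + t • w) w := by fun_prop
  have h := intervalIntegral.integral_eq_sub_of_hasDerivAt (a := 0) (b := 1) (fun t _ => hd t)
    (hc'.intervalIntegrable _ _)
  simp only [one_smul, zero_smul, add_zero] at h
  rw [← h, intervalIntegral.integral_of_le zero_le_one]
  refine (enorm_integral_le_lintegral_enorm _).trans (lintegral_mono fun t => ?_)
  exact ContinuousLinearMap.le_opENorm _ _

theorem eLpNorm_ennreal_const_mul_le {X : Type*} [MeasurableSpace X] {μ : Measure X} {c : ℝ≥0∞}
    (hc : c ≠ ⊤) (F : X → ℝ≥0∞) (p : ℝ≥0∞) :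
    eLpNorm (fun x => c * F x) p μ ≤ c * eLpNorm F p μ := by
  lift c to ℝ≥0 using hc
  exact eLpNorm_le_nnreal_smul_eLpNorm_of_ae_le_mul' (f := fun x => c * F x) (g := F) (c := c)
    (Filter.Eventually.of_forall fun x => le_rfl) p

theorem eLpNorm_lintegral_withDensity_prod_le {p : ℝ≥0∞} (hp : 1 ≤ p) {W : E d → ℝ≥0∞}
    (hW : Measurable W) (hWt : ∫⁻ z, W z ≠ ⊤) {F : E d → E d × ℝ → ℝ≥0∞}
    (hF : Measurable (Function.uncurry F)) {A : ℝ≥0∞}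
    (hA : ∀ s, eLpNorm (fun x => F x s) p volume ≤ A) :
    eLpNorm (fun x => ∫⁻ z, W z * ∫⁻ t in Set.Ioc (0 : ℝ) 1, F x (z, t)) p volume
      ≤ (∫⁻ z, W z) * A := by
  have hν : (volume.withDensity W) Set.univ = ∫⁻ z, W z := by simp
  have : IsFiniteMeasure (volume.withDensity W) := ⟨by rw [hν]; exact hWt.lt_top⟩
  have h := eLpNorm_lintegral_le (μ := (volume : Measure (E d)))
    (ν := (volume.withDensity W).prod (volume.restrict (Set.Ioc (0 : ℝ) 1))) hp hF hA
  rw [← Set.univ_prod_univ, Measure.prod_prod, hν] at h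
  simp only [MeasurableSet.univ, Measure.restrict_apply, Set.univ_inter, Real.volume_Ioc,
    sub_zero, ENNReal.ofReal_one, mul_one] at h
  refine le_trans (le_of_eq ?_) h
  congr 1
  ext x
  have hx : Measurable (F x) := hF.comp measurable_prodMk_left
  rw [lintegral_prod _ hx.aemeasurable,
    lintegral_withDensity_eq_lintegral_mul _ hW hx.lintegral_prod_right']
  rfl

theorem lintegral_enorm_mul_enorm_ne_top (K : 𝓢(E d, ℂ)) : ∫⁻ z, ‖K z‖ₑ * ‖z‖ₑ ≠ ⊤ := by
  have h := integrable_one_add_norm_rpow_mul K 1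
  refine ne_top_of_le_ne_top h.2.ne (lintegral_mono fun z => ?_)
  rw [enorm_mul, mul_comm]
  gcongr
  · rw [enorm_le_iff_norm_le, Real.rpow_one, Real.norm_of_nonneg (by positivity)]
    linarith [norm_nonneg z]
  · rw [enorm_norm]

namespace DyadicPartition

variable (P : DyadicPartition d)

theorem eLpNorm_grad_ker_le {v : E d → E d} (hv : ContDiff ℝ 1 v) {p : ℝ≥0∞} (hp : 1 ≤ p)
    (k : Sym d) (n : ℤ) : eLpNorm (grad v (P.ker k n)) p volume
      ≤ (∫⁻ z, ‖P.ker k 0 z‖ₑ) * eLpNorm (fderiv ℝ v) p volume := by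
  have hc : Continuous (fderiv ℝ v) := hv.continuous_fderiv (by simp)
  let ν : Measure (E d) := volume.withDensity fun z => ‖P.ker k 0 z‖ₑ
  have hKm : Measurable fun z => ‖P.ker k 0 z‖ₑ := (P.ker k 0).continuous.measurable.enorm
  have hν : ν Set.univ = ∫⁻ z, ‖P.ker k 0 z‖ₑ := by simp [ν]
  have : IsFiniteMeasure ν := ⟨by rw [hν]; exact (P.ker k 0).integrable.2⟩
  have h := eLpNorm_lintegral_le (μ := (volume : Measure (E d))) (ν := ν) hp
    (F := fun x z => ‖fderiv ℝ v (x + (2 : ℝ) ^ (-n) • z)‖ₑ)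
    (Measurable.enorm (Continuous.measurable (by fun_prop)))
    (A := eLpNorm (fderiv ℝ v) p volume) (fun z => by
      rw [eLpNorm_enorm (fun x => fderiv ℝ v (x + (2 : ℝ) ^ (-n) • z)),
        eLpNorm_comp_const_add hc.aestronglyMeasurable])
  rw [hν] at h
  refine le_trans (le_of_eq ?_) h
  congr 1
  ext x
  rw [grad, P.lintegral_ker_mul k n
    (Measurable.enorm (Continuous.measurable (by fun_prop))),
    lintegral_withDensity_eq_lintegral_mul _ hKm
    (Measurable.enorm (Continuous.measurable (by fun_prop)))]
  rfl

/-- After rescaling z, the increment over 2^(-n) z is the integral of ∇v along a segment, times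
2^(-n) |z|. Minkowski's inequality over (z, t) and translation invariance of the L^p norm conclude,
the first moment of the unit-scale kernel being finite. -/
theorem eLpNorm_osc_ker_le {v : E d → E d} (hv : ContDiff ℝ 1 v) {p : ℝ≥0∞} (hp : 1 ≤ p)
    (k : Sym d) (n : ℤ) : eLpNorm (osc v (P.ker k n)) p volume
      ≤ ENNReal.ofReal ((2 : ℝ) ^ (-n)) * (∫⁻ z, ‖P.ker k 0 z‖ₑ * ‖z‖ₑ)
        * eLpNorm (fderiv ℝ v) p volume := by
  have hc : Continuous (fderiv ℝ v) := hv.continuous_fderiv (by simp)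
  have hvc : Continuous v := hv.continuous
  have hKm : Measurable fun z => ‖P.ker k 0 z‖ₑ * ‖z‖ₑ :=
    (P.ker k 0).continuous.measurable.enorm.mul measurable_enorm
  have hm : Measurable fun z : E d × (E d × ℝ) =>
      ‖fderiv ℝ v (z.1 + z.2.2 • (2 : ℝ) ^ (-n) • z.2.1)‖ₑ :=
    Measurable.enorm (Continuous.measurable (by fun_prop))
  have h := eLpNorm_lintegral_withDensity_prod_le hp hKm (lintegral_enorm_mul_enorm_ne_top _)
    (F := fun x z => ‖fderiv ℝ v (x + z.2 • (2 : ℝ) ^ (-n) • z.1)‖ₑ) hm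
    (A := eLpNorm (fderiv ℝ v) p volume) (fun z => by
      rw [eLpNorm_enorm (fun x => fderiv ℝ v (x + z.2 • (2 : ℝ) ^ (-n) • z.1)),
        eLpNorm_comp_const_add hc.aestronglyMeasurable])
  have hpt : ∀ x, osc v (P.ker k n) x ≤ ENNReal.ofReal ((2 : ℝ) ^ (-n)) *
      ∫⁻ z, (‖P.ker k 0 z‖ₑ * ‖z‖ₑ)
        * ∫⁻ t in Set.Ioc (0 : ℝ) 1, ‖fderiv ℝ v (x + t • (2 : ℝ) ^ (-n) • z)‖ₑ := fun x => by
    have e2 : osc v (P.ker k n) x =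
        ∫⁻ z, ‖P.ker k 0 z‖ₑ * ‖v (x + (2 : ℝ) ^ (-n) • z) - v x‖ₑ :=
      P.lintegral_ker_mul k n (G := fun z => ‖v (x + z) - v x‖ₑ)
        (Measurable.enorm (Continuous.measurable (by fun_prop)))
    rw [e2, ← lintegral_const_mul' _ _ ENNReal.ofReal_ne_top]
    refine lintegral_mono fun z => ?_
    beta_reduce
    calc _ ≤ ‖P.ker k 0 z‖ₑ * ∫⁻ t in Set.Ioc (0 : ℝ) 1,
          ‖fderiv ℝ v (x + t • (2 : ℝ) ^ (-n) • z)‖ₑ * ‖(2 : ℝ) ^ (-n) • z‖ₑ := by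
          gcongr
          exact enorm_sub_le_lintegral hv x _
      _ = _ := by
          rw [lintegral_mul_const' _ _ enorm_ne_top, enorm_smul,
            Real.enorm_of_nonneg (by positivity)]
          ring
  calc _ ≤ eLpNorm (fun x => ENNReal.ofReal ((2 : ℝ) ^ (-n)) *
      ∫⁻ z, (‖P.ker k 0 z‖ₑ * ‖z‖ₑ)
        * ∫⁻ t in Set.Ioc (0 : ℝ) 1, ‖fderiv ℝ v (x + t • (2 : ℝ) ^ (-n) • z)‖ₑ) p volume :=
        eLpNorm_mono_enorm hpt
    _ ≤ ENNReal.ofReal ((2 : ℝ) ^ (-n)) * eLpNorm (fun x =>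
      ∫⁻ z, (‖P.ker k 0 z‖ₑ * ‖z‖ₑ)
        * ∫⁻ t in Set.Ioc (0 : ℝ) 1, ‖fderiv ℝ v (x + t • (2 : ℝ) ^ (-n) • z)‖ₑ) p volume := by
        exact eLpNorm_ennreal_const_mul_le ENNReal.ofReal_ne_top _ _
    _ ≤ _ := by
        rw [mul_assoc]
        gcongr

/-! ### The dyadic blocks of a function -/

/-- The convolution kernel of a dyadic block. -/
noncomputable def blockKer : ℕ → 𝓢(E d, ℂ)
  | 0 => dilKer P.lowSym 0
  | q + 1 => P.ker Sym.one q

theorem fourier_blockKer (m : ℕ) (ξ : E d) : 𝓕 (P.blockKer m) ξ = P.symbol m ξ := by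
  cases m with
  | zero =>
    rw [blockKer, fourier_dilKer, symbol]
    simp only [neg_zero, zpow_zero, one_smul]
    rfl
  | succ q =>
    rw [blockKer, fourier_ker, symbol]
    simp only [Sym.one, mul_one]

theorem symbol_neg (m : ℕ) (ξ : E d) : P.symbol m (-ξ) = P.symbol m ξ := by
  cases m with
  | zero => simp only [symbol, P.χ_radial (-ξ) ξ (norm_neg ξ)]
  | succ q => simp only [symbol, smul_neg, P.φ_radial _ _ (norm_neg ((2 : ℝ) ^ (-(q : ℤ)) • ξ))]

theorem hasTemperateGrowth_symbol (m : ℕ) : (P.symbol m).HasTemperateGrowth := by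
  have : P.symbol m = (𝓕 (P.blockKer m) : 𝓢(E d, ℂ)) := by
    ext ξ
    exact (P.fourier_blockKer m ξ).symm
  rw [this]
  exact SchwartzMap.hasTemperateGrowth _

/-- Transposing the multiplier reflects its symbol; as χ and φ are radial, the reflection is
invisible and a block acts on test functions by plain convolution. -/
theorem block_apply (m : ℕ) (u : 𝓢'(E d, ℂ)) (g : 𝓢(E d, ℂ)) :
    P.block m u g = u (conv (P.blockKer m) g) := by
  rw [block, TemperedDistribution.fourierMultiplierCLM_apply_apply]
  congr 1
  have hinv : ∀ (f : 𝓢(E d, ℂ)) (ξ : E d), (𝓕 (𝓕 f) : 𝓢(E d, ℂ)) ξ = f (-ξ) := fun f ξ => by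
    have h1 : (𝓕⁻ (𝓕 f) : 𝓢(E d, ℂ)) = f :=
      FourierTransform.fourierInv_fourier_eq (E := 𝓢(E d, ℂ)) (F := 𝓢(E d, ℂ)) f
    have h2 : (𝓕⁻ (𝓕 f) : 𝓢(E d, ℂ)) (-ξ) = (𝓕 (𝓕 f) : 𝓢(E d, ℂ)) ξ := by
      rw [SchwartzMap.fourierInv_coe, Real.fourierInv_eq_fourier_neg,
        neg_neg, SchwartzMap.fourier_coe (𝓕 f)]
    rw [← h2, h1]
  refine fourier_injective fun ξ => ?_
  rw [hinv, fourier_conv, fourier_blockKer,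
    SchwartzMap.smulLeftCLM_apply_apply (P.hasTemperateGrowth_symbol m), symbol_neg, smul_eq_mul]
  congr 1
  rw [SchwartzMap.fourierInv_coe, Real.fourierInv_eq_fourier_neg, neg_neg, SchwartzMap.fourier_coe]

theorem isFunction_block {Θ : 𝓢'(E d, ℂ)} {θ : E d → ℂ} (hθ : TemperateInt θ)
    (hΘ : IsFunction Θ θ) (m : ℕ) : IsFunction (P.block m Θ) (corr (P.blockKer m) θ) := fun g =>
  ⟨hθ.integrable_corr_mul _ g, by rw [block_apply, (hΘ _).2, hθ.integral_corr_mul]⟩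

end DyadicPartition

theorem IsFunction.ae_eq {u : 𝓢'(E d, ℂ)} {f g : E d → ℂ} (hf : IsFunction u f)
    (hg : IsFunction u g) (hfl : LocallyIntegrable f) (hgl : LocallyIntegrable g) :
    f =ᵐ[volume] g := by
  refine ae_eq_of_integral_contDiff_smul_eq hfl hgl fun φ hφ hφc => ?_
  let φ' : 𝓢(E d, ℂ) := HasCompactSupport.toSchwartzMap (f := fun x => (φ x : ℂ))
    (hφc.comp_left (g := fun x : ℝ => (x : ℂ)) rfl) (Complex.ofRealCLM.contDiff.comp hφ)
  have h : ∀ f : E d → ℂ, ∫ x, φ x • f x = ∫ x, f x * φ' x := fun f =>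
    integral_congr_ae (Filter.Eventually.of_forall fun x => by
      change φ x • f x = f x * ((φ x : ℝ) : ℂ)
      rw [Complex.real_smul]; ring)
  rw [h, h, ← (hf φ').2, ← (hg φ').2]

/-- Any bounded representative equals f almost everywhere, and a bound valid almost everywhere holds
everywhere for a continuous f. -/
theorem enorm_le_distLpNorm_top {u : 𝓢'(E d, ℂ)} {f : E d → ℂ} (hf : IsFunction u f)
    (hc : Continuous f) (y : E d) : ‖f y‖ₑ ≤ distLpNorm ⊤ u := by
  rw [distLpNorm]
  refine le_iInf fun g => le_iInf fun hg => le_iInf fun hug => ?_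
  have h := hf.ae_eq hug hc.locallyIntegrable (hg.locallyIntegrable le_top)
  rw [← eLpNorm_congr_ae h, eLpNorm_exponent_top]
  have h2 := enorm_ae_le_eLpNormEssSup f volume
  have h3 := Continuous.ae_eq_iff_eq (μ := (volume : Measure (E d)))
    (f := fun y => max ‖f y‖ₑ (eLpNormEssSup f volume)) (g := fun _ => eLpNormEssSup f volume)
    (by fun_prop) continuous_const
  have := congrFun (h3.1 (by filter_upwards [h2] with y hy using max_eq_right hy)) y
  exact max_eq_right_iff.1 this

/-! ### Bernstein bounds for the homogeneous blocks of θ -/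

namespace DyadicPartition

variable (P : DyadicPartition d)

/-- The size of the homogeneous dyadic blocks of a function. -/
noncomputable def blockSize (p : ℝ≥0∞) (θ : E d → ℂ) (Θ : 𝓢'(E d, ℂ)) (q : ℤ) : ℝ≥0∞ :=
  if q ≤ 0 then ENNReal.ofReal ((2 : ℝ) ^ ((q : ℝ) * (d / p.toReal))) * eLpNorm θ p volume
  else ∑ i ∈ Finset.Icc (-1 : ℤ) 1, distLpNorm ⊤ (P.block (q + i + 1).toNat Θ)

/-- The amplitude gives 2^(qd) and the dilation 2^(-qd/p'); their product is 2^(qd/p). With Hölder's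
inequality this is Bernstein's inequality from L^p to L^∞. -/
theorem eLpNorm_ker {p p' : ℝ≥0∞} [hpp : p.HolderConjugate p'] (h : Sym d) (q : ℤ) :
    eLpNorm (P.ker h q) p' volume
      = ENNReal.ofReal ((2 : ℝ) ^ ((q : ℝ) * (d / p.toReal))) * eLpNorm (P.ker h 0) p' volume := by
  have h2 : (0 : ℝ) < (2 : ℝ) ^ q := by positivity
  have e : (P.ker h q : E d → ℂ)
      = (((2 : ℝ) ^ q) ^ d : ℝ) • fun x => P.ker h 0 (0 + (2 : ℝ) ^ q • x) := by
    ext x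
    rw [Pi.smul_apply, zero_add]
    exact P.ker_apply h q x
  rw [e, eLpNorm_const_smul, eLpNorm_comp_add_smul (P.ker h 0).continuous.aestronglyMeasurable _ _
    h2, ← mul_assoc, Real.enorm_of_nonneg (by positivity), ← ENNReal.ofReal_mul (by positivity)]
  congr 2
  have hr : p.toReal⁻¹ + p'.toReal⁻¹ = 1 := by
    have := ENNReal.HolderConjugate.inv_add_inv_eq_one p p'
    have h3 : (p⁻¹ + p'⁻¹).toReal = 1 := by rw [this]; rfl
    rwa [ENNReal.toReal_add (by simp [ENNReal.HolderConjugate.ne_zero p p'])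
      (by simp [ENNReal.HolderConjugate.ne_zero p' p]),
      ENNReal.toReal_inv, ENNReal.toReal_inv] at h3
  rw [← Real.rpow_natCast, ← Real.rpow_add h2, two_zpow_rpow]
  congr 2
  rw [div_eq_mul_inv, div_eq_mul_inv]
  linear_combination (-(d : ℝ)) * hr

theorem enorm_corr_ker_le_low {p p' : ℝ≥0∞} [hpp : p.HolderConjugate p'] {θ : E d → ℂ}
    (hθ : AEStronglyMeasurable θ volume) (h : Sym d) (q : ℤ) (y : E d) :
    ‖corr (P.ker h q) θ y‖ₑ ≤ eLpNorm (P.ker h 0) p' volume *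
      (ENNReal.ofReal ((2 : ℝ) ^ ((q : ℝ) * (d / p.toReal))) * eLpNorm θ p volume) := by
  have hc : AEStronglyMeasurable (fun x => P.ker h q (x - y)) volume :=
    Continuous.aestronglyMeasurable (by fun_prop)
  refine (enorm_integral_mul_le (p := p) (p' := p') hθ hc).trans (le_of_eq ?_)
  have : eLpNorm (fun x => P.ker h q (x - y)) p' volume = eLpNorm (P.ker h q) p' volume := by
    simp only [sub_eq_add_neg]
    exact eLpNorm_comp_const_add (P.ker h q).continuous.aestronglyMeasurable _ _
  rw [this, P.eLpNorm_ker (p := p)]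
  ring

theorem lintegral_ker (h : Sym d) (n : ℤ) :
    ∫⁻ z, ‖P.ker h n z‖ₑ = ∫⁻ z, ‖P.ker h 0 z‖ₑ := lintegral_dilKer _ n

theorem enorm_corr_le {f : E d → ℂ} (K : 𝓢(E d, ℂ)) {M : ℝ≥0∞} (hMt : M ≠ ⊤)
    (hM : ∀ x, ‖f x‖ₑ ≤ M) (y : E d) : ‖corr K f y‖ₑ ≤ (∫⁻ z, ‖K z‖ₑ) * M := by
  rw [corr_eq_integral_add, mul_comm, ← lintegral_const_mul' _ _ hMt]
  refine (enorm_integral_le_lintegral_enorm _).trans (lintegral_mono fun z => ?_)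
  rw [enorm_mul]; gcongr; exact hM _

theorem enorm_corr_ker_le_high {θ : E d → ℂ} {Θ : 𝓢'(E d, ℂ)} (hθ : TemperateInt θ)
    (hΘ : IsFunction Θ θ) (hfin : ∀ m, distLpNorm ⊤ (P.block m Θ) ≠ ⊤) (h : Sym d) {q : ℤ}
    (hq : 1 ≤ q) (y : E d) :
    ‖corr (P.ker h q) θ y‖ₑ ≤ (∫⁻ z, ‖P.ker h 0 z‖ₑ) *
      ∑ i ∈ Finset.Icc (-1 : ℤ) 1, distLpNorm ⊤ (P.block (q + i + 1).toNat Θ) := by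
  rw [P.ker_eq_sum_conv, hθ.corr_sum, Finset.mul_sum]
  refine (enorm_sum_le _ _).trans (Finset.sum_le_sum fun i hi => ?_)
  rw [Finset.mem_Icc] at hi
  -- As q ≥ 1 and i ≥ −1, each neighbour has index q + i ≥ 0. It is therefore an inhomogeneous
  -- block, numbered m + 1, and the low-frequency cut-off χ never enters.
  obtain ⟨m, hm⟩ : ∃ m : ℕ, q + i = m := ⟨(q + i).toNat, by omega⟩
  rw [conv_comm, ← hθ.corr_corr, ← P.lintegral_ker h q, hm]
  refine enorm_corr_le _ (hfin _) (fun x => ?_) y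
  exact enorm_le_distLpNorm_top (P.isFunction_block hθ hΘ (m + 1))
    (hθ.differentiable_corr _).continuous x

theorem exists_enorm_corr_ker_le {p : ℝ≥0∞} (hp : 1 ≤ p) (h : Sym d) : ∃ C : ℝ≥0,
    ∀ (θ : E d → ℂ) (Θ : 𝓢'(E d, ℂ)), MemLp θ p volume → IsFunction Θ θ →
      (∀ m, distLpNorm ⊤ (P.block m Θ) ≠ ⊤) → ∀ q y,
      ‖corr (P.ker h q) θ y‖ₑ ≤ C * P.blockSize p θ Θ q := by
  have hpp : p.HolderConjugate (1 - p⁻¹)⁻¹ :=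
    have := ENNReal.HolderConjugate.inv_one_sub_inv' hp
    ENNReal.HolderTriple.symm
  have h1 : eLpNorm (P.ker h 0) (1 - p⁻¹)⁻¹ volume ≠ ⊤ := ((P.ker h 0).memLp _ volume).2.ne
  have h2 : ∫⁻ z, ‖P.ker h 0 z‖ₑ ≠ ⊤ := (P.ker h 0).integrable.2.ne
  refine ⟨max (eLpNorm (P.ker h 0) (1 - p⁻¹)⁻¹ volume).toNNReal
    (∫⁻ z, ‖P.ker h 0 z‖ₑ).toNNReal, fun θ Θ hθ hΘ hfin q y => ?_⟩
  rw [ENNReal.coe_max, ENNReal.coe_toNNReal h1, ENNReal.coe_toNNReal h2, blockSize]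
  split_ifs with hq
  · exact (P.enorm_corr_ker_le_low (p := p) hθ.1 h q y).trans
      (mul_le_mul_left (le_max_left _ _) _)
  · exact (P.enorm_corr_ker_le_high (temperateInt_of_memLp hp hθ) hΘ hfin h (by omega) y).trans
      (mul_le_mul_left (le_max_right _ _) _)

theorem blockSize_ne_top {p : ℝ≥0∞} {θ : E d → ℂ} {Θ : 𝓢'(E d, ℂ)} (hθ : MemLp θ p volume)
    (hfin : ∀ m, distLpNorm ⊤ (P.block m Θ) ≠ ⊤) (q : ℤ) : P.blockSize p θ Θ q ≠ ⊤ := by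
  rw [blockSize]
  split_ifs
  · exact ENNReal.mul_ne_top ENNReal.ofReal_ne_top hθ.2.ne
  · exact ENNReal.sum_ne_top.2 fun i _ => hfin _

end DyadicPartition

/-! ### Bounds for the dyadic pieces of the commutator -/

theorem measurable_osc {v : E d → E d} (hv : Continuous v) (K : 𝓢(E d, ℂ)) :
    Measurable (osc v K) := by
  have : Measurable fun z : E d × E d => ‖K z.2‖ₑ * ‖v (z.1 + z.2) - v z.1‖ₑ :=
    (Measurable.enorm (Continuous.measurable (by fun_prop))).mul
      (Measurable.enorm (Continuous.measurable (by fun_prop)))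
  exact this.lintegral_prod_right'

theorem measurable_grad {v : E d → E d} (hv : ContDiff ℝ 1 v) (K : 𝓢(E d, ℂ)) :
    Measurable (grad v K) := by
  have hc : Continuous (fderiv ℝ v) := hv.continuous_fderiv (by simp)
  have : Measurable fun z : E d × E d => ‖K z.2‖ₑ * ‖fderiv ℝ v (z.1 + z.2)‖ₑ :=
    (Measurable.enorm (Continuous.measurable (by fun_prop))).mul
      (Measurable.enorm (Continuous.measurable (by fun_prop)))
  exact this.lintegral_prod_right'

theorem osc_le_of_holder {v : E d → E d} {Ω : ℝ≥0∞} (hΩt : Ω ≠ ⊤) {a : ℝ} (ha : 0 ≤ a)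
    (hΩ : ∀ x w, ‖v (x + w) - v x‖ₑ ≤ Ω * ‖w‖ₑ ^ a) (P : DyadicPartition d) (k : Sym d) (n : ℤ)
    (x : E d) (hvm : Continuous v) : osc v (P.ker k n) x ≤
      ENNReal.ofReal ((2 : ℝ) ^ (-(n : ℝ) * a)) * (∫⁻ z, ‖P.ker k 0 z‖ₑ * ‖z‖ₑ ^ a) * Ω := by
  rw [osc, P.lintegral_ker_mul k n (G := fun z => ‖v (x + z) - v x‖ₑ)
    (Measurable.enorm (Continuous.measurable (by fun_prop))),
    mul_right_comm, ← lintegral_const_mul' _ _ (ENNReal.mul_ne_top ENNReal.ofReal_ne_top hΩt)]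
  refine lintegral_mono fun z => ?_
  beta_reduce
  calc _ ≤ ‖P.ker k 0 z‖ₑ * (Ω * ‖(2 : ℝ) ^ (-n) • z‖ₑ ^ a) := by
        gcongr
        exact hΩ _ _
    _ = _ := by
        rw [enorm_smul, ENNReal.mul_rpow_of_nonneg _ _ ha, Real.enorm_of_nonneg (by positivity),
          ENNReal.ofReal_rpow_of_nonneg (by positivity) ha, two_zpow_rpow]
        push_cast
        ring

theorem lintegral_enorm_mul_enorm_rpow_ne_top (K : 𝓢(E d, ℂ)) {a : ℝ} (ha : 0 ≤ a) :
    ∫⁻ z, ‖K z‖ₑ * ‖z‖ₑ ^ a ≠ ⊤ := by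
  have h := integrable_one_add_norm_rpow_mul K a
  refine ne_top_of_le_ne_top h.2.ne (lintegral_mono fun z => ?_)
  rw [enorm_mul, mul_comm]
  gcongr
  · rw [← ofReal_norm, ENNReal.ofReal_rpow_of_nonneg (norm_nonneg _) ha,
      Real.enorm_of_nonneg (by positivity)]
    gcongr
    linarith [norm_nonneg z]
  · rw [enorm_norm]

namespace DyadicPartition

variable (P : DyadicPartition d)

theorem exists_enorm_corr_ker_le_family {p : ℝ≥0∞} (hp : 1 ≤ p) {ι : Type*} [Fintype ι]
    (h : ι → Sym d) : ∃ C : ℝ≥0,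
    ∀ (θ : E d → ℂ) (Θ : 𝓢'(E d, ℂ)), MemLp θ p volume → IsFunction Θ θ →
      (∀ m, distLpNorm ⊤ (P.block m Θ) ≠ ⊤) → ∀ i q y,
      ‖corr (P.ker (h i) q) θ y‖ₑ ≤ C * P.blockSize p θ Θ q := by
  choose C hC using fun i => P.exists_enorm_corr_ker_le hp (h i)
  refine ⟨∑ i, C i, fun θ Θ hθ hΘ hf i q y => (hC i θ Θ hθ hΘ hf q y).trans ?_⟩
  gcongr
  exact Finset.single_le_sum (f := C) (fun _ _ => zero_le) (Finset.mem_univ i)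

/-- The data common to all the estimates: a divergence-free field, and a function. -/
structure Admissible (v : E d → E d) (p : ℝ≥0∞) (θ : E d → ℂ) (Θ : 𝓢'(E d, ℂ)) : Prop where
  smooth : ContDiff ℝ ∞ v
  div : DivergenceFree v
  temp : ∀ i, TemperateInt (comp v i)
  temp_fderiv : ∀ i j, TemperateInt fun y => fderiv ℝ (comp v i) y (EuclideanSpace.single j 1)
  cont : Continuous θ
  memLp : MemLp θ p volume
  isFunction : IsFunction Θ θ
  finite : ∀ m, distLpNorm ⊤ (P.block m Θ) ≠ ⊤

variable {P}

theorem exists_comm_le_osc {p : ℝ≥0∞} (hp : 1 ≤ p) (h : Sym d) : ∃ C : ℝ≥0,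
    ∀ (v : E d → E d) (θ : E d → ℂ) (Θ : 𝓢'(E d, ℂ)), P.Admissible v p θ Θ → ∀ (k : Sym d) n q x,
      ‖comm v (corr (P.ker h q) θ) (P.ker k n) x‖ₑ ≤
        ENNReal.ofReal ((2 : ℝ) ^ q) * (C * P.blockSize p θ Θ q) * osc v (P.ker k n) x := by
  -- Indexing by `Option (Fin d)` gives one constant for h and all its `mulX j` together.
  obtain ⟨C, hC⟩ := P.exists_enorm_corr_ker_le_family hp
    (fun i : Option (Fin d) => i.elim h fun j => h.mulX j)
  refine ⟨C * d, fun v θ Θ H k n q x => ?_⟩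
  have hS := hC θ Θ H.memLp H.isFunction H.finite
  refine (P.enorm_comm_corr_le_osc H.smooth H.temp H.temp_fderiv (temperateInt_of_memLp hp H.memLp)
    (ENNReal.mul_ne_top ENNReal.coe_ne_top (P.blockSize_ne_top H.memLp H.finite q)) H.div h q
    (fun y => hS none q y) (fun j y => hS (some j) q y) _ x).trans (le_of_eq ?_)
  push_cast
  ring

theorem exists_comm_le_osc_mulX {p : ℝ≥0∞} (hp : 1 ≤ p) (h : Sym d) : ∃ C : ℝ≥0,
    ∀ (v : E d → E d) (θ : E d → ℂ) (Θ : 𝓢'(E d, ℂ)), P.Admissible v p θ Θ → ∀ (k : Sym d) n q x,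
      ‖comm v (corr (P.ker h q) θ) (P.ker k n) x‖ₑ ≤
        ENNReal.ofReal ((2 : ℝ) ^ n) * (C * P.blockSize p θ Θ q) *
          ∑ i, osc v (P.ker (k.mulX i) n) x := by
  obtain ⟨C, hC⟩ := P.exists_enorm_corr_ker_le hp h
  refine ⟨C, fun v θ Θ H k n q x => ?_⟩
  exact P.enorm_comm_le_osc_mulX v
    (ENNReal.mul_ne_top ENNReal.coe_ne_top (P.blockSize_ne_top H.memLp H.finite q))
    (hC θ Θ H.memLp H.isFunction H.finite q) k n x

theorem exists_comm_le_grad {p : ℝ≥0∞} (hp : 1 ≤ p) (h : Sym d) : ∃ C : ℝ≥0,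
    ∀ (v : E d → E d) (θ : E d → ℂ) (Θ : 𝓢'(E d, ℂ)), P.Admissible v p θ Θ → ∀ (k : Sym d) n q x,
      ‖comm v (corr (P.ker h q) θ) (P.ker k n) x‖ₑ ≤
        ENNReal.ofReal ((2 : ℝ) ^ (-q)) * (C * P.blockSize p θ Θ q) *
          ∑ i, ∑ j, (ENNReal.ofReal ((2 : ℝ) ^ n) * grad v (P.ker (k.mulX i) n) x
            + ENNReal.ofReal ((2 : ℝ) ^ n) * ENNReal.ofReal ((2 : ℝ) ^ n) *
              osc v (P.ker ((k.mulX i).mulX j) n) x) := by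
  obtain ⟨C₁, h₁⟩ := P.exists_enorm_corr_ker_le_family hp fun j => h.divX j
  obtain ⟨C₂, h₂⟩ := P.exists_enorm_corr_ker_le_family hp
    fun j : Fin d × Fin d => (h.divX j.1).mulX j.2
  refine ⟨max C₁ C₂, fun v θ Θ H k n q x => ?_⟩
  have hS₁ := h₁ θ Θ H.memLp H.isFunction H.finite
  have hS₂ := h₂ θ Θ H.memLp H.isFunction H.finite
  refine P.enorm_comm_corr_le_grad H.smooth H.temp H.temp_fderiv (temperateInt_of_memLp hp H.memLp)
    (ENNReal.mul_ne_top ENNReal.coe_ne_top (P.blockSize_ne_top H.memLp H.finite q)) h q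
    (fun j y => (hS₁ j q y).trans ?_) (fun j i y => (hS₂ (j, i) q y).trans ?_) k n x
  · gcongr; exact le_max_left _ _
  · gcongr; exact le_max_right _ _

/-- The oscillation bound gives 2^q · 2^(-n) for q ≤ n, and the gradient bound 2^(-q) · 2^n for n ≤
q. -/
theorem exists_eLpNorm_comm_le {p : ℝ≥0∞} (hp : 1 ≤ p) (h k : Sym d) : ∃ C : ℝ≥0,
    ∀ (v : E d → E d) (θ : E d → ℂ) (Θ : 𝓢'(E d, ℂ)), P.Admissible v p θ Θ → ∀ n q : ℤ,
      eLpNorm (comm v (corr (P.ker h q) θ) (P.ker k n)) p volume ≤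
        C * (eLpNorm (fderiv ℝ v) p volume * ENNReal.ofReal ((2 : ℝ) ^ (-|(n : ℝ) - q|)) *
          P.blockSize p θ Θ q) := by
  obtain ⟨C₁, h₁⟩ := exists_comm_le_osc (P := P) hp h
  obtain ⟨C₂, h₂⟩ := exists_comm_le_grad (P := P) hp h
  let a : Sym d → ℝ≥0 := fun k => (∫⁻ z, ‖P.ker k 0 z‖ₑ).toNNReal
  let b : Sym d → ℝ≥0 := fun k => (∫⁻ z, ‖P.ker k 0 z‖ₑ * ‖z‖ₑ).toNNReal
  have ha : ∀ k, (a k : ℝ≥0∞) = ∫⁻ z, ‖P.ker k 0 z‖ₑ := fun k =>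
    ENNReal.coe_toNNReal (P.ker k 0).integrable.2.ne
  have hb : ∀ k, (b k : ℝ≥0∞) = ∫⁻ z, ‖P.ker k 0 z‖ₑ * ‖z‖ₑ := fun k =>
    ENNReal.coe_toNNReal (lintegral_enorm_mul_enorm_ne_top _)
  refine ⟨max (C₁ * b k) (C₂ * ∑ i, ∑ j, (a (k.mulX i) + b ((k.mulX i).mulX j))),
    fun v θ Θ H n q => ?_⟩
  have hv : ContDiff ℝ 1 v := H.smooth.of_le (by simp)
  have hγt := P.blockSize_ne_top H.memLp H.finite q
  have h2 : ∀ m : ℤ, ENNReal.ofReal ((2 : ℝ) ^ m) * ENNReal.ofReal ((2 : ℝ) ^ (-m)) = 1 :=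
    fun m => by
      rw [← ENNReal.ofReal_mul (by positivity), ← zpow_add₀ two_ne_zero]; simp
  have hpow : ∀ m l : ℤ, ENNReal.ofReal ((2 : ℝ) ^ m) * ENNReal.ofReal ((2 : ℝ) ^ l)
      = ENNReal.ofReal ((2 : ℝ) ^ (((m + l : ℤ) : ℝ))) := fun m l => by
    rw [← ENNReal.ofReal_mul (by positivity), ← zpow_add₀ two_ne_zero, Real.rpow_intCast]
  rw [ENNReal.coe_max]
  rcases le_total q n with hqn | hqn
  · refine le_trans ?_ (mul_le_mul_left (le_max_left _ _) _)
    calc _ ≤ eLpNorm (fun x => ENNReal.ofReal ((2 : ℝ) ^ q) * (C₁ * P.blockSize p θ Θ q) *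
          osc v (P.ker k n) x) p volume := eLpNorm_mono_enorm fun x => h₁ v θ Θ H k n q x
      _ ≤ ENNReal.ofReal ((2 : ℝ) ^ q) * (C₁ * P.blockSize p θ Θ q) *
          (ENNReal.ofReal ((2 : ℝ) ^ (-n)) * b k * eLpNorm (fderiv ℝ v) p volume) := by
          refine (eLpNorm_ennreal_const_mul_le (by finiteness) _ _).trans ?_
          gcongr
          rw [hb]
          exact P.eLpNorm_osc_ker_le hv hp k n
      _ = _ := by
          rw [show -|(n : ℝ) - q| = ((q + -n : ℤ) : ℝ) by
            have : (q : ℝ) ≤ n := by exact_mod_cast hqn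
            rw [abs_of_nonneg (by linarith)]; push_cast; ring, ← hpow]
          push_cast
          ring
  · refine le_trans ?_ (mul_le_mul_left (le_max_right _ _) _)
    have hm1 := fun i => measurable_grad hv (P.ker (k.mulX i) n)
    have hm2 := fun i j => measurable_osc hv.continuous (P.ker ((k.mulX i).mulX j) n)
    let F : Fin d → Fin d → E d → ℝ≥0∞ := fun i j x =>
      ENNReal.ofReal ((2 : ℝ) ^ n) * grad v (P.ker (k.mulX i) n) x
    let G : Fin d → Fin d → E d → ℝ≥0∞ := fun i j x =>
      ENNReal.ofReal ((2 : ℝ) ^ n) * ENNReal.ofReal ((2 : ℝ) ^ n) *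
              osc v (P.ker ((k.mulX i).mulX j) n) x
    have hF : ∀ i j, AEStronglyMeasurable (F i j) volume := fun i j =>
      ((hm1 i).const_mul _).aestronglyMeasurable
    have hG : ∀ i j, AEStronglyMeasurable (G i j) volume := fun i j =>
      ((hm2 i j).const_mul _).aestronglyMeasurable
    have hFG : ∀ i j, eLpNorm (F i j + G i j) p volume ≤ ENNReal.ofReal ((2 : ℝ) ^ n) *
        (a (k.mulX i) + b ((k.mulX i).mulX j)) * eLpNorm (fderiv ℝ v) p volume := fun i j => by
      refine (eLpNorm_add_le (hF i j) (hG i j) hp).trans ?_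
      calc _ ≤ ENNReal.ofReal ((2 : ℝ) ^ n) * (a (k.mulX i) * eLpNorm (fderiv ℝ v) p volume)
            + ENNReal.ofReal ((2 : ℝ) ^ n) * ENNReal.ofReal ((2 : ℝ) ^ n) *
              (ENNReal.ofReal ((2 : ℝ) ^ (-n)) * b ((k.mulX i).mulX j)
                * eLpNorm (fderiv ℝ v) p volume) := by
            refine add_le_add
              ((eLpNorm_ennreal_const_mul_le (by finiteness) _ _).trans ?_)
              ((eLpNorm_ennreal_const_mul_le (by finiteness) _ _).trans ?_)
            · gcongr
              rw [ha]
              exact P.eLpNorm_grad_ker_le hv hp _ n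
            · gcongr
              rw [hb]
              exact P.eLpNorm_osc_ker_le hv hp _ n
        _ = ENNReal.ofReal ((2 : ℝ) ^ n) * (a (k.mulX i) * eLpNorm (fderiv ℝ v) p volume)
            + ENNReal.ofReal ((2 : ℝ) ^ n) * (ENNReal.ofReal ((2 : ℝ) ^ n) *
              ENNReal.ofReal ((2 : ℝ) ^ (-n))) * (b ((k.mulX i).mulX j)
                * eLpNorm (fderiv ℝ v) p volume) := by ring
        _ = _ := by rw [h2]; ring
    calc _ ≤ eLpNorm (fun x => ENNReal.ofReal ((2 : ℝ) ^ (-q)) * (C₂ * P.blockSize p θ Θ q) *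
          (∑ i, ∑ j, (F i j + G i j)) x) p volume := eLpNorm_mono_enorm fun x => by
            refine (h₂ v θ Θ H k n q x).trans (le_of_eq ?_)
            simp only [Finset.sum_apply, Pi.add_apply, F, G]
            rfl
      _ ≤ ENNReal.ofReal ((2 : ℝ) ^ (-q)) * (C₂ * P.blockSize p θ Θ q) *
          ∑ i, ∑ j, ENNReal.ofReal ((2 : ℝ) ^ n) *
        (a (k.mulX i) + b ((k.mulX i).mulX j)) * eLpNorm (fderiv ℝ v) p volume := by
          refine (eLpNorm_ennreal_const_mul_le (by finiteness) _ _).trans ?_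
          gcongr
          refine (eLpNorm_sum_le (fun i _ => Finset.aestronglyMeasurable_sum _ fun j _ =>
            (hF i j).add (hG i j)) hp).trans (Finset.sum_le_sum fun i _ => ?_)
          refine (eLpNorm_sum_le (fun j _ => (hF i j).add (hG i j)) hp).trans
            (Finset.sum_le_sum fun j _ => hFG i j)
      _ = _ := by
          rw [show -|(n : ℝ) - q| = ((n + -q : ℤ) : ℝ) by
            have : (n : ℝ) ≤ q := by exact_mod_cast hqn
            rw [abs_of_nonpos (by linarith)]; push_cast; ring, ← hpow]
          push_cast
          simp only [← Finset.sum_mul, ← Finset.mul_sum]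
          ring

/-- For a (1 − κ)-Hölder field an increment is worth 2^(-n(1-κ)). When q ≤ n the exponent is q − n(1
− κ) = κq − (1 − κ)(n − q); when n ≤ q it is nκ = κq − κ(q − n). This accounts for the two
conditions on μ. -/
theorem exists_enorm_comm_le {p : ℝ≥0∞} (hp : 1 ≤ p) {κ μ : ℝ} (hκ1 : κ ≤ 1)
    (hμ : μ ≤ κ) (hμ' : μ ≤ 1 - κ) (h k : Sym d) : ∃ C : ℝ≥0,
    ∀ (v : E d → E d) (θ : E d → ℂ) (Θ : 𝓢'(E d, ℂ)) (Ω : ℝ≥0∞), P.Admissible v p θ Θ → Ω ≠ ⊤ →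
      (∀ x w, ‖v (x + w) - v x‖ₑ ≤ Ω * ‖w‖ₑ ^ (1 - κ)) → ∀ (n q : ℤ) x,
      ‖comm v (corr (P.ker h q) θ) (P.ker k n) x‖ₑ ≤
        C * (Ω * ENNReal.ofReal ((2 : ℝ) ^ (-(μ * |(n : ℝ) - q|) + κ * q)) *
          P.blockSize p θ Θ q) := by
  obtain ⟨C₁, h₁⟩ := exists_comm_le_osc (P := P) hp h
  obtain ⟨C₂, h₂⟩ := exists_comm_le_osc_mulX (P := P) hp h
  have hκ : 0 ≤ 1 - κ := by linarith
  let b : Sym d → ℝ≥0 := fun k => (∫⁻ z, ‖P.ker k 0 z‖ₑ * ‖z‖ₑ ^ (1 - κ)).toNNReal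
  have hb : ∀ k, (b k : ℝ≥0∞) = ∫⁻ z, ‖P.ker k 0 z‖ₑ * ‖z‖ₑ ^ (1 - κ) := fun k =>
    ENNReal.coe_toNNReal (lintegral_enorm_mul_enorm_rpow_ne_top _ hκ)
  refine ⟨max (C₁ * b k) (C₂ * ∑ i, b (k.mulX i)), fun v θ Θ Ω H hΩt hΩ n q x => ?_⟩
  have hpow : ∀ (m : ℤ) (l t : ℝ), m + l ≤ t → ENNReal.ofReal ((2 : ℝ) ^ m) *
      ENNReal.ofReal ((2 : ℝ) ^ l) ≤ ENNReal.ofReal ((2 : ℝ) ^ t) := fun m l t hml => by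
    rw [← ENNReal.ofReal_mul (by positivity), ← Real.rpow_intCast,
      ← Real.rpow_add two_pos]
    exact ENNReal.ofReal_le_ofReal (Real.rpow_le_rpow_of_exponent_le one_le_two hml)
  rw [ENNReal.coe_max]
  rcases le_total q n with hqn | hqn
  · have hqn' : (q : ℝ) ≤ n := by exact_mod_cast hqn
    refine le_trans ?_ (mul_le_mul_left (le_max_left _ _) _)
    calc _ ≤ ENNReal.ofReal ((2 : ℝ) ^ q) * (C₁ * P.blockSize p θ Θ q) *
          (ENNReal.ofReal ((2 : ℝ) ^ (-(n : ℝ) * (1 - κ))) * b k * Ω) := by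
          refine (h₁ v θ Θ H k n q x).trans ?_
          gcongr
          rw [hb]
          exact osc_le_of_holder hΩt hκ hΩ P k n x H.smooth.continuous
      _ = (ENNReal.ofReal ((2 : ℝ) ^ q) * ENNReal.ofReal ((2 : ℝ) ^ (-(n : ℝ) * (1 - κ)))) *
          (C₁ * b k * Ω * P.blockSize p θ Θ q) := by ring
      _ ≤ ENNReal.ofReal ((2 : ℝ) ^ (-(μ * |(n : ℝ) - q|) + κ * q)) *
          (C₁ * b k * Ω * P.blockSize p θ Θ q) := by
          refine mul_le_mul_left (hpow _ _ _ ?_) _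
          rw [abs_of_nonneg (by linarith)]
          nlinarith
      _ = _ := by push_cast; ring
  · have hqn' : (n : ℝ) ≤ q := by exact_mod_cast hqn
    refine le_trans ?_ (mul_le_mul_left (le_max_right _ _) _)
    calc _ ≤ ENNReal.ofReal ((2 : ℝ) ^ n) * (C₂ * P.blockSize p θ Θ q) *
          ∑ i, (ENNReal.ofReal ((2 : ℝ) ^ (-(n : ℝ) * (1 - κ))) * b (k.mulX i) * Ω) := by
          refine (h₂ v θ Θ H k n q x).trans ?_
          gcongr
          rw [hb]
          exact osc_le_of_holder hΩt hκ hΩ P _ n x H.smooth.continuous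
      _ = (ENNReal.ofReal ((2 : ℝ) ^ n) * ENNReal.ofReal ((2 : ℝ) ^ (-(n : ℝ) * (1 - κ)))) *
          (C₂ * (∑ i, (b (k.mulX i) : ℝ≥0∞)) * Ω * P.blockSize p θ Θ q) := by
          rw [← Finset.sum_mul, ← Finset.mul_sum]; ring
      _ ≤ ENNReal.ofReal ((2 : ℝ) ^ (-(μ * |(n : ℝ) - q|) + κ * q)) *
          (C₂ * (∑ i, (b (k.mulX i) : ℝ≥0∞)) * Ω * P.blockSize p θ Θ q) := by
          refine mul_le_mul_left (hpow _ _ _ ?_) _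
          rw [abs_of_nonpos (by linarith)]
          nlinarith
      _ = _ := by push_cast; ring

theorem Admissible.exists_norm_corr_ker_le {p : ℝ≥0∞} (hp : 1 ≤ p) {v : E d → E d} {θ : E d → ℂ}
    {Θ : 𝓢'(E d, ℂ)} (H : P.Admissible v p θ Θ) (h h' : Sym d) (q : ℤ) :
    ∃ A : ℝ, (∀ y, ‖corr (P.ker h q) θ y‖ ≤ A) ∧ ∀ y, ‖corr (P.ker h' q) θ y‖ ≤ A := by
  have key : ∀ h : Sym d, ∃ A : ℝ, ∀ y, ‖corr (P.ker h q) θ y‖ ≤ A := fun h => by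
    obtain ⟨C, hC⟩ := P.exists_enorm_corr_ker_le hp h
    refine ⟨(C * P.blockSize p θ Θ q).toReal, fun y => ?_⟩
    rw [← toReal_enorm]
    exact ENNReal.toReal_mono
      (ENNReal.mul_ne_top ENNReal.coe_ne_top (P.blockSize_ne_top H.memLp H.finite q))
      (hC θ Θ H.memLp H.isFunction H.finite q y)
  obtain ⟨A, hA⟩ := key h
  obtain ⟨B, hB⟩ := key h'
  exact ⟨max A B, fun y => (hA y).trans (le_max_left _ _), fun y => (hB y).trans (le_max_right _ _)⟩

theorem Admissible.piece_eq {p : ℝ≥0∞} (hp : 1 ≤ p) {v : E d → E d} {θ : E d → ℂ}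
    {Θ : 𝓢'(E d, ℂ)} (H : P.Admissible v p θ Θ) (i₀ : Fin d) (n q : ℤ) :
    P.piece i₀ v θ n q = comm v (corr (P.ker Sym.one q) θ) (P.ker (Sym.riesz i₀) n)
      - comm v (corr (P.ker (Sym.riesz i₀) q) θ) (P.ker Sym.one n) := by
  obtain ⟨A, hA, hA'⟩ := H.exists_norm_corr_ker_le hp Sym.one (Sym.riesz i₀) q
  ext x
  exact P.piece_eq_comm H.temp (temperateInt_of_memLp hp H.memLp) i₀ hA hA' n x

theorem Admissible.continuous_piece {p : ℝ≥0∞} (hp : 1 ≤ p) {v : E d → E d} {θ : E d → ℂ}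
    {Θ : 𝓢'(E d, ℂ)} (H : P.Admissible v p θ Θ) (i₀ : Fin d) (n q : ℤ) :
    Continuous (P.piece i₀ v θ n q) := by
  obtain ⟨A, hA, hA'⟩ := H.exists_norm_corr_ker_le hp Sym.one (Sym.riesz i₀) q
  exact P.continuous_piece H.temp (temperateInt_of_memLp hp H.memLp) i₀ hA hA' n

/-- Read `sum_corr_pd_eq` backwards: the commutator is a combination of differentiable correlations
and components of v. -/
theorem Admissible.continuous_comm {p : ℝ≥0∞} (hp : 1 ≤ p) {v : E d → E d} {θ : E d → ℂ}
    {Θ : 𝓢'(E d, ℂ)} (H : P.Admissible v p θ Θ) (h : Sym d) (q : ℤ) (K : 𝓢(E d, ℂ)) :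
    Continuous (comm v (corr (P.ker h q) θ) K) := by
  obtain ⟨A, hA, -⟩ := H.exists_norm_corr_ker_le hp h h q
  have hθ := temperateInt_of_memLp hp H.memLp
  have e : comm v (corr (P.ker h q) θ) K = fun x =>
      (∑ i, corr (pd i K) (fun y => corr (P.ker h q) θ y * comp v i y) x) -
      ∑ i, comp v i x * corr (conv (P.ker h q) (pd i K)) θ x := by
    ext x
    rw [P.sum_corr_pd_eq H.temp hθ hA]; ring
  have hvd : Differentiable ℝ v := H.smooth.differentiable (by simp)
  rw [e]
  exact (continuous_finsetSum _ fun i _ => ((P.temperateInt_corr_mul_comp H.temp hθ hA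
    i).differentiable_corr _).continuous).sub (continuous_finsetSum _ fun i _ => by
      have : Continuous (comp v i) := continuous_iff_continuousAt.2 fun x =>
        (hasFDerivAt_comp (hvd x) i).continuousAt
      exact this.mul (hθ.differentiable_corr _).continuous)

theorem exists_eLpNorm_piece_le {p : ℝ≥0∞} (hp : 1 ≤ p) (i₀ : Fin d) : ∃ C : ℝ≥0,
    ∀ (v : E d → E d) (θ : E d → ℂ) (Θ : 𝓢'(E d, ℂ)), P.Admissible v p θ Θ → ∀ n q : ℤ,
      eLpNorm (P.piece i₀ v θ n q) p volume ≤
        C * (eLpNorm (fderiv ℝ v) p volume * ENNReal.ofReal ((2 : ℝ) ^ (-|(n : ℝ) - q|)) *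
          P.blockSize p θ Θ q) := by
  obtain ⟨C₁, h₁⟩ := exists_eLpNorm_comm_le (P := P) hp Sym.one (Sym.riesz i₀)
  obtain ⟨C₂, h₂⟩ := exists_eLpNorm_comm_le (P := P) hp (Sym.riesz i₀) Sym.one
  refine ⟨C₁ + C₂, fun v θ Θ H n q => ?_⟩
  rw [H.piece_eq hp]
  refine (eLpNorm_sub_le (H.continuous_comm hp _ _ _).aestronglyMeasurable
    (H.continuous_comm hp _ _ _).aestronglyMeasurable hp).trans ?_
  rw [ENNReal.coe_add, add_mul]
  exact add_le_add (h₁ v θ Θ H n q) (h₂ v θ Θ H n q)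

theorem exists_eLpNorm_top_piece_le {p : ℝ≥0∞} (hp : 1 ≤ p) {κ μ : ℝ} (hκ1 : κ ≤ 1)
    (hμ : μ ≤ κ) (hμ' : μ ≤ 1 - κ) (i₀ : Fin d) : ∃ C : ℝ≥0,
    ∀ (v : E d → E d) (θ : E d → ℂ) (Θ : 𝓢'(E d, ℂ)) (Ω : ℝ≥0∞), P.Admissible v p θ Θ → Ω ≠ ⊤ →
      (∀ x w, ‖v (x + w) - v x‖ₑ ≤ Ω * ‖w‖ₑ ^ (1 - κ)) → ∀ n q : ℤ,
      eLpNorm (P.piece i₀ v θ n q) ⊤ volume ≤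
        C * (Ω * ENNReal.ofReal ((2 : ℝ) ^ (-(μ * |(n : ℝ) - q|) + κ * q)) *
          P.blockSize p θ Θ q) := by
  obtain ⟨C₁, h₁⟩ := exists_enorm_comm_le (P := P) hp hκ1 hμ hμ' Sym.one (Sym.riesz i₀)
  obtain ⟨C₂, h₂⟩ := exists_enorm_comm_le (P := P) hp hκ1 hμ hμ' (Sym.riesz i₀) Sym.one
  refine ⟨C₁ + C₂, fun v θ Θ Ω H hΩt hΩ n q => ?_⟩
  rw [H.piece_eq hp, eLpNorm_exponent_top]
  refine eLpNormEssSup_le_of_ae_enorm_bound (Filter.Eventually.of_forall fun x => ?_)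
  rw [ENNReal.coe_add, add_mul]
  exact enorm_sub_le.trans (add_le_add (h₁ v θ Θ Ω H hΩt hΩ n q x) (h₂ v θ Θ Ω H hΩt hΩ n q x))

end DyadicPartition

/-! ### Series of functions and tempered distributions -/

/-- A tempered distribution given by an absolutely convergent series of functions in `L^p` lies in
`L^p`. -/
theorem distLpNorm_le_tsum {ι : Type*} [Countable ι] {p : ℝ≥0∞} (hp : 1 ≤ p) {f : ι → E d → ℂ}
    (hf : ∀ k, MemLp (f k) p volume) (hs : ∑' k, eLpNorm (f k) p volume ≠ ⊤) {u : 𝓢'(E d, ℂ)}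
    (hu : ∀ g : 𝓢(E d, ℂ), HasSum (fun k => ∫ x, f k x * g x) (u g)) :
    distLpNorm p u ≤ ∑' k, eLpNorm (f k) p volume := by
  have : Fact (1 ≤ p) := ⟨hp⟩
  let F : ι → Lp ℂ p (volume : Measure (E d)) := fun k => (hf k).toLp
  have hFe : ∀ k, ‖F k‖ₑ = eLpNorm (f k) p volume := fun k => Lp.enorm_toLp (hf k)
  have hsn : Summable fun k => ‖F k‖ := by
    have h1 := ENNReal.summable_toReal (f := fun k => ‖F k‖ₑ) (by simpa only [hFe] using hs)
    simpa using h1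
  have hsum : HasSum F (∑' k, F k) := hsn.of_norm.hasSum
  set G : Lp ℂ p (volume : Measure (E d)) := ∑' k, F k with hG
  have hGle : ‖G‖ₑ ≤ ∑' k, eLpNorm (f k) p volume := by
    simp only [← hFe]
    exact enorm_tsum_le_tsum_enorm
  have hGf : IsFunction u G := fun g => by
    have hm := (temperateInt_of_memLp hp (Lp.memLp G)).integrable_mul g
    refine ⟨hm, (hu g).unique ?_⟩
    -- L^p embeds continuously in the tempered distributions, so the sum in L^p and the given sum
    -- against test functions represent the same distribution.
    have h1 : HasSum (fun k => Lp.toTemperedDistributionCLM ℂ volume p (F k))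
        (Lp.toTemperedDistributionCLM ℂ volume p G) :=
      hsum.mapL (Lp.toTemperedDistributionCLM ℂ volume p)
    have h2 := h1.mapL (PointwiseConvergenceCLM.evalCLM (RingHom.id ℂ) ℂ g)
    have h3 : ∀ H : Lp ℂ p (volume : Measure (E d)),
        PointwiseConvergenceCLM.evalCLM (RingHom.id ℂ) ℂ g
          (Lp.toTemperedDistributionCLM ℂ volume p H) = ∫ x, H x * g x := fun H => by
      change Lp.toTemperedDistribution H g = _
      rw [Lp.toTemperedDistribution_apply]
      refine integral_congr_ae (Filter.Eventually.of_forall fun x => ?_)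
      simp only [smul_eq_mul]; ring
    rw [h3] at h2
    refine h2.congr_fun fun k => ?_
    rw [h3]
    refine integral_congr_ae ?_
    filter_upwards [(hf k).coeFn_toLp] with x hx
    rw [hx]
  rw [distLpNorm]
  refine ((iInf_le _ (G : E d → ℂ)).trans ((iInf_le _ (Lp.memLp G)).trans (iInf_le _ hGf))).trans ?_
  rwa [← Lp.enorm_def]

theorem corr_neg_eq_conv (K g : 𝓢(E d, ℂ)) :
    corr (SchwartzMap.compCLMOfContinuousLinearEquiv ℂ (ContinuousLinearEquiv.neg ℝ) K) g
      = conv K g := by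
  ext x
  rw [corr, conv_apply]
  refine integral_congr_ae (Filter.Eventually.of_forall fun y => ?_)
  simp only [SchwartzMap.compCLMOfContinuousLinearEquiv_apply, Function.comp,
    ContinuousLinearEquiv.coe_neg, Pi.neg_apply, id, neg_sub]
  ring

/-- Young's inequality for convolutions. -/
theorem eLpNorm_conv_le (K g : 𝓢(E d, ℂ)) {p : ℝ≥0∞} (hp : 1 ≤ p) :
    eLpNorm (conv K g) p volume ≤ (∫⁻ z, ‖K z‖ₑ) * eLpNorm g p volume := by
  rw [← corr_neg_eq_conv]
  refine (eLpNorm_corr_le g.continuous.measurable _ hp).trans (le_of_eq ?_)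
  congr 1
  exact lintegral_neg_eq_self (fun z => ‖K z‖ₑ)

theorem conv_sum_left {ι : Type*} (s : Finset ι) (K : ι → 𝓢(E d, ℂ)) (g : 𝓢(E d, ℂ)) :
    conv (∑ i ∈ s, K i) g = ∑ i ∈ s, conv (K i) g :=
  fourier_injective fun ξ => by
    simp only [DyadicPartition.fourier_sum, fourier_conv, Finset.sum_mul]

theorem conv_sum_right {ι : Type*} (s : Finset ι) (K : 𝓢(E d, ℂ)) (g : ι → 𝓢(E d, ℂ)) :
    conv K (∑ i ∈ s, g i) = ∑ i ∈ s, conv K (g i) := by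
  simp only [conv_comm K, conv_sum_left]

theorem conv_smul_left (c : ℝ) (K g : 𝓢(E d, ℂ)) : conv (c • K) g = c • conv K g :=
  fourier_injective fun ξ => by
    simp only [DyadicPartition.fourier_real_smul, fourier_conv, smul_mul_assoc]

/-! ### Frequency localization of the pieces -/

namespace DyadicPartition

variable (P : DyadicPartition d)

/-- The kernel of a projector that is the identity on the `n`-th dyadic annulus. -/
noncomputable def wide (n : ℤ) : 𝓢(E d, ℂ) := ∑ i ∈ Finset.Icc (-1 : ℤ) 1, P.ker Sym.one (n + i)

theorem conv_ker_wide (h : Sym d) (n : ℤ) : conv (P.ker h n) (P.wide n) = P.ker h n := by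
  rw [wide, conv_sum_right, ← P.ker_eq_sum_conv]

theorem conv_ker_low_eq_zero (h : Sym d) {n : ℤ} (hn : 1 ≤ n) :
    conv (P.ker h n) (P.blockKer 0) = 0 := by
  refine fourier_injective fun ξ => ?_
  rw [fourier_conv, fourier_ker, fourier_blockKer, symbol]
  have h0 : 𝓕 (0 : 𝓢(E d, ℂ)) ξ = 0 := by
    rw [show 𝓕 (0 : 𝓢(E d, ℂ)) = 0 from FourierTransform.fourier_zero]
    rfl
  rw [h0]
  by_cases hz : P.φ ((2 : ℝ) ^ (-n) • ξ) = 0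
  · simp only [hz, Complex.ofReal_zero, zero_mul]
  · have hχ : P.χ ξ = 0 := by
      by_contra hχ
      obtain ⟨m, rfl⟩ : ∃ m : ℕ, n = m := ⟨n.toNat, by omega⟩
      exact Set.disjoint_left.1 (P.χ_disjoint m (by omega)) (subset_tsupport _ hχ)
        (subset_tsupport (fun ξ : E d => P.φ ((2 : ℝ) ^ (-(m : ℤ)) • ξ)) hz)
    beta_reduce
    rw [hχ, Complex.ofReal_zero, mul_zero]

/-- One derivative of the test function buys 2^(-n) at high frequency. This pays for summing pieces
whose bounds are controlled only in ℓ^r. -/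
theorem exists_eLpNorm_conv_wide_le {p : ℝ≥0∞} (hp : 1 ≤ p) : ∃ C : ℝ≥0,
    ∀ (n : ℤ) (g : 𝓢(E d, ℂ)), eLpNorm (conv (P.wide n) g) p volume ≤
      C * ENNReal.ofReal ((2 : ℝ) ^ (-max 0 (n : ℝ))) *
        (eLpNorm g p volume + ∑ j, eLpNorm (pd j g) p volume) := by
  let a : Sym d → ℝ≥0 := fun k => (∫⁻ z, ‖P.ker k 0 z‖ₑ).toNNReal
  have ha : ∀ k n, ∫⁻ z, ‖P.ker k n z‖ₑ = (a k : ℝ≥0∞) := fun k n => by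
    rw [ENNReal.coe_toNNReal (P.ker k 0).integrable.2.ne, P.lintegral_ker]
  -- Three kernels make up `wide`; in the high-frequency case each also loses 2, from 2^(-(n+i)) ≤ 2
  -- · 2^(-n).
  refine ⟨3 * a Sym.one + 6 * ∑ j, a (Sym.one.divX j), fun n g => ?_⟩
  have hsum : eLpNorm (conv (P.wide n) g) p volume ≤
      ∑ i ∈ Finset.Icc (-1 : ℤ) 1, eLpNorm (conv (P.ker Sym.one (n + i)) g) p volume := by
    rw [wide, conv_sum_left]
    have : ((∑ i ∈ Finset.Icc (-1 : ℤ) 1, conv (P.ker Sym.one (n + i)) g : 𝓢(E d, ℂ)) : E d → ℂ)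
        = ∑ i ∈ Finset.Icc (-1 : ℤ) 1, (conv (P.ker Sym.one (n + i)) g : E d → ℂ) := by
      ext x
      simp [sum_apply, Finset.sum_apply]
    rw [this]
    exact eLpNorm_sum_le (fun i _ => (conv _ g).continuous.aestronglyMeasurable) hp
  refine hsum.trans ?_
  have hcard : (Finset.Icc (-1 : ℤ) 1).card = 3 := by simp
  rcases le_total n 0 with hn | hn
  · rw [max_eq_left (by exact_mod_cast hn), neg_zero, Real.rpow_zero, ENNReal.ofReal_one, mul_one]
    calc _ ≤ ∑ i ∈ Finset.Icc (-1 : ℤ) 1, a Sym.one * eLpNorm g p volume :=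
          Finset.sum_le_sum fun i _ => by
            rw [← ha Sym.one (n + i)]
            exact eLpNorm_conv_le _ _ hp
      _ = (3 * a Sym.one) * eLpNorm g p volume := by
          rw [Finset.sum_const, hcard, nsmul_eq_mul]; push_cast; ring
      _ ≤ _ := by
          push_cast
          gcongr
          · exact le_self_add
          · exact le_self_add
  · rw [max_eq_right (by exact_mod_cast hn)]
    set N := eLpNorm g p volume + ∑ j, eLpNorm (pd j g) p volume
    calc _ ≤ ∑ i ∈ Finset.Icc (-1 : ℤ) 1, 2 * ENNReal.ofReal ((2 : ℝ) ^ (-(n : ℝ))) *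
          ((∑ j, (a (Sym.one.divX j) : ℝ≥0∞)) * N) := Finset.sum_le_sum fun i hi => by
            rw [Finset.mem_Icc] at hi
            have e : (conv (P.ker Sym.one (n + i)) g : E d → ℂ) = ((2 : ℝ) ^ (-(n + i))) •
                ∑ j, (conv (P.ker (Sym.one.divX j) (n + i)) (pd j g) : E d → ℂ) := by
              rw [P.ker_eq_sum_pd, conv_smul_left, conv_sum_left]
              ext x
              simp [sum_apply, Finset.sum_apply, ← pd_conv_left, pd_conv_right]
            rw [e, eLpNorm_const_smul]
            refine mul_le_mul' ?_ ?_
            · rw [Real.enorm_of_nonneg (by positivity), show (2 : ℝ≥0∞) = ENNReal.ofReal 2 by simp,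
                ← ENNReal.ofReal_mul (by positivity), ← Real.rpow_intCast]
              refine ENNReal.ofReal_le_ofReal ?_
              have : (2 : ℝ) * 2 ^ (-(n : ℝ)) = 2 ^ (1 + -(n : ℝ)) := by
                rw [Real.rpow_add two_pos, Real.rpow_one]
              rw [this]
              refine Real.rpow_le_rpow_of_exponent_le one_le_two ?_
              have : (-1 : ℝ) ≤ i := by exact_mod_cast hi.1
              push_cast
              linarith
            · refine (eLpNorm_sum_le
                (fun j _ => (conv _ (pd j g)).continuous.aestronglyMeasurable) hp).trans ?_
              rw [Finset.sum_mul]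
              refine Finset.sum_le_sum fun j _ => (eLpNorm_conv_le _ _ hp).trans ?_
              rw [ha]
              gcongr
              refine le_trans ?_ le_add_self
              exact Finset.single_le_sum (f := fun j => eLpNorm (pd j g) p volume)
                (fun _ _ => zero_le) (Finset.mem_univ j)
      _ = (6 * ∑ j, (a (Sym.one.divX j) : ℝ≥0∞)) * ENNReal.ofReal ((2 : ℝ) ^ (-(n : ℝ))) * N := by
          rw [Finset.sum_const, hcard, nsmul_eq_mul]; push_cast; ring
      _ ≤ _ := by
          push_cast
          gcongr
          exact le_add_self

theorem pd_zero (i : Fin d) : pd i (0 : 𝓢(E d, ℂ)) = 0 := by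
  refine SchwartzMap.ext fun x => ?_
  rw [pd_apply]
  have : ((0 : 𝓢(E d, ℂ)) : E d → ℂ) = fun _ => 0 := rfl
  rw [this]
  simp

theorem corr_zero_left (f : E d → ℂ) : corr (0 : 𝓢(E d, ℂ)) f = 0 := by
  ext y; simp [corr]

section

variable {P} {p : ℝ≥0∞} (hp : 1 ≤ p) {v : E d → E d} {θ : E d → ℂ}
    {Θ : 𝓢'(E d, ℂ)} (H : P.Admissible v p θ Θ) (i₀ : Fin d) (n q : ℤ)

include H hp

/-- Correlating a piece with K just replaces its kernel of frequency 2^n by the convolution with K.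
Hence the piece inherits the spectral localization of that kernel in n, whatever v and q are. -/
theorem Admissible.corr_piece (K : 𝓢(E d, ℂ)) (y : E d) : corr K (P.piece i₀ v θ n q) y =
    ∑ i, corr (pd i (conv (P.ker (Sym.riesz i₀) n) K))
        (fun y => corr (P.ker Sym.one q) θ y * comp v i y) y
      - ∑ i, corr (pd i (conv (P.ker Sym.one n) K))
        (fun y => corr (P.ker (Sym.riesz i₀) q) θ y * comp v i y) y := by
  obtain ⟨A, hA, hA'⟩ := H.exists_norm_corr_ker_le hp Sym.one (Sym.riesz i₀) q
  have hθ := temperateInt_of_memLp hp H.memLp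
  have h1 := fun i => P.temperateInt_corr_mul_comp H.temp hθ hA i
  have h2 := fun i => P.temperateInt_corr_mul_comp H.temp hθ hA' i
  have i1 : ∀ i, Integrable fun x => corr (pd i (P.ker (Sym.riesz i₀) n))
      (fun y => corr (P.ker Sym.one q) θ y * comp v i y) x * K (x - y) := fun i =>
    (h1 i).integrable_corr_mul _ (SchwartzMap.compSubConstCLM ℂ y K)
  have i2 : ∀ i, Integrable fun x => corr (pd i (P.ker Sym.one n))
      (fun y => corr (P.ker (Sym.riesz i₀) q) θ y * comp v i y) x * K (x - y) := fun i =>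
    (h2 i).integrable_corr_mul _ (SchwartzMap.compSubConstCLM ℂ y K)
  simp only [pd_conv_left, ← (h1 _).corr_corr, ← (h2 _).corr_corr]
  rw [corr]
  simp only [piece, sub_mul, Finset.sum_mul]
  rw [integral_sub (integrable_finsetSum _ fun i _ => i1 i)
    (integrable_finsetSum _ fun i _ => i2 i), integral_finsetSum _ fun i _ => i1 i,
    integral_finsetSum _ fun i _ => i2 i]
  rfl

theorem Admissible.corr_wide_piece :
    corr (P.wide n) (P.piece i₀ v θ n q) = P.piece i₀ v θ n q := by
  ext y
  rw [H.corr_piece hp, piece]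
  simp only [conv_ker_wide]

theorem Admissible.corr_ker_piece_eq_zero {N : ℤ} (hN : 2 ≤ |n - N|) :
    corr (P.ker Sym.one N) (P.piece i₀ v θ n q) = 0 := by
  ext y
  rw [H.corr_piece hp]
  simp only [P.conv_ker_ker_eq_zero _ _ hN, pd_zero, corr_zero_left]
  simp

theorem Admissible.corr_low_piece_eq_zero (hn : 1 ≤ n) :
    corr (P.blockKer 0) (P.piece i₀ v θ n q) = 0 := by
  ext y
  rw [H.corr_piece hp]
  simp only [P.conv_ker_low_eq_zero _ hn, pd_zero, corr_zero_left]
  simp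

end

end DyadicPartition

/-! ### Dyadic weights and sequence norms -/

/-- The weight `2^t`. -/
noncomputable def two (t : ℝ) : ℝ≥0∞ := ENNReal.ofReal ((2 : ℝ) ^ t)

theorem two_ne_top (t : ℝ) : two t ≠ ⊤ := ENNReal.ofReal_ne_top

theorem two_add (s t : ℝ) : two (s + t) = two s * two t := by
  rw [two, Real.rpow_add two_pos, ENNReal.ofReal_mul (by positivity)]; rfl

theorem two_mono {s t : ℝ} (h : s ≤ t) : two s ≤ two t :=
  ENNReal.ofReal_le_ofReal (Real.rpow_le_rpow_of_exponent_le one_le_two h)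

theorem two_zero : two 0 = 1 := by simp [two]

theorem tsum_two_neg_abs_ne_top {c : ℝ} (hc : 0 < c) : ∑' n : ℤ, two (-(c * |(n : ℝ)|)) ≠ ⊤ := by
  have h := (summable_two_rpow_neg_abs hc).tsum_ofReal_ne_top
  simpa only [two, neg_mul] using h

theorem tsum_two_neg_abs_sub (c : ℝ) (q : ℤ) :
    ∑' n : ℤ, two (-(c * |(n : ℝ) - q|)) = ∑' n : ℤ, two (-(c * |(n : ℝ)|)) := by
  rw [← (Equiv.subRight q).tsum_eq fun n : ℤ => two (-(c * |(n : ℝ)|))]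
  simp

/-- Viewing ℓ^r as L^r of the counting measure makes the triangle and Minkowski inequalities
available. -/
theorem seqNorm_eq_eLpNorm {r : ℝ≥0∞} (hr : 1 ≤ r) (a : ℕ → ℝ≥0∞) :
    seqNorm r a = eLpNorm a r Measure.count := by
  rw [seqNorm]
  split_ifs with h
  · rw [h, eLpNorm_exponent_top, eLpNormEssSup]
    simp only [enorm_eq_self]
    refine le_antisymm (iSup_le fun n => ?_) (essSup_le_of_ae_le _
      (Filter.Eventually.of_forall fun n => le_iSup a n))
    have h1 := ENNReal.ae_le_essSup (μ := Measure.count) a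
    rw [Measure.ae_count_iff] at h1
    exact h1 n
  · rw [eLpNorm_eq_lintegral_rpow_enorm_toReal (by rintro rfl; simp at hr) h]
    simp only [enorm_eq_self, lintegral_count]

theorem seqNorm_mono {r : ℝ≥0∞} (hr : 1 ≤ r) {a b : ℕ → ℝ≥0∞} (h : ∀ n, a n ≤ b n) :
    seqNorm r a ≤ seqNorm r b := by
  rw [seqNorm_eq_eLpNorm hr, seqNorm_eq_eLpNorm hr]
  exact eLpNorm_mono_enorm h

theorem seqNorm_add_le {r : ℝ≥0∞} (hr : 1 ≤ r) (a b : ℕ → ℝ≥0∞) :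
    seqNorm r (fun n => a n + b n) ≤ seqNorm r a + seqNorm r b := by
  simp only [seqNorm_eq_eLpNorm hr]
  exact eLpNorm_add_le (Measurable.of_discrete.aestronglyMeasurable)
    (Measurable.of_discrete.aestronglyMeasurable) hr

theorem seqNorm_sum_le {r : ℝ≥0∞} (hr : 1 ≤ r) {ι : Type*} (s : Finset ι) (a : ι → ℕ → ℝ≥0∞) :
    seqNorm r (fun n => ∑ i ∈ s, a i n) ≤ ∑ i ∈ s, seqNorm r (a i) := by
  simp only [seqNorm_eq_eLpNorm hr]
  have : (fun n => ∑ i ∈ s, a i n) = ∑ i ∈ s, a i := by ext; simp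
  rw [this]
  exact eLpNorm_sum_le (fun i _ => Measurable.of_discrete.aestronglyMeasurable) hr

theorem seqNorm_const_mul_le {r : ℝ≥0∞} (hr : 1 ≤ r) {c : ℝ≥0∞} (hc : c ≠ ⊤) (a : ℕ → ℝ≥0∞) :
    seqNorm r (fun n => c * a n) ≤ c * seqNorm r a := by
  simp only [seqNorm_eq_eLpNorm hr]
  exact eLpNorm_ennreal_const_mul_le hc a r

theorem seqNorm_single_zero_le {r : ℝ≥0∞} (hr : 1 ≤ r) (c : ℝ≥0∞) :
    seqNorm r (fun n => if n = 0 then c else 0) ≤ c := by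
  rw [seqNorm]
  split_ifs with h
  · refine iSup_le fun n => ?_
    split_ifs <;> simp
  · have h0 : 0 < r.toReal := ENNReal.toReal_pos (by rintro rfl; simp at hr) h
    rw [tsum_eq_single 0 fun n hn => by simp [hn, h0], if_pos rfl, ← ENNReal.rpow_mul,
      mul_one_div_cancel h0.ne', ENNReal.rpow_one]

theorem le_seqNorm {r : ℝ≥0∞} (hr : 1 ≤ r) (a : ℕ → ℝ≥0∞) (n : ℕ) : a n ≤ seqNorm r a := by
  rw [seqNorm]
  split_ifs with h
  · exact le_iSup a n
  · have h0 : 0 < r.toReal := ENNReal.toReal_pos (by rintro rfl; simp at hr) h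
    calc a n = (a n ^ r.toReal) ^ (1 / r.toReal) := by
          rw [← ENNReal.rpow_mul, mul_one_div_cancel h0.ne', ENNReal.rpow_one]
      _ ≤ _ := by
          gcongr
          exact ENNReal.le_tsum (f := fun n => a n ^ r.toReal) n

/-- A sequence shifted by an integer, extended by zero. -/
noncomputable def shift (a : ℕ → ℝ≥0∞) (i : ℤ) (m : ℕ) : ℝ≥0∞ :=
  if 0 ≤ (m : ℤ) - i then a ((m : ℤ) - i).toNat else 0

theorem seqNorm_shift_le {r : ℝ≥0∞} (hr : 1 ≤ r) (a : ℕ → ℝ≥0∞) (i : ℤ) :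
    seqNorm r (shift a i) ≤ seqNorm r a := by
  by_cases h : r = ⊤
  · simp only [seqNorm, if_pos h]
    refine iSup_le fun n => ?_
    rw [shift]
    split_ifs
    · exact le_iSup a _
    · simp
  · have h0 : 0 < r.toReal := ENNReal.toReal_pos (by rintro rfl; simp at hr) h
    simp only [seqNorm, if_neg h]
    gcongr ?_ ^ _
    let b : ℤ → ℝ≥0∞ := fun k => if 0 ≤ k then a k.toNat ^ r.toReal else 0
    have h1 : ∀ m : ℕ, shift a i m ^ r.toReal = b (m - i) := fun m => by
      simp only [shift, b]
      split_ifs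
      · rfl
      · rw [ENNReal.zero_rpow_of_pos h0]
    have h2 : Function.Injective fun m : ℕ => (m : ℤ) - i := fun a b hab => by simpa using hab
    have h3 : ∑' k, b k = ∑' n : ℕ, b n := by
      refine (Function.Injective.tsum_eq (g := fun n : ℕ => (n : ℤ)) Nat.cast_injective ?_).symm
      intro k hk
      by_contra hn
      refine hk ?_
      have : ¬ 0 ≤ k := fun hk' => hn ⟨k.toNat, Int.toNat_of_nonneg hk'⟩
      simp only [b, if_neg this]
    calc _ = ∑' m : ℕ, b (m - i) := tsum_congr h1
      _ ≤ ∑' k, b k := ENNReal.tsum_comp_le_tsum_of_injective h2 b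
      _ = _ := by
          rw [h3]
          exact tsum_congr fun n => by simp [b]

/-- Young's inequality in `ℓ^r`, for a dyadic weight. -/
theorem seqNorm_tsum_two_mul_le {r : ℝ≥0∞} (hr : 1 ≤ r) {c : ℝ} (hc : 0 < c) (a : ℕ → ℝ≥0∞) :
    seqNorm r (fun m => ∑' j : ℕ, two (-(c * |(m : ℝ) - j|)) * a j) ≤
      (∑' n : ℤ, two (-(c * |(n : ℝ)|))) * seqNorm r a := by
  -- The weight becomes a finite measure on the shifts, so that Young's inequality is Minkowski's
  -- inequality over shifted copies of a.
  let ν : Measure ℤ := Measure.count.withDensity fun i => two (-(c * |(i : ℝ)|))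
  have hν : ν Set.univ = ∑' n : ℤ, two (-(c * |(n : ℝ)|)) := by
    simp [ν, lintegral_count]
  have : IsFiniteMeasure ν := ⟨by rw [hν]; exact (tsum_two_neg_abs_ne_top hc).lt_top⟩
  have h := eLpNorm_lintegral_le (μ := (Measure.count : Measure ℕ)) (ν := ν) hr
    (F := fun m i => shift a i m) (Measurable.of_discrete) (A := seqNorm r a) fun i => by
      rw [← seqNorm_eq_eLpNorm hr]
      exact seqNorm_shift_le hr a i
  rw [hν, ← seqNorm_eq_eLpNorm hr] at h
  refine (seqNorm_mono hr fun m => ?_).trans h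
  have e : ∫⁻ i, shift a i m ∂ν = ∑' i : ℤ, two (-(c * |(i : ℝ)|)) * shift a i m := by
    rw [lintegral_withDensity_eq_lintegral_mul _ Measurable.of_discrete Measurable.of_discrete,
      lintegral_count]
    rfl
  rw [e]
  have h2 : Function.Injective fun j : ℕ => (m : ℤ) - j := fun a b hab => by simpa using hab
  refine le_trans (le_of_eq (tsum_congr fun j => ?_))
    (ENNReal.tsum_comp_le_tsum_of_injective h2 fun i => two (-(c * |(i : ℝ)|)) * shift a i m)
  simp [shift]

/-- The sequence obtained from a sequence on `ℤ` by summing all the nonpositive indices. -/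
noncomputable def fold (δ : ℤ → ℝ≥0∞) (j : ℕ) : ℝ≥0∞ := ∑' q : ℤ, if q.toNat = j then δ q else 0

theorem tsum_mul_eq_tsum_fold (G : ℕ → ℝ≥0∞) (δ : ℤ → ℝ≥0∞) :
    ∑' q : ℤ, G q.toNat * δ q = ∑' j, G j * fold δ j := by
  simp only [fold, ← ENNReal.tsum_mul_left]
  rw [ENNReal.tsum_comm]
  refine tsum_congr fun q => ?_
  rw [tsum_eq_single q.toNat fun j hj => by rw [if_neg hj.symm, mul_zero], if_pos rfl]

theorem fold_of_pos (δ : ℤ → ℝ≥0∞) {j : ℕ} (hj : j ≠ 0) : fold δ j = δ j := by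
  rw [fold, tsum_eq_single (j : ℤ) fun q hq => if_neg (by omega), if_pos (by simp)]

/-! ### Summation of the dyadic pieces of the commutator -/

theorem continuous_pd (i : Fin d) : Continuous (pd i) :=
  LineDeriv.continuous_lineDerivOp (E := 𝓢(E d, ℂ)) (EuclideanSpace.single i (1 : ℝ))

theorem hasSum_of_tsum_enorm_ne_top {ι : Type*} {f : ι → ℂ} (h : ∑' k, ‖f k‖ₑ ≠ ⊤) :
    Summable f := by
  have h1 := ENNReal.summable_toReal h
  exact Summable.of_norm (by simpa using h1)

/-- A family of tempered distributions that is absolutely summable, with a uniform bound in terms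
of finitely many Lebesgue norms, is summable. -/
theorem exists_hasSum_distribution {ι : Type*} (t : ι → 𝓢(E d, ℂ) →ₗ[ℂ] ℂ) {p : ℝ≥0∞} (hp : 1 ≤ p)
    {B : ℝ≥0∞} (hB : B ≠ ⊤) (h : ∀ g : 𝓢(E d, ℂ), ∑' k, ‖t k g‖ₑ ≤
      B * (eLpNorm g p volume + ∑ j, eLpNorm (pd j g) p volume)) :
    ∃ T : 𝓢'(E d, ℂ), ∀ g : 𝓢(E d, ℂ), HasSum (fun k => t k g) (T g) := by
  have : Fact (1 ≤ p) := ⟨hp⟩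
  have hfin : ∀ g : 𝓢(E d, ℂ), B * (eLpNorm g p volume + ∑ j, eLpNorm (pd j g) p volume) ≠ ⊤ :=
    fun g => ENNReal.mul_ne_top hB (ENNReal.add_ne_top.2 ⟨(g.memLp p volume).2.ne,
      ENNReal.sum_ne_top.2 fun j _ => ((pd j g).memLp p volume).2.ne⟩)
  have hs : ∀ g : 𝓢(E d, ℂ), Summable fun k => t k g := fun g =>
    hasSum_of_tsum_enorm_ne_top (ne_top_of_le_ne_top (hfin g) (h g))
  let L : 𝓢(E d, ℂ) →ₗ[ℂ] ℂ :=
    { toFun := fun g => ∑' k, t k g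
      map_add' := fun f g => by
        simp only [map_add]
        exact (hs f).tsum_add (hs g)
      map_smul' := fun c g => by
        simp only [map_smul, RingHom.id_apply]
        exact (hs g).tsum_const_smul c }
  have hb : ∀ g, ‖L g‖ ≤ B.toReal * (‖SchwartzMap.toLpCLM ℂ ℂ p volume g‖ +
      ∑ j, ‖SchwartzMap.toLpCLM ℂ ℂ p volume (pd j g)‖) := fun g => by
    have h1 : ‖L g‖ₑ ≤ _ := enorm_tsum_le_tsum_enorm.trans (h g)
    have h2 := ENNReal.toReal_mono (hfin g) h1
    rw [toReal_enorm, ENNReal.toReal_mul, ENNReal.toReal_add (g.memLp p volume).2.ne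
      (ENNReal.sum_ne_top.2 fun j _ => ((pd j g).memLp p volume).2.ne),
      ENNReal.toReal_sum fun j _ => ((pd j g).memLp p volume).2.ne] at h2
    simpa only [SchwartzMap.toLpCLM_apply, SchwartzMap.norm_toLp] using h2
  have hc : Continuous L := by
    refine continuous_of_continuousAt_zero L ?_
    rw [ContinuousAt, map_zero]
    refine squeeze_zero_norm hb ?_
    have : Continuous fun g : 𝓢(E d, ℂ) => B.toReal * (‖SchwartzMap.toLpCLM ℂ ℂ p volume g‖ +
      ∑ j, ‖SchwartzMap.toLpCLM ℂ ℂ p volume (pd j g)‖) :=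
      continuous_const.mul ((SchwartzMap.toLpCLM ℂ ℂ p volume).continuous.norm.add
        (continuous_finsetSum _ fun j _ =>
          ((SchwartzMap.toLpCLM ℂ ℂ p volume).continuous.comp (continuous_pd j)).norm))
    have h0 := this.tendsto 0
    simpa only [DyadicPartition.pd_zero, map_zero, norm_zero, Finset.sum_const_zero, add_zero,
      mul_zero] using h0
  exact ⟨ContinuousLinearMap.toPointwiseConvergenceCLM _ _ _ _ ⟨L, hc⟩, fun g => (hs g).hasSum⟩

/-- Integration of Schwartz functions against a function that is integrable in the mean. -/
noncomputable def TemperateInt.integralLM {f : E d → ℂ} (hf : TemperateInt f) :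
    𝓢(E d, ℂ) →ₗ[ℂ] ℂ where
  toFun g := ∫ x, f x * g x
  map_add' g h := by
    simp only [add_apply, mul_add]
    exact integral_add (hf.integrable_mul g) (hf.integrable_mul h)
  map_smul' c g := by
    rw [RingHom.id_apply, ← integral_smul]
    refine integral_congr_ae (Filter.Eventually.of_forall fun x => ?_)
    simp only [smul_apply, smul_eq_mul]; ring

namespace DyadicPartition

variable {P : DyadicPartition d} {p' : ℝ≥0∞} {v : E d → E d} {θ : E d → ℂ}
    {Θ : 𝓢'(E d, ℂ)} {p A : ℝ≥0∞} {δ : ℤ → ℝ≥0∞} {μ : ℝ} {i₀ : Fin d}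

theorem Admissible.memLp_piece (H : P.Admissible v p' θ Θ) (hp' : 1 ≤ p') (hA : A ≠ ⊤)
    (hδ : ∀ q, δ q ≠ ⊤)
    (hb : ∀ n q, eLpNorm (P.piece i₀ v θ n q) p volume ≤ A * two (-(μ * |(n : ℝ) - q|)) * δ q)
    (n q : ℤ) : MemLp (P.piece i₀ v θ n q) p volume :=
  ⟨(H.continuous_piece hp' i₀ n q).aestronglyMeasurable, (hb n q).trans_lt
    (ENNReal.mul_lt_top (ENNReal.mul_lt_top hA.lt_top (two_ne_top _).lt_top) (hδ q).lt_top)⟩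

/-- Each piece is reproduced by its wide projector, which is transposed onto g. The resulting factor
2^(-max(0, n)), combined with the decay in |n − q|, makes the double series absolutely convergent
even when δ does not decay. -/
theorem Admissible.exists_hasSum_piece (H : P.Admissible v p' θ Θ) (hp' : 1 ≤ p') (hp : 1 ≤ p)
    (hA : A ≠ ⊤) (hδ : ∀ q, δ q ≠ ⊤) (hμ : 0 < μ) (hμ1 : μ ≤ 1)
    (hb : ∀ n q, eLpNorm (P.piece i₀ v θ n q) p volume ≤ A * two (-(μ * |(n : ℝ) - q|)) * δ q)
    (hs : ∑' q : ℤ, two (-(μ / 2 * q.toNat)) * δ q ≠ ⊤) :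
    ∃ T : 𝓢'(E d, ℂ), ∀ g : 𝓢(E d, ℂ),
      HasSum (fun k : ℤ × ℤ => ∫ x, P.piece i₀ v θ k.1 k.2 x * g x) (T g) := by
  have hpp := ENNReal.HolderConjugate.inv_one_sub_inv' hp
  have hm := fun n q => H.memLp_piece hp' hA hδ hb n q
  have ht := fun n q => temperateInt_of_memLp hp (hm n q)
  set p₁ := (1 - p⁻¹)⁻¹
  have hp₁ : 1 ≤ p₁ := ENNReal.HolderConjugate.one_le p₁ p
  obtain ⟨C, hC⟩ := P.exists_eLpNorm_conv_wide_le hp₁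
  refine exists_hasSum_distribution (fun k : ℤ × ℤ => (ht k.1 k.2).integralLM) hp₁
    (B := A * C * ((∑' n : ℤ, two (-(μ / 2 * |(n : ℝ)|))) *
      ∑' q : ℤ, two (-(μ / 2 * q.toNat)) * δ q)) ?_ fun g => ?_
  · exact ENNReal.mul_ne_top (ENNReal.mul_ne_top hA ENNReal.coe_ne_top) (ENNReal.mul_ne_top
      (tsum_two_neg_abs_ne_top (by linarith)) hs)
  set N := eLpNorm g p₁ volume + ∑ j, eLpNorm (pd j g) p₁ volume
  have hk : ∀ k : ℤ × ℤ, ‖(ht k.1 k.2).integralLM g‖ₑ ≤ A * C * N *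
      (two (-(μ / 2 * |(k.1 : ℝ) - k.2|)) * (two (-(μ / 2 * k.2.toNat)) * δ k.2)) := fun k => by
    obtain ⟨n, q⟩ := k
    change ‖∫ x, P.piece i₀ v θ n q x * g x‖ₑ ≤ _
    rw [← H.corr_wide_piece hp', (ht n q).integral_corr_mul]
    refine (enorm_integral_mul_le (p := p) (p' := p₁) (hm n q).1
      (conv _ g).continuous.aestronglyMeasurable).trans ?_
    calc _ ≤ (A * two (-(μ * |(n : ℝ) - q|)) * δ q) * (C * two (-max 0 (n : ℝ)) * N) :=
          mul_le_mul' (hb n q) (hC n g)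
      _ = A * C * N * ((two (-(μ * |(n : ℝ) - q|)) * two (-max 0 (n : ℝ))) * δ q) := by ring
      _ ≤ A * C * N * ((two (-(μ / 2 * |(n : ℝ) - q|)) * two (-(μ / 2 * q.toNat))) * δ q) := by
          -- Half of the decay in |n − q| is kept for the sum over n. The other half and the factor
          -- in n yield decay in max(0, q), because max(0, q) ≤ |n − q| + max(0, n); here μ ≤ 1 is
          -- used.
          gcongr A * C * N * (?_ * δ q)
          rw [← two_add, ← two_add]
          refine two_mono ?_
          have h1 : (q.toNat : ℝ) = max 0 (q : ℝ) := by
            rcases le_total 0 q with h | h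
            · rw [max_eq_right (by exact_mod_cast h)]
              exact_mod_cast Int.toNat_of_nonneg h
            · rw [max_eq_left (by exact_mod_cast h), Int.toNat_of_nonpos h]; simp
          rw [h1]
          have h2 : max 0 (q : ℝ) ≤ |(n : ℝ) - q| + max 0 (n : ℝ) := by
            refine max_le (by positivity) ?_
            have := neg_abs_le ((n : ℝ) - q)
            have := le_max_right 0 (n : ℝ)
            linarith
          have h3 := le_max_left 0 (n : ℝ)
          nlinarith
      _ = _ := by ring
  calc _ ≤ ∑' k : ℤ × ℤ, A * C * N *
      (two (-(μ / 2 * |(k.1 : ℝ) - k.2|)) * (two (-(μ / 2 * k.2.toNat)) * δ k.2)) :=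
        ENNReal.tsum_le_tsum hk
    _ = A * C * N * ∑' q : ℤ, ∑' n : ℤ, two (-(μ / 2 * |(n : ℝ) - q|)) *
        (two (-(μ / 2 * q.toNat)) * δ q) := by
        rw [ENNReal.tsum_mul_left, ENNReal.tsum_prod', ENNReal.tsum_comm]
    _ = _ := by
        simp only [ENNReal.tsum_mul_right, tsum_two_neg_abs_sub, ENNReal.tsum_mul_left]
        ring

/-- Spectral localization leaves only |n − N| ≤ 1 in the block numbered N + 1, and n ≤ 0 in the
low-frequency block. The decay in |n − q| then becomes decay in the distance from the block index to
max(0, q). -/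
theorem exists_distLpNorm_block_le (P : DyadicPartition d) (hμ : 0 < μ) (hp : 1 ≤ p) :
    ∃ C : ℝ≥0, ∀ (p' : ℝ≥0∞) (v : E d → E d) (θ : E d → ℂ) (Θ T : 𝓢'(E d, ℂ)) (A : ℝ≥0∞)
      (δ : ℤ → ℝ≥0∞) (i₀ : Fin d), P.Admissible v p' θ Θ → 1 ≤ p' → A ≠ ⊤ → (∀ q, δ q ≠ ⊤) →
      (∀ n q, eLpNorm (P.piece i₀ v θ n q) p volume ≤ A * two (-(μ * |(n : ℝ) - q|)) * δ q) →
      (∀ g : 𝓢(E d, ℂ), HasSum (fun k : ℤ × ℤ => ∫ x, P.piece i₀ v θ k.1 k.2 x * g x) (T g)) →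
      (∀ m : ℕ, ∑' q : ℤ, two (-(μ / 2 * |(m : ℝ) - q.toNat|)) * δ q ≠ ⊤) →
      ∀ m, distLpNorm p (P.block m T) ≤
        C * A * ∑' q : ℤ, two (-(μ / 2 * |(m : ℝ) - q.toNat|)) * δ q := by
  let a : ℝ≥0∞ := ∫⁻ z, ‖P.blockKer 0 z‖ₑ
  let b : ℝ≥0∞ := ∫⁻ z, ‖P.ker Sym.one 0 z‖ₑ
  have ha : a ≠ ⊤ := (P.blockKer 0).integrable.2.ne
  have hbt : b ≠ ⊤ := (P.ker Sym.one 0).integrable.2.ne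
  let w : ℝ → ℝ≥0∞ := fun c => ∑' n : ℤ, two (-(c * |(n : ℝ)|))
  have hw : ∀ {c}, 0 < c → w c ≠ ⊤ := fun h => tsum_two_neg_abs_ne_top h
  have hC : (a + b) * two (2 * μ + 1) * (w (μ / 2) + w 1) ≠ ⊤ :=
    ENNReal.mul_ne_top (ENNReal.mul_ne_top (ENNReal.add_ne_top.2 ⟨ha, hbt⟩) (two_ne_top _))
      (ENNReal.add_ne_top.2 ⟨hw (by linarith), hw one_pos⟩)
  refine ⟨((a + b) * two (2 * μ + 1) * (w (μ / 2) + w 1)).toNNReal,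
    fun p' v θ Θ T A δ i₀ H hp' hA hδ hb hT hs m => ?_⟩
  rw [ENNReal.coe_toNNReal hC]
  have hm := fun n q => H.memLp_piece hp' hA hδ hb n q
  have ht := fun n q => temperateInt_of_memLp hp (hm n q)
  have hsum : ∀ g : 𝓢(E d, ℂ), HasSum (fun k : ℤ × ℤ =>
      ∫ x, corr (P.blockKer m) (P.piece i₀ v θ k.1 k.2) x * g x) (P.block m T g) := fun g => by
    rw [block_apply]
    refine (hT _).congr_fun fun k => ?_
    rw [(ht _ _).integral_corr_mul]
  have hcb : ∀ n q, eLpNorm (corr (P.blockKer m) (P.piece i₀ v θ n q)) p volume ≤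
      (∫⁻ z, ‖P.blockKer m z‖ₑ) * (A * two (-(μ * |(n : ℝ) - q|)) * δ q) := fun n q =>
    (eLpNorm_corr_le (H.continuous_piece hp' i₀ n q).measurable _ hp).trans
      (mul_le_mul_right (hb n q) _)
  have hpos : ∀ q : ℤ, (q.toNat : ℝ) = max 0 (q : ℝ) := fun q => by
    rcases le_total 0 q with h | h
    · rw [max_eq_right (by exact_mod_cast h)]
      exact_mod_cast Int.toNat_of_nonneg h
    · rw [max_eq_left (by exact_mod_cast h), Int.toNat_of_nonpos h]; simp
  set K : ℝ≥0∞ := (a + b) * two (2 * μ + 1) * (w (μ / 2) + w 1)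
  have hle : ∀ q : ℤ, ∑' n : ℤ, eLpNorm (corr (P.blockKer m) (P.piece i₀ v θ n q)) p volume ≤
      K * A * (two (-(μ / 2 * |(m : ℝ) - q.toNat|)) * δ q) := fun q => by
    cases m with
    | zero =>
      have h1 : ∀ n : ℤ, eLpNorm (corr (P.blockKer 0) (P.piece i₀ v θ n q)) p volume ≤
          two (-(μ / 2 * |(n : ℝ) - q|)) *
            (a * A * (two (-(μ / 2 * |((0 : ℕ) : ℝ) - q.toNat|)) * δ q)) := fun n => by
        rcases le_or_gt 1 n with hn | hn
        · rw [H.corr_low_piece_eq_zero hp' i₀ n q hn, eLpNorm_zero]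
          exact zero_le
        · refine (hcb n q).trans ?_
          calc _ ≤ a * (A * (two (-(μ / 2 * |(n : ℝ) - q|)) *
                two (-(μ / 2 * |((0 : ℕ) : ℝ) - q.toNat|))) * δ q) := by
                -- Here n ≤ 0, so max(0, q) ≤ |n − q|: half of the decay sums over n and the other
                -- half is the weight in q.
                gcongr a * (A * ?_ * δ q)
                rw [← two_add]
                refine two_mono ?_
                rw [hpos, Nat.cast_zero, zero_sub, abs_neg, abs_of_nonneg (le_max_left (0 : ℝ) (q : ℝ))]
                have hn' : (n : ℝ) ≤ 0 := by exact_mod_cast (by omega : n ≤ 0)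
                have h2 : max 0 (q : ℝ) ≤ |(n : ℝ) - q| := by
                  refine max_le (abs_nonneg _) ?_
                  have := neg_abs_le ((n : ℝ) - q)
                  linarith
                nlinarith
            _ = _ := by ring
      refine (ENNReal.tsum_le_tsum h1).trans ?_
      rw [ENNReal.tsum_mul_right, tsum_two_neg_abs_sub]
      calc w (μ / 2) * (a * A * (two (-(μ / 2 * |((0 : ℕ) : ℝ) - q.toNat|)) * δ q))
          = a * 1 * w (μ / 2) * A * (two (-(μ / 2 * |((0 : ℕ) : ℝ) - q.toNat|)) * δ q) := by ring
        _ ≤ _ := by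
          refine mul_le_mul' (mul_le_mul' (mul_le_mul' (mul_le_mul' le_self_add ?_) le_self_add)
            le_rfl) le_rfl
          rw [← two_zero]
          exact two_mono (by linarith)
    | succ N =>
      have h1 : ∀ n : ℤ, eLpNorm (corr (P.blockKer (N + 1)) (P.piece i₀ v θ n q)) p volume ≤
          two (-(1 * |(n : ℝ) - (N : ℤ)|)) *
            (b * two (2 * μ + 1) * A * (two (-(μ / 2 * |((N + 1 : ℕ) : ℝ) - q.toNat|)) * δ q)) :=
          fun n => by
        rcases le_or_gt 2 |n - (N : ℤ)| with hn | hn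
        · rw [show P.blockKer (N + 1) = P.ker Sym.one N from rfl,
            H.corr_ker_piece_eq_zero hp' i₀ n q hn, eLpNorm_zero]
          exact zero_le
        · refine (hcb n q).trans ?_
          have hbe : ∫⁻ z, ‖P.blockKer (N + 1) z‖ₑ = b := P.lintegral_ker Sym.one N
          rw [hbe]
          calc _ ≤ b * (A * (two (2 * μ + 1) * two (-(1 * |(n : ℝ) - (N : ℤ)|)) *
                two (-(μ / 2 * |((N + 1 : ℕ) : ℝ) - q.toNat|))) * δ q) := by
                -- The shift from N to N + 1 and the neighbours of N move the distance by at most 2,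
                -- which is absorbed in 2^(2μ). The additional factor 2 makes room for the weight
                -- 2^(-|n-N|), inserted only to sum over the three values of n.
                gcongr b * (A * ?_ * δ q)
                rw [← two_add, ← two_add]
                refine two_mono ?_
                rw [hpos]
                have hn' : |(n : ℝ) - (N : ℤ)| ≤ 1 := by exact_mod_cast (by omega : |n - (N : ℤ)| ≤ 1)
                have hn2 := abs_le.1 hn'
                have h2 : |((N + 1 : ℕ) : ℝ) - max 0 (q : ℝ)| ≤ |(n : ℝ) - q| + 2 := by
                  push_cast at hn2 ⊢
                  have e1 := neg_abs_le ((n : ℝ) - q)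
                  have e2 := le_abs_self ((n : ℝ) - q)
                  have e3 : (0 : ℝ) ≤ N := Nat.cast_nonneg N
                  rcases le_total 0 (q : ℝ) with h | h
                  · rw [max_eq_right h]
                    exact abs_le.2 ⟨by linarith, by linarith⟩
                  · rw [max_eq_left h]
                    exact abs_le.2 ⟨by linarith, by linarith⟩
                nlinarith [abs_nonneg ((n : ℝ) - q)]
            _ = _ := by ring
      refine (ENNReal.tsum_le_tsum h1).trans ?_
      rw [ENNReal.tsum_mul_right, tsum_two_neg_abs_sub]
      calc w 1 * (b * two (2 * μ + 1) * A *
            (two (-(μ / 2 * |((N + 1 : ℕ) : ℝ) - q.toNat|)) * δ q))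
          = b * two (2 * μ + 1) * w 1 * A *
            (two (-(μ / 2 * |((N + 1 : ℕ) : ℝ) - q.toNat|)) * δ q) := by ring
        _ ≤ _ := by
          exact mul_le_mul' (mul_le_mul' (mul_le_mul' (mul_le_mul' le_add_self le_rfl) le_add_self)
            le_rfl) le_rfl
  have htot : ∑' k : ℤ × ℤ, eLpNorm (corr (P.blockKer m) (P.piece i₀ v θ k.1 k.2)) p volume ≤
      K * A * ∑' q : ℤ, two (-(μ / 2 * |(m : ℝ) - q.toNat|)) * δ q := by
    rw [ENNReal.tsum_prod', ENNReal.tsum_comm, ← ENNReal.tsum_mul_left]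
    exact ENNReal.tsum_le_tsum hle
  have hfin : K * A * ∑' q : ℤ, two (-(μ / 2 * |(m : ℝ) - q.toNat|)) * δ q ≠ ⊤ :=
    ENNReal.mul_ne_top (ENNReal.mul_ne_top hC hA) (hs m)
  refine (distLpNorm_le_tsum hp (fun k : ℤ × ℤ => ⟨((ht k.1 k.2).differentiable_corr
    _).continuous.aestronglyMeasurable, ?_⟩) (ne_top_of_le_ne_top hfin htot) hsum).trans htot
  exact lt_of_le_of_lt (ENNReal.le_tsum (f := fun k : ℤ × ℤ =>
    eLpNorm (corr (P.blockKer m) (P.piece i₀ v θ k.1 k.2)) p volume) k)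
    (htot.trans_lt hfin.lt_top)

theorem two_zero_mul_eq (n : ℕ) :
    ENNReal.ofReal ((2 : ℝ) ^ (((n : ℝ) - 1) * 0)) = 1 := by simp

/-- The commutator as a tempered distribution, with its Besov norm. -/
theorem exists_besovNorm_le (P : DyadicPartition d) (hμ : 0 < μ) (hμ1 : μ ≤ 1) (hp : 1 ≤ p) :
    ∃ C : ℝ≥0, ∀ (r p' : ℝ≥0∞) (v : E d → E d) (θ : E d → ℂ) (Θ : 𝓢'(E d, ℂ)) (A : ℝ≥0∞)
      (δ : ℤ → ℝ≥0∞) (i₀ : Fin d), 1 ≤ r → P.Admissible v p' θ Θ → 1 ≤ p' → A ≠ ⊤ →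
      (∀ q, δ q ≠ ⊤) → seqNorm r (fold δ) ≠ ⊤ →
      (∀ n q, eLpNorm (P.piece i₀ v θ n q) p volume ≤ A * two (-(μ * |(n : ℝ) - q|)) * δ q) →
      ∃ T : 𝓢'(E d, ℂ), (∀ g : 𝓢(E d, ℂ),
        HasSum (fun k : ℤ × ℤ => ∫ x, P.piece i₀ v θ k.1 k.2 x * g x) (T g)) ∧
        besovNorm P 0 p r T ≤ C * A * seqNorm r (fold δ) := by
  obtain ⟨C, hC⟩ := exists_distLpNorm_block_le P hμ hp
  have hμ2 : 0 < μ / 2 := by linarith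
  have hw := tsum_two_neg_abs_ne_top hμ2
  refine ⟨C * (∑' n : ℤ, two (-(μ / 2 * |(n : ℝ)|))).toNNReal,
    fun r p' v θ Θ A δ i₀ hr H hp' hA hδ hfin hb => ?_⟩
  have hY := seqNorm_tsum_two_mul_le hr hμ2 (fold δ)
  have hfold : ∀ m : ℕ, ∑' q : ℤ, two (-(μ / 2 * |(m : ℝ) - q.toNat|)) * δ q =
      ∑' j : ℕ, two (-(μ / 2 * |(m : ℝ) - j|)) * fold δ j := fun m =>
    tsum_mul_eq_tsum_fold (fun j => two (-(μ / 2 * |(m : ℝ) - j|))) δ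
  have hs : ∀ m : ℕ, ∑' q : ℤ, two (-(μ / 2 * |(m : ℝ) - q.toNat|)) * δ q ≠ ⊤ := fun m => by
    rw [hfold]
    exact ne_top_of_le_ne_top (ENNReal.mul_ne_top hw hfin)
      ((le_seqNorm hr (fun m : ℕ => ∑' j : ℕ, two (-(μ / 2 * |(m : ℝ) - j|)) * fold δ j) m).trans hY)
  have hs0 : ∑' q : ℤ, two (-(μ / 2 * q.toNat)) * δ q ≠ ⊤ := by
    have := hs 0
    simpa only [Nat.cast_zero, zero_sub, abs_neg, Nat.abs_cast] using this
  obtain ⟨T, hT⟩ := H.exists_hasSum_piece hp' hp hA hδ hμ hμ1 hb hs0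
  refine ⟨T, hT, ?_⟩
  rw [besovNorm, ENNReal.coe_mul, ENNReal.coe_toNNReal hw]
  calc _ ≤ seqNorm r fun m => (C * A) * ∑' j : ℕ, two (-(μ / 2 * |(m : ℝ) - j|)) * fold δ j :=
        seqNorm_mono hr fun m => by
          rw [two_zero_mul_eq, one_mul, ← hfold]
          exact hC p' v θ Θ T A δ i₀ H hp' hA hδ hb hT hs m
    _ ≤ (C * A) * ((∑' n : ℤ, two (-(μ / 2 * |(n : ℝ)|))) * seqNorm r (fold δ)) :=
        (seqNorm_const_mul_le hr (ENNReal.mul_ne_top ENNReal.coe_ne_top hA) _).trans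
          (mul_le_mul_right hY _)
    _ = _ := by ring

/-- The Besov norm controls the sizes of the dyadic blocks. -/
theorem exists_seqNorm_fold_le (P : DyadicPartition d) (hd : 0 < d) {ρ : ℝ≥0∞} (hρ : 1 ≤ ρ)
    (hρt : ρ ≠ ⊤) {κ ε : ℝ} (hκ : 0 ≤ κ) (hκε : κ ≤ ε) :
    ∃ C : ℝ≥0, ∀ (r : ℝ≥0∞) (θ : E d → ℂ) (Θ : 𝓢'(E d, ℂ)), 1 ≤ r →
      seqNorm r (fold fun q => two (κ * q) * P.blockSize ρ θ Θ q) ≤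
        C * (besovNorm P ε ⊤ r Θ + eLpNorm θ ρ volume) := by
  set c : ℝ := κ + d / ρ.toReal
  have hρr : 0 < ρ.toReal := ENNReal.toReal_pos (by rintro rfl; simp at hρ) hρt
  have hc : 0 < c := by positivity
  have hw := tsum_two_neg_abs_ne_top hc
  refine ⟨max (3 * (two κ).toNNReal) (∑' n : ℤ, two (-(c * |(n : ℝ)|))).toNNReal,
    fun r θ Θ hr => ?_⟩
  let δ : ℤ → ℝ≥0∞ := fun q => two (κ * q) * P.blockSize ρ θ Θ q
  let b : ℕ → ℝ≥0∞ := fun n =>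
    ENNReal.ofReal ((2 : ℝ) ^ (((n : ℝ) - 1) * ε)) * distLpNorm ⊤ (P.block n Θ)
  -- Low frequencies: the bound 2^(q(κ + d/ρ)) ‖θ‖_ρ is a convergent geometric series over q ≤ 0,
  -- because ρ < ∞.
  have h0 : fold δ 0 ≤ (∑' n : ℤ, two (-(c * |(n : ℝ)|))) * eLpNorm θ ρ volume := by
    rw [fold, ← ENNReal.tsum_mul_right]
    refine ENNReal.tsum_le_tsum fun q => ?_
    split_ifs with h
    · have hq : q ≤ 0 := by omega
      have hq' : (q : ℝ) ≤ 0 := by exact_mod_cast hq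
      simp only [δ, blockSize, if_pos hq]
      rw [← mul_assoc, show ENNReal.ofReal ((2 : ℝ) ^ ((q : ℝ) * (d / ρ.toReal)))
        = two ((q : ℝ) * (d / ρ.toReal)) from rfl, ← two_add, abs_of_nonpos hq']
      gcongr
      refine two_mono (le_of_eq ?_)
      simp only [c]; ring
    · exact zero_le
  -- For j ≥ 1 the three neighbours of the j-th block have inhomogeneous indices j + i + 1, that is,
  -- shifts by −(i + 1). The loss 2^κ comes from the neighbour i = −1, and κ ≤ ε allows the weight
  -- of the Besov norm.
  have hj : ∀ j : ℕ, fold δ j ≤ (if j = 0 then fold δ 0 else 0) +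
      ∑ i ∈ Finset.Icc (-1 : ℤ) 1, two κ * shift b (-(i + 1)) j := fun j => by
    rcases eq_or_ne j 0 with rfl | hj
    · rw [if_pos rfl]
      exact le_self_add
    · rw [if_neg hj, zero_add, fold_of_pos δ hj]
      have hq : ¬ (j : ℤ) ≤ 0 := by omega
      simp only [δ, blockSize, if_neg hq]
      rw [Finset.mul_sum]
      refine Finset.sum_le_sum fun i hi => ?_
      rw [Finset.mem_Icc] at hi
      obtain ⟨m, hm⟩ : ∃ m : ℕ, (j : ℤ) + i + 1 = m := ⟨((j : ℤ) + i + 1).toNat, by omega⟩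
      have hm' : (j : ℤ) - -(i + 1) = m := by omega
      rw [shift, if_pos (by omega), hm', hm]
      simp only [Int.toNat_natCast, b]
      rw [← mul_assoc]
      gcongr
      rw [show ENNReal.ofReal ((2 : ℝ) ^ (((m : ℝ) - 1) * ε)) = two (((m : ℝ) - 1) * ε) from rfl,
        ← two_add]
      refine two_mono ?_
      have e1 : (m : ℝ) = j + i + 1 := by exact_mod_cast hm.symm
      have e2 : (-1 : ℝ) ≤ i := by exact_mod_cast hi.1
      have e3 : (1 : ℝ) ≤ m := by exact_mod_cast (by omega : 1 ≤ m)
      push_cast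
      nlinarith
  have hbes : besovNorm P ε ⊤ r Θ = seqNorm r b := rfl
  rw [hbes, ENNReal.coe_max, ENNReal.coe_mul, ENNReal.coe_toNNReal hw,
    ENNReal.coe_toNNReal (two_ne_top κ)]
  calc _ ≤ fold δ 0 + ∑ i ∈ Finset.Icc (-1 : ℤ) 1, two κ * seqNorm r b := by
        refine (seqNorm_mono hr hj).trans ((seqNorm_add_le hr _ _).trans
          (add_le_add (seqNorm_single_zero_le hr _) ((seqNorm_sum_le hr _ _).trans
            (Finset.sum_le_sum fun i _ => ?_))))
        exact (seqNorm_const_mul_le hr (two_ne_top κ) _).trans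
          (mul_le_mul_right (seqNorm_shift_le hr b _) _)
    _ ≤ (∑' n : ℤ, two (-(c * |(n : ℝ)|))) * eLpNorm θ ρ volume + 3 * two κ * seqNorm r b := by
        refine add_le_add h0 (le_of_eq ?_)
        rw [Finset.sum_const, show (Finset.Icc (-1 : ℤ) 1).card = 3 by simp, nsmul_eq_mul]
        push_cast; ring
    _ ≤ _ := by
        rw [add_comm, mul_add]
        exact add_le_add (mul_le_mul_left (le_max_left _ _) _) (mul_le_mul_left (le_max_right _ _) _)

end DyadicPartition

/-! ### Identification of the commutator -/

theorem measurable_convection {v : E d → E d} (hv : Measurable v) (f : E d → ℂ) :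
    Measurable (convection v f) := by
  have e : convection v f = fun x => ∑ i, v x i • fderiv ℝ f x (EuclideanSpace.single i 1) := by
    ext x
    exact fderiv_eq_sum _ _
  rw [e]
  refine Finset.measurable_sum _ fun i _ => ?_
  have h : Measurable fun x => v x i := (EuclideanSpace.proj i : E d →L[ℝ] ℝ).measurable.comp hv
  exact h.smul (measurable_fderiv_apply_const ℝ f _)

namespace DyadicPartition

variable {P : DyadicPartition d} {v : E d → E d} {θ : E d → ℂ} {Θ : 𝓢'(E d, ℂ)}

theorem memLp_convection_mult [Nonempty (Fin d)] (P : DyadicPartition d) {h : Sym d}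
    (hh : h.IsHomogeneous) (g : 𝓢(E d, ℂ))
    (hv : Continuous v) {p' : ℝ≥0∞} {s : ℝ} (hs : 0 ≤ s) (hsd : s < d + 1)
    (hw : MemLp (fun x => ‖v x‖ * (1 + ‖x‖) ^ (-s)) p' volume) :
    MemLp (convection v (h.mult g)) p' volume := by
  obtain ⟨u, hu, hb⟩ := P.exists_convection_conv_ker_le h g hs hsd v
  refine (hw.const_mul (∑' n, u n)).mono
    (measurable_convection hv.measurable _).aestronglyMeasurable
    (Filter.Eventually.of_forall fun x => ?_)
  rw [← (P.hasSum_convection_conv_ker hh g v x).tsum_eq]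
  refine (tsum_of_norm_bounded (hu.hasSum.mul_right _) fun n => hb n x).trans ?_
  exact Real.le_norm_self _

theorem hasSum_integral_mul_convection [Nonempty (Fin d)] (P : DyadicPartition d) {h : Sym d}
    (hh : h.IsHomogeneous) (g : 𝓢(E d, ℂ))
    (hv : Continuous v) {p p' : ℝ≥0∞} [p.HolderConjugate p'] {s : ℝ} (hs : 0 ≤ s) (hsd : s < d + 1)
    (hw : MemLp (fun x => ‖v x‖ * (1 + ‖x‖) ^ (-s)) p' volume) {f : E d → ℂ}
    (hf : MemLp f p volume) :
    HasSum (fun n : ℤ => ∫ x, f x * convection v (conv (P.ker h n) g) x)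
      (∫ x, f x * convection v (h.mult g) x) := by
  obtain ⟨u, hu, hb⟩ := P.exists_convection_conv_ker_le h g hs hsd v
  have hG : Integrable fun x => ‖f x‖ * (‖v x‖ * (1 + ‖x‖) ^ (-s)) :=
    MemLp.integrable_mul (p := p) (q := p') hf.norm hw
  refine (hasSum_integral_of_summable_bound
    (F := fun n x => f x * convection v (conv (P.ker h n) g) x)
    (fun n => hf.1.mul (measurable_convection hv.measurable _).aestronglyMeasurable) hu hG
    (fun n x => ?_) (Filter.Eventually.of_forall fun x =>
      (P.hasSum_convection_conv_ker hh g v x).mul_left _)).2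
  rw [norm_mul]
  calc _ ≤ ‖f x‖ * (u n * (‖v x‖ * (1 + ‖x‖) ^ (-s))) := by gcongr; exact hb n x
    _ = _ := by ring

theorem hasSum_integral_mul_conv_ker [Nonempty (Fin d)] (P : DyadicPartition d) {h : Sym d}
    (hh : h.IsHomogeneous) (g : 𝓢(E d, ℂ)) {p p' : ℝ≥0∞} [p.HolderConjugate p'] (hp : 1 < p)
    (hpt : p ≠ ⊤) {f : E d → ℂ} (hf : MemLp f p volume) :
    Integrable (fun x => f x * h.mult g x) ∧
    HasSum (fun n : ℤ => ∫ x, f x * conv (P.ker h n) g x) (∫ x, f x * h.mult g x) := by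
  have hd : 0 < d := Fin.pos_iff_nonempty.2 inferInstance
  obtain ⟨s, hs0, hsd, hsp⟩ := exists_memLp_one_add_norm_rpow (p' := p') hd hp hpt
  obtain ⟨u, hu, hb⟩ := P.exists_conv_ker_le h g hs0 hsd
  have hG : Integrable fun x => ‖f x‖ * (1 + ‖x‖) ^ (-s) :=
    MemLp.integrable_mul (p := p) (q := p') hf.norm hsp
  refine hasSum_integral_of_summable_bound
    (F := fun n x => f x * conv (P.ker h n) g x)
    (fun n => hf.1.mul (conv (P.ker h n) g).continuous.aestronglyMeasurable) hu hG
    (fun n x => ?_) (Filter.Eventually.of_forall fun x =>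
      (P.hasSum_conv_ker hh g x).mul_left _)
  rw [norm_mul]
  calc _ ≤ ‖f x‖ * (u n * (1 + ‖x‖) ^ (-s)) := by gcongr; exact hb n x
    _ = _ := by ring

theorem contDiff_convection (hv : ContDiff ℝ ∞ v) (g : 𝓢(E d, ℂ)) :
    ContDiff ℝ ∞ (convection v g) :=
  (g.smooth'.fderiv_right (m := ∞) (by simp)).clm_apply hv

theorem hasCompactSupport_convection {g : E d → ℂ} (hg : HasCompactSupport g) :
    HasCompactSupport (convection v g) :=
  (hg.fderiv (𝕜 := ℝ)).mono fun x hx hx' => hx (by simp [convection, hx'])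

/-- For fixed q, summing over n rebuilds R g in the first half and g in the second. Summing over q
then rebuilds θ in the first half and the Riesz transform of v·∇g in the second. The double series
converges absolutely, so this order of summation gives T. -/
theorem Admissible.isCommutator {ϑ : E d → ℝ} {p p' : ℝ≥0∞} [hpp : p.HolderConjugate p']
    (H : P.Admissible v p (fun x => (ϑ x : ℂ)) Θ) (hp : 1 < p) (hpt : p ≠ ⊤) {s : ℝ} (hs : 0 ≤ s)
    (hsd : s < d + 1) (hw : MemLp (fun x => ‖v x‖ * (1 + ‖x‖) ^ (-s)) p' volume) (i₀ : Fin d)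
    {T : 𝓢'(E d, ℂ)} (hT : ∀ g : 𝓢(E d, ℂ), HasSum (fun k : ℤ × ℤ =>
      ∫ x, P.piece i₀ v (fun x => (ϑ x : ℂ)) k.1 k.2 x * g x) (T g)) :
    IsCommutator i₀ v ϑ T := by
  intro g hg
  have : Nonempty (Fin d) := ⟨i₀⟩
  set θ : E d → ℂ := fun x => (ϑ x : ℂ)
  have hvc : Continuous v := H.smooth.continuous
  have hθ := temperateInt_of_memLp hp.le H.memLp
  -- Compact support of g makes v·∇g a Schwartz function, whatever the growth of v.
  let F : 𝓢(E d, ℂ) := (hasCompactSupport_convection (v := v) hg).toSchwartzMap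
    (contDiff_convection H.smooth g)
  have hF : (F : E d → ℂ) = convection v g := rfl
  have hL := P.memLp_convection_mult (Sym.isHomogeneous_riesz i₀) g hvc hs hsd hw
  rw [Sym.mult_riesz] at hL
  have h2 := P.hasSum_integral_mul_conv_ker (Sym.isHomogeneous_riesz i₀) F (p' := p') hp hpt H.memLp
  rw [Sym.mult_riesz, hF] at h2
  refine ⟨MemLp.integrable_mul (p := p) (q := p') H.memLp hL, h2.1, ?_⟩
  have hq : ∀ q : ℤ, HasSum (fun n : ℤ => ∫ x, P.piece i₀ v θ n q x * g x)
      ((∫ x, corr (P.ker Sym.one q) θ x * convection v (riesz i₀ g) x)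
        - ∫ x, θ x * conv (P.ker (Sym.riesz i₀) q) F x) := fun q => by
    obtain ⟨A, hA, hA'⟩ := H.exists_norm_corr_ker_le hp.le Sym.one (Sym.riesz i₀) q
    have e1 := P.hasSum_integral_mul_convection (Sym.isHomogeneous_riesz i₀) g hvc hs hsd hw
      (memLp_corr H.cont hp.le H.memLp (P.ker Sym.one q))
    have e2 := P.hasSum_integral_mul_convection Sym.isHomogeneous_one g hvc hs hsd hw
      (memLp_corr H.cont hp.le H.memLp (P.ker (Sym.riesz i₀) q))
    rw [Sym.mult_riesz] at e1
    rw [Sym.mult_one, ← hF, hθ.integral_corr_mul] at e2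
    refine (e1.sub e2).congr_fun fun n => ?_
    exact ((P.integral_piece_mul H.temp hθ i₀ hA hA' n g).2)
  have h3 : HasSum (fun q : ℤ => (∫ x, corr (P.ker Sym.one q) θ x * convection v (riesz i₀ g) x)
        - ∫ x, θ x * conv (P.ker (Sym.riesz i₀) q) F x) (T g) :=
    ((Equiv.prodComm ℤ ℤ).hasSum_iff.2 (hT g)).prod_fiberwise hq
  have h4 := h3.comp tendsto_Ico_neg_atTop
  -- In the first half, v·∇(R g) is only known to be in L^p', so its q-series is summed along
  -- symmetric partial sums; uniqueness of the limit then identifies T.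
  have h5 := (P.tendsto_sum_integral_corr_mul hp hpt H.cont H.memLp hL).sub
    (h2.2.comp tendsto_Ico_neg_atTop)
  refine tendsto_nhds_unique h4 (h5.congr fun Q => ?_)
  simp only [Function.comp, Finset.sum_sub_distrib]

end DyadicPartition

/-! ### Growth of vector fields -/

/-- A radial average of the gradient of a vector field. -/
noncomputable def radialAvg (v : E d → E d) (a : ℝ) (x : E d) : ℝ :=
  ∫ t in (0 : ℝ)..1, |t| ^ a * ‖fderiv ℝ v (|t| • x)‖

theorem continuous_radialAvg {v : E d → E d} (hv : ContDiff ℝ 1 v) {a : ℝ} (ha : 0 ≤ a) :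
    Continuous (radialAvg v a) := by
  have hc : Continuous (fderiv ℝ v) := hv.continuous_fderiv (by simp)
  refine intervalIntegral.continuous_parametric_intervalIntegral_of_continuous' ?_ 0 1
  have h1 : Continuous fun z : E d × ℝ => |z.2| ^ a :=
    Continuous.rpow_const (by fun_prop) fun _ => .inr ha
  exact h1.mul (by fun_prop)

/-- Dilation by t multiplies the L^p norm by t^(-d/p), which the weight t^(d/p) compensates exactly;
Minkowski's inequality over t ∈ (0, 1] does the rest. -/
theorem eLpNorm_radialAvg_le {v : E d → E d} (hv : ContDiff ℝ 1 v) {p : ℝ≥0∞} (hp : 1 ≤ p)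
    (ha : 0 < d / p.toReal) :
    eLpNorm (radialAvg v (d / p.toReal)) p volume ≤ eLpNorm (fderiv ℝ v) p volume := by
  have hc : Continuous (fderiv ℝ v) := hv.continuous_fderiv (by simp)
  set a : ℝ := d / p.toReal
  have h1 : Continuous fun z : E d × ℝ => |z.2| ^ a * ‖fderiv ℝ v (|z.2| • z.1)‖ :=
    (Continuous.rpow_const (by fun_prop) fun _ => .inr ha.le).mul (by fun_prop)
  have h := eLpNorm_lintegral_le (μ := (volume : Measure (E d)))
    (ν := volume.restrict (Set.Ioc (0 : ℝ) 1)) hp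
    (F := fun x t => ‖|t| ^ a * ‖fderiv ℝ v (|t| • x)‖‖ₑ) h1.measurable.enorm
    (A := eLpNorm (fderiv ℝ v) p volume) (fun t => by
      rcases eq_or_ne t 0 with rfl | ht
      · simp [Real.zero_rpow ha.ne']
      · have ht' : 0 < |t| := abs_pos.2 ht
        rw [eLpNorm_enorm (fun x => |t| ^ a * ‖fderiv ℝ v (|t| • x)‖)]
        have e : (fun x => |t| ^ a * ‖fderiv ℝ v (|t| • x)‖)
            = |t| ^ a • fun x => ‖fderiv ℝ v (0 + |t| • x)‖ := by
          ext x; simp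
        rw [e, eLpNorm_const_smul, eLpNorm_norm,
          eLpNorm_comp_add_smul hc.aestronglyMeasurable _ _ ht', ← mul_assoc,
          Real.enorm_of_nonneg (by positivity), ← ENNReal.ofReal_mul (by positivity),
          ← Real.rpow_add ht']
        simp [a])
  simp only [MeasurableSet.univ, Measure.restrict_apply, Set.univ_inter, Real.volume_Ioc,
    sub_zero, ENNReal.ofReal_one, one_mul] at h
  refine le_trans (eLpNorm_mono_enorm fun x => ?_) h
  rw [radialAvg, intervalIntegral.integral_of_le zero_le_one, enorm_eq_self]
  exact enorm_integral_le_lintegral_enorm _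

/-- Integrate ∇v along the segment from 0 to x. Inside the unit ball ∇v is bounded; outside, t|x| >
1, so the factor (t|x|)^a ≥ 1 can be inserted, which produces the weight t^a of the radial average
at the cost of |x|^a. -/
theorem exists_norm_le_radialAvg {v : E d → E d} (hv : ContDiff ℝ 1 v) {a : ℝ} (ha : 0 ≤ a) :
    ∃ B : ℝ, 0 ≤ B ∧ ∀ x, ‖v x‖ ≤ B * (1 + ‖x‖) + (1 + ‖x‖) ^ (1 + a) * radialAvg v a x := by
  have hc : Continuous (fderiv ℝ v) := hv.continuous_fderiv (by simp)
  obtain ⟨B, hB⟩ := (isCompact_closedBall (0 : E d) 1).exists_bound_of_continuousOn hc.continuousOn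
  have hB0 : 0 ≤ B := (norm_nonneg _).trans (hB 0 (by simp))
  refine ⟨B + ‖v 0‖, by positivity, fun x => ?_⟩
  have hd : ∀ t : ℝ, HasDerivAt (fun t : ℝ => v (t • x)) (fderiv ℝ v (t • x) x) t := fun t => by
    have h1 : HasDerivAt (fun t : ℝ => t • x) x t := by
      simpa using (hasDerivAt_id t).smul_const x
    exact ((hv.differentiable (by simp)) _).hasFDerivAt.comp_hasDerivAt t h1
  have hcx : Continuous fun t : ℝ => fderiv ℝ v (t • x) x := by fun_prop
  have h := intervalIntegral.integral_eq_sub_of_hasDerivAt (a := 0) (b := 1) (fun t _ => hd t)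
    (hcx.intervalIntegrable _ _)
  simp only [one_smul, zero_smul] at h
  have hr : Continuous fun t : ℝ => |t| ^ a * ‖fderiv ℝ v (|t| • x)‖ :=
    (Continuous.rpow_const (by fun_prop) fun _ => .inr ha).mul (by fun_prop)
  have hpt : ∀ t ∈ Set.Icc (0 : ℝ) 1, ‖fderiv ℝ v (t • x) x‖ ≤
      B * ‖x‖ + (1 + ‖x‖) ^ (1 + a) * (|t| ^ a * ‖fderiv ℝ v (|t| • x)‖) := fun t ht => by
    rw [abs_of_nonneg ht.1]
    have h1 : ‖fderiv ℝ v (t • x) x‖ ≤ ‖fderiv ℝ v (t • x)‖ * ‖x‖ :=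
      ContinuousLinearMap.le_opNorm _ _
    have hta : 0 ≤ t ^ a := Real.rpow_nonneg ht.1 a
    rcases le_or_gt ‖t • x‖ 1 with hx | hx
    · have h2 := hB (t • x) (by simpa using hx)
      have h3 : 0 ≤ (1 + ‖x‖) ^ (1 + a) * (t ^ a * ‖fderiv ℝ v (t • x)‖) := by positivity
      calc _ ≤ _ := h1
        _ ≤ B * ‖x‖ := by gcongr
        _ ≤ _ := by linarith
    · rw [norm_smul, Real.norm_of_nonneg ht.1] at hx
      have h4 : 1 ≤ t ^ a * ‖x‖ ^ a := by
        rw [← Real.mul_rpow ht.1 (norm_nonneg _)]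
        exact Real.one_le_rpow hx.le ha
      have h5 : ‖x‖ ^ a ≤ (1 + ‖x‖) ^ a :=
        Real.rpow_le_rpow (norm_nonneg _) (by linarith) ha
      have h6 : 0 ≤ B * ‖x‖ := by positivity
      calc _ ≤ _ := h1
        _ = 1 * (‖fderiv ℝ v (t • x)‖ * ‖x‖) := (one_mul _).symm
        _ ≤ (t ^ a * (1 + ‖x‖) ^ a) * (‖fderiv ℝ v (t • x)‖ * (1 + ‖x‖)) := by
            gcongr
            · exact h4.trans (by gcongr)
            · linarith
        _ = (1 + ‖x‖) ^ (1 + a) * (t ^ a * ‖fderiv ℝ v (t • x)‖) := by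
            rw [Real.rpow_add (by positivity), Real.rpow_one]; ring
        _ ≤ _ := by linarith
  have h7 : ‖v x - v 0‖ ≤ B * ‖x‖ + (1 + ‖x‖) ^ (1 + a) * radialAvg v a x := by
    rw [← h]
    refine (intervalIntegral.norm_integral_le_integral_norm zero_le_one).trans ?_
    calc _ ≤ ∫ t in (0 : ℝ)..1, (B * ‖x‖ +
          (1 + ‖x‖) ^ (1 + a) * (|t| ^ a * ‖fderiv ℝ v (|t| • x)‖)) :=
          intervalIntegral.integral_mono_on zero_le_one (hcx.norm.intervalIntegrable _ _)
            ((continuous_const.add (continuous_const.mul hr)).intervalIntegrable _ _) hpt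
      _ = _ := by
          have hr' : Continuous fun t : ℝ =>
              (1 + ‖x‖) ^ (1 + a) * (|t| ^ a * ‖fderiv ℝ v (|t| • x)‖) := continuous_const.mul hr
          have hi := intervalIntegral.integral_add (a := (0 : ℝ)) (b := 1) (μ := volume)
            (f := fun _ => B * ‖x‖)
            (g := fun t => (1 + ‖x‖) ^ (1 + a) * (|t| ^ a * ‖fderiv ℝ v (|t| • x)‖))
            (continuous_const.intervalIntegrable _ _) (hr'.intervalIntegrable _ _)
          rw [hi, intervalIntegral.integral_const_mul]
          simp [radialAvg]
  calc ‖v x‖ ≤ ‖v x - v 0‖ + ‖v 0‖ := by simpa using norm_add_le (v x - v 0) (v 0)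
    _ ≤ (B * ‖x‖ + (1 + ‖x‖) ^ (1 + a) * radialAvg v a x) + ‖v 0‖ := by gcongr
    _ ≤ _ := by nlinarith [norm_nonneg x, norm_nonneg (v 0)]

/-- The linear part of the growth of v is absorbed by the weight alone. The radial average lies in
L^p and is brought to L^p' by a weight in L^σ with 1/σ = 1/p' − 1/p. This requires p' ≤ p, that is,
p ≥ 2. -/
theorem exists_memLp_mul_of_memLp_fderiv {v : E d → E d} (hv : ContDiff ℝ 1 v) (hd : 0 < d)
    {p p' : ℝ≥0∞} [hpp : p.HolderConjugate p'] (hp : 2 ≤ p) (hpt : p ≠ ⊤)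
    (hvp : MemLp (fderiv ℝ v) p volume) :
    ∃ s : ℝ, 0 ≤ s ∧ s < d + 1 ∧ MemLp (fun x => ‖v x‖ * (1 + ‖x‖) ^ (-s)) p' volume := by
  have hp1 : 1 < p := lt_of_lt_of_le (by norm_num) hp
  obtain ⟨hp't, hp'1⟩ := one_lt_conjExponent_toReal (p' := p') hp1 hpt
  have hp'0 : p' ≠ 0 := by rintro rfl; simp at hp'1; linarith
  have hd' : (0 : ℝ) < d := by exact_mod_cast hd
  have hpr : 2 ≤ p.toReal := by
    rw [← ENNReal.toReal_ofNat]; exact ENNReal.toReal_mono hpt hp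
  have hinv : p.toReal⁻¹ + p'.toReal⁻¹ = 1 := by
    have := ENNReal.HolderConjugate.inv_add_inv_eq_one p p'
    have h3 : (p⁻¹ + p'⁻¹).toReal = 1 := by rw [this]; rfl
    rwa [ENNReal.toReal_add (by simp [ENNReal.HolderConjugate.ne_zero p p'])
      (by simp [hp'0]), ENNReal.toReal_inv, ENNReal.toReal_inv] at h3
  set a : ℝ := d / p.toReal with ha_def
  have ha : 0 < a := by positivity
  have had : a ≤ d / 2 := div_le_div_of_nonneg_left hd'.le two_pos hpr
  -- With a = d/p, the two weights are integrable when s − 1 > d − a and s − 1 − a > d − 2a, while s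
  -- < d + 1 is also needed. So any s strictly between d + 1 − a and d + 1 passes these three tests;
  -- the midpoint is taken.
  set s : ℝ := d + 1 - a / 2 with hs_def
  have hV : MemLp (radialAvg v a) p volume :=
    ⟨(continuous_radialAvg hv ha.le).aestronglyMeasurable,
      (eLpNorm_radialAvg_le hv hp1.le ha).trans_lt hvp.2⟩
  obtain ⟨B, hB0, hB⟩ := exists_norm_le_radialAvg hv ha.le
  have h1 : MemLp (fun x : E d => (1 + ‖x‖) ^ (-(s - 1))) p' volume := by
    refine memLp_one_add_norm_rpow hp't hp'0 ?_
    have : (d : ℝ) / p'.toReal < s - 1 := by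
      rw [div_eq_mul_inv, show p'.toReal⁻¹ = 1 - p.toReal⁻¹ by linarith]
      have : a = d * p.toReal⁻¹ := div_eq_mul_inv _ _
      nlinarith
    rwa [div_lt_iff₀ (by linarith)] at this
  have h2 : MemLp (fun x => (1 + ‖x‖) ^ (-(s - 1 - a)) * radialAvg v a x) p' volume := by
    have hle : p⁻¹ ≤ p'⁻¹ := by
      rw [← ENNReal.toReal_le_toReal (by simp [ENNReal.HolderConjugate.ne_zero p p'])
        (by simp [hp'0]), ENNReal.toReal_inv, ENNReal.toReal_inv]
      have : p.toReal⁻¹ ≤ 2⁻¹ := by gcongr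
      linarith
    set σ : ℝ≥0∞ := (p'⁻¹ - p⁻¹)⁻¹ with hσ
    have hσi : σ⁻¹ = p'⁻¹ - p⁻¹ := by rw [hσ, inv_inv]
    have : ENNReal.HolderTriple σ p p' := ⟨by rw [hσi, tsub_add_cancel_of_le hle]⟩
    have h3 : MemLp (fun x : E d => (1 + ‖x‖) ^ (-(s - 1 - a))) σ volume := by
      have hc : Continuous fun x : E d => (1 + ‖x‖) ^ (-(s - 1 - a)) :=
        Continuous.rpow_const (by fun_prop) fun x => .inl (by positivity)
      have hpos : 0 ≤ s - 1 - a := by rw [hs_def]; linarith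
      by_cases hσt : σ = ⊤
      · rw [hσt]
        refine memLp_top_of_bound hc.aestronglyMeasurable 1 (Filter.Eventually.of_forall fun x => ?_)
        rw [Real.norm_of_nonneg (by positivity)]
        exact Real.rpow_le_one_of_one_le_of_nonpos (by linarith [norm_nonneg x]) (by linarith)
      · have hσ0 : σ ≠ 0 := by
          rw [hσ, ENNReal.inv_ne_zero]
          exact ENNReal.sub_ne_top (by simp [hp'0])
        have hσr : 0 < σ.toReal := ENNReal.toReal_pos hσ0 hσt
        refine memLp_one_add_norm_rpow hσt hσ0 ?_
        have hσe : σ.toReal⁻¹ = p'.toReal⁻¹ - p.toReal⁻¹ := by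
          rw [← ENNReal.toReal_inv, hσi, ENNReal.toReal_sub_of_le hle (by simp [hp'0]),
            ENNReal.toReal_inv, ENNReal.toReal_inv]
        have : (d : ℝ) / σ.toReal < s - 1 - a := by
          rw [div_eq_mul_inv, hσe, show p'.toReal⁻¹ = 1 - p.toReal⁻¹ by linarith]
          have : a = d * p.toReal⁻¹ := div_eq_mul_inv _ _
          nlinarith
        rwa [div_lt_iff₀ hσr] at this
    exact MemLp.mul' hV h3
  refine ⟨s, by rw [hs_def]; linarith, by rw [hs_def]; linarith, ?_⟩
  refine ((h1.const_mul B).add h2).mono ?_ (Filter.Eventually.of_forall fun x => ?_)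
  · have hc : Continuous fun x : E d => (1 + ‖x‖) ^ (-s) :=
      Continuous.rpow_const (by fun_prop) fun x => .inl (by positivity)
    exact (hv.continuous.norm.mul hc).aestronglyMeasurable
  · rw [Real.norm_of_nonneg (by positivity)]
    refine le_trans ?_ (Real.le_norm_self _)
    simp only [Pi.add_apply]
    calc _ ≤ (B * (1 + ‖x‖) + (1 + ‖x‖) ^ (1 + a) * radialAvg v a x) * (1 + ‖x‖) ^ (-s) := by
          gcongr; exact hB x
      _ = B * ((1 + ‖x‖) ^ (1 : ℝ) * (1 + ‖x‖) ^ (-s)) +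
          ((1 + ‖x‖) ^ (1 + a) * (1 + ‖x‖) ^ (-s)) * radialAvg v a x := by
          rw [Real.rpow_one]; ring
      _ = _ := by
          rw [← Real.rpow_add (by positivity), ← Real.rpow_add (by positivity)]
          ring_nf

/-- A Hölder field grows at most linearly, so one extra power of the weight suffices and no relation
between p and p' is needed. -/
theorem exists_memLp_mul_of_holder {v : E d → E d} (hv : Continuous v) (hd : 0 < d)
    {p p' : ℝ≥0∞} [hpp : p.HolderConjugate p'] (hp : 1 < p) (hpt : p ≠ ⊤) {Ω : ℝ≥0∞} (hΩt : Ω ≠ ⊤)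
    {a : ℝ} (ha : 0 ≤ a) (ha1 : a ≤ 1) (hΩ : ∀ x w, ‖v (x + w) - v x‖ₑ ≤ Ω * ‖w‖ₑ ^ a) :
    ∃ s : ℝ, 0 ≤ s ∧ s < d + 1 ∧ MemLp (fun x => ‖v x‖ * (1 + ‖x‖) ^ (-s)) p' volume := by
  obtain ⟨s, hs0, hsd, hs⟩ := exists_memLp_one_add_norm_rpow (p' := p') hd hp hpt
  refine ⟨s + 1, by linarith, by linarith, ?_⟩
  refine (hs.const_mul (‖v 0‖ + Ω.toReal)).mono ?_ (Filter.Eventually.of_forall fun x => ?_)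
  · have hc : Continuous fun x : E d => (1 + ‖x‖) ^ (-(s + 1)) :=
      Continuous.rpow_const (by fun_prop) fun x => .inl (by positivity)
    exact (hv.norm.mul hc).aestronglyMeasurable
  · rw [Real.norm_of_nonneg (by positivity), Real.norm_of_nonneg (by positivity)]
    have h1 : ‖v x - v 0‖ ≤ Ω.toReal * (1 + ‖x‖) := by
      have h := ENNReal.toReal_mono (ENNReal.mul_ne_top hΩt
        (ENNReal.rpow_ne_top_of_nonneg ha enorm_ne_top)) (hΩ 0 x)
      rw [zero_add, toReal_enorm, ENNReal.toReal_mul, ← ENNReal.toReal_rpow, toReal_enorm] at h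
      refine h.trans ?_
      gcongr
      calc ‖x‖ ^ a ≤ (1 + ‖x‖) ^ a :=
            Real.rpow_le_rpow (norm_nonneg _) (by linarith) ha
        _ ≤ (1 + ‖x‖) ^ (1 : ℝ) :=
            Real.rpow_le_rpow_of_exponent_le (by linarith [norm_nonneg x]) ha1
        _ = _ := Real.rpow_one _
    have h2 : ‖v x‖ ≤ (‖v 0‖ + Ω.toReal) * (1 + ‖x‖) := by
      have : ‖v x‖ ≤ ‖v x - v 0‖ + ‖v 0‖ := by simpa using norm_add_le (v x - v 0) (v 0)
      nlinarith [norm_nonneg x, norm_nonneg (v 0), ENNReal.toReal_nonneg (a := Ω)]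
    calc _ ≤ (‖v 0‖ + Ω.toReal) * (1 + ‖x‖) * (1 + ‖x‖) ^ (-(s + 1)) := by gcongr
      _ = (‖v 0‖ + Ω.toReal) * ((1 + ‖x‖) ^ (1 : ℝ) * (1 + ‖x‖) ^ (-(s + 1))) := by
          rw [Real.rpow_one]; ring
      _ = _ := by
          rw [← Real.rpow_add (by positivity)]
          ring_nf

theorem TemperateInt.of_norm_le {f g : E d → ℂ} (hg : TemperateInt g)
    (hf : AEStronglyMeasurable f volume) (M : ℕ) (h : ∀ x, ‖f x‖ ≤ (1 + ‖x‖) ^ M * ‖g x‖) :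
    TemperateInt f := by
  obtain ⟨N, hN⟩ := hg
  have hc : Continuous fun x : E d => (((1 + ‖x‖) ^ (M + N))⁻¹ : ℝ) :=
    Continuous.inv₀ (by fun_prop) fun x => by positivity
  refine ⟨M + N, hN.mono (hc.aestronglyMeasurable.smul hf)
    (Filter.Eventually.of_forall fun x => ?_)⟩
  rw [norm_smul, norm_smul, Real.norm_of_nonneg (by positivity), Real.norm_of_nonneg (by positivity)]
  calc _ ≤ ((1 + ‖x‖) ^ (M + N))⁻¹ * ((1 + ‖x‖) ^ M * ‖g x‖) := by gcongr; exact h x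
    _ = _ := by
      rw [pow_add]; field_simp

/-- The components of a vector field whose gradient is in a Lebesgue space are temperate. -/
theorem temperateInt_comp_of_memLp_fderiv {v : E d → E d} (hv : ContDiff ℝ 1 v) (hd : 0 < d)
    {p : ℝ≥0∞} (hp : 1 ≤ p) (hpt : p ≠ ⊤) (hvp : MemLp (fderiv ℝ v) p volume) (i : Fin d) :
    TemperateInt (comp v i) := by
  have hp0 : 0 < p.toReal := ENNReal.toReal_pos (by positivity) hpt
  have ha : 0 < d / p.toReal := by positivity
  have hV : MemLp (radialAvg v (d / p.toReal)) p volume :=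
    ⟨(continuous_radialAvg hv ha.le).aestronglyMeasurable,
      (eLpNorm_radialAvg_le hv hp ha).trans_lt hvp.2⟩
  obtain ⟨B, hB0, hB⟩ := exists_norm_le_radialAvg hv ha.le
  obtain ⟨M, hM⟩ := exists_nat_ge (1 + d / p.toReal)
  have hVt : TemperateInt fun x => ((|radialAvg v (d / p.toReal) x| : ℝ) : ℂ) :=
    temperateInt_of_memLp hp hV.abs.ofReal
  have hci : Continuous (comp v i) := by
    have := hv.continuous
    unfold comp; fun_prop
  refine (hVt.sub (temperateInt_const (-(B : ℂ)))).of_norm_le hci.aestronglyMeasurable M fun x => ?_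
  rw [sub_neg_eq_add, ← Complex.ofReal_add, Complex.norm_real, Real.norm_of_nonneg (by positivity),
    comp, Complex.norm_real]
  have h1 : (1 : ℝ) ≤ 1 + ‖x‖ := by linarith [norm_nonneg x]
  have h2 : (1 + ‖x‖) ^ (1 + d / p.toReal) ≤ (1 + ‖x‖) ^ M := by
    rw [← Real.rpow_natCast]
    exact Real.rpow_le_rpow_of_exponent_le h1 hM
  have h3 : 1 + ‖x‖ ≤ (1 + ‖x‖) ^ M := by
    refine le_trans ?_ h2
    exact Real.self_le_rpow_of_one_le h1 (by linarith)
  calc ‖v x i‖ ≤ ‖v x‖ := PiLp.norm_apply_le _ _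
    _ ≤ _ := hB x
    _ ≤ B * (1 + ‖x‖) + (1 + ‖x‖) ^ (1 + d / p.toReal) * |radialAvg v (d / p.toReal) x| := by
      gcongr
      exact le_abs_self _
    _ ≤ B * (1 + ‖x‖) ^ M + (1 + ‖x‖) ^ M * |radialAvg v (d / p.toReal) x| := by
      gcongr
    _ = _ := by ring

/-! ### Hölder continuity of a vector field with bounded vorticity -/

/-- Integration by parts in a correlation. -/
theorem corr_fderiv {W : E d → ℂ} (hW : Differentiable ℝ W) (hW1 : TemperateInt W) (j : Fin d)
    (hW2 : TemperateInt fun y => fderiv ℝ W y (EuclideanSpace.single j 1)) (L : 𝓢(E d, ℂ))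
    (x : E d) :
    corr L (fun y => fderiv ℝ W y (EuclideanSpace.single j 1)) x = -corr (pd j L) W x := by
  have h := integral_fderiv_mul_mul (f := fun _ : E d => (1 : ℂ)) (W := W)
    (differentiable_const _) hW (A := 1) (B := 0) (fun x => by simp) j
    (by simpa using aestronglyMeasurable_const) (fun x => by simp) hW1 hW2 L x
  simp only [fderiv_fun_const, Pi.zero_apply, zero_apply, zero_mul, one_mul, integral_zero] at h
  simp only [corr]
  linear_combination h

theorem pd_comm (i j : Fin d) (K : 𝓢(E d, ℂ)) : pd i (pd j K) = pd j (pd i K) := by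
  refine fourier_injective fun ξ => ?_
  simp only [fourier_pd]
  ring

theorem TemperateInt.corr_fun_sum {ι : Type*} (s : Finset ι) {f : ι → E d → ℂ}
    (hf : ∀ i, TemperateInt (f i)) (K : 𝓢(E d, ℂ)) (y : E d) :
    corr K (fun x => ∑ i ∈ s, f i x) y = ∑ i ∈ s, corr K (f i) y := by
  simp only [corr, Finset.sum_mul]
  exact integral_finsetSum _ fun i _ => (hf i).integrable_mul_sub K y

theorem TemperateInt.corr_fun_sub {f g : E d → ℂ} (hf : TemperateInt f) (hg : TemperateInt g)
    (K : 𝓢(E d, ℂ)) (y : E d) :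
    corr K (fun x => f x - g x) y = corr K f y - corr K g y := by
  simp only [corr, sub_mul]
  exact integral_sub (hf.integrable_mul_sub K y) (hg.integrable_mul_sub K y)

/-- The entries of the vorticity, as complex functions. -/
noncomputable def vort (v : E d → E d) (i j : Fin d) (x : E d) : ℂ := ((vorticity v x i j : ℝ) : ℂ)

theorem vort_eq {v : E d → E d} (hv : Differentiable ℝ v) (i j : Fin d) :
    vort v i j = fun x => fderiv ℝ (comp v j) x (EuclideanSpace.single i 1) -
      fderiv ℝ (comp v i) x (EuclideanSpace.single j 1) := by
  ext x
  rw [fderiv_comp_apply (hv x), fderiv_comp_apply (hv x), vort, vorticity, Complex.ofReal_sub]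

theorem norm_vort_le (v : E d → E d) (i j : Fin d) (x : E d) : ‖vort v i j x‖ ≤ ‖vorticity v x‖ := by
  rw [vort, Complex.norm_real]
  exact (norm_le_pi_norm (vorticity v x i) j).trans (norm_le_pi_norm (vorticity v x) i)

theorem continuous_vort {v : E d → E d} (hv : ContDiff ℝ 1 v) (i j : Fin d) :
    Continuous (vort v i j) := by
  have hc : Continuous (fderiv ℝ v) := hv.continuous_fderiv (by simp)
  unfold vort vorticity
  fun_prop

/-- The size of the vorticity. -/
noncomputable def vortSize (v : E d → E d) (ρ : ℝ≥0∞) : ℝ≥0∞ :=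
  eLpNorm (vorticity v) ⊤ volume + eLpNorm (vorticity v) ρ volume

/-! ### The Biot–Savart law on dyadic blocks -/

namespace DyadicPartition

variable (P : DyadicPartition d)

section

variable {v : E d → E d} (hv : Differentiable ℝ v) (hT : ∀ i, TemperateInt (comp v i))
  (hT' : ∀ i j, TemperateInt fun y => fderiv ℝ (comp v i) y (EuclideanSpace.single j 1))

include hv hT hT'

/-- The Biot-Savart law, on a dyadic block. -/
theorem corr_ker_fderiv (hdiv : DivergenceFree v) (h : Sym d) (q : ℤ) (j k : Fin d) (y : E d) :
    corr (P.ker h q) (fun y => fderiv ℝ (comp v j) y (EuclideanSpace.single k 1)) y =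
      ∑ i, corr (P.ker ((h.divX i).mulX k) q) (vort v i j) y := by
  have hc : ∀ i, Differentiable ℝ (comp v i) := fun i y =>
    (hasFDerivAt_comp (hv y) i).differentiableAt
  have hI : ∀ (L : 𝓢(E d, ℂ)) (i j : Fin d),
      corr L (fun y => fderiv ℝ (comp v i) y (EuclideanSpace.single j 1)) y
        = -corr (pd j L) (comp v i) y := fun L i j => corr_fderiv (hc i) (hT i) j (hT' i j) L y
  have hS : ∀ i k : Fin d, pd k (P.ker (h.divX i) q) = pd i (P.ker (h.divX k) q) := fun i k => by
    rw [pd_ker, pd_ker]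
    congr 2
    simp only [Sym.mulX, Sym.divX, Sym.mk.injEq]
    ext ξ
    ring
  -- The part of the vorticity containing ∂_j v_i disappears: exchanging derivatives turns the sum
  -- into an operator applied to div v.
  have h0 : ∑ i, corr (pd k (P.ker (h.divX i) q))
      (fun y => fderiv ℝ (comp v i) y (EuclideanSpace.single j 1)) y = 0 := by
    have e : ∀ i, corr (pd k (P.ker (h.divX i) q))
        (fun y => fderiv ℝ (comp v i) y (EuclideanSpace.single j 1)) y =
        corr (pd j (P.ker (h.divX k) q))
          (fun y => fderiv ℝ (comp v i) y (EuclideanSpace.single i 1)) y := fun i => by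
      rw [hI, hI, hS i k, pd_comm j i]
    rw [Finset.sum_congr rfl fun i _ => e i,
      ← TemperateInt.corr_fun_sum Finset.univ (fun i => hT' i i)]
    have : (fun x => ∑ i, fderiv ℝ (comp v i) x (EuclideanSpace.single i 1)) = fun _ => 0 := by
      ext x
      simp only [fderiv_comp_apply (hv _)]
      rw [← Complex.ofReal_sum, hdiv x]; simp
    rw [this]
    simp [corr]
  -- Writing the kernel as a divergence, then exchanging ∂_i with ∂_k between kernel and field,
  -- expresses ∂_k v_j through all the ∂_i v_j.
  have h1 : corr (P.ker h q) (fun y => fderiv ℝ (comp v j) y (EuclideanSpace.single k 1)) y =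
      (2 : ℝ) ^ (-q) • ∑ i, corr (pd k (P.ker (h.divX i) q))
        (fun y => fderiv ℝ (comp v j) y (EuclideanSpace.single i 1)) y := by
    conv_lhs => rw [P.ker_eq_sum_pd h q, corr_smul, (hT' j k).corr_sum]
    congr 1
    refine Finset.sum_congr rfl fun i _ => ?_
    rw [hI, hI, pd_comm]
  have h2 : ∑ i, corr (pd k (P.ker (h.divX i) q))
        (fun y => fderiv ℝ (comp v j) y (EuclideanSpace.single i 1)) y =
      ∑ i, corr (pd k (P.ker (h.divX i) q)) (vort v i j) y := by
    rw [← sub_zero (∑ i, corr (pd k (P.ker (h.divX i) q))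
        (fun y => fderiv ℝ (comp v j) y (EuclideanSpace.single i 1)) y), ← h0,
      ← Finset.sum_sub_distrib]
    refine Finset.sum_congr rfl fun i _ => ?_
    rw [vort_eq hv, TemperateInt.corr_fun_sub (hT' j i) (hT' i j)]
  rw [h1, h2, Finset.smul_sum]
  refine Finset.sum_congr rfl fun i _ => ?_
  rw [pd_ker, corr_smul, smul_smul, ← zpow_add₀ two_ne_zero, neg_add_cancel, zpow_zero, one_smul]

/-- Recovering a block of a field from its gradient. -/
theorem corr_ker_comp_eq (h : Sym d) (q : ℤ) (j : Fin d) (y : E d) :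
    corr (P.ker h q) (comp v j) y = -((2 : ℝ) ^ (-q) • ∑ k, corr (P.ker (h.divX k) q)
      (fun y => fderiv ℝ (comp v j) y (EuclideanSpace.single k 1)) y) := by
  have hc : Differentiable ℝ (comp v j) := fun y => (hasFDerivAt_comp (hv y) j).differentiableAt
  conv_lhs => rw [P.ker_eq_sum_pd h q, corr_smul, (hT j).corr_sum]
  rw [← smul_neg, ← Finset.sum_neg_distrib]
  congr 1
  refine Finset.sum_congr rfl fun k _ => ?_
  rw [corr_fderiv hc (hT j) k (hT' j k), neg_neg]

theorem fderiv_corr_ker_comp (h : Sym d) (q : ℤ) (j k : Fin d) (y : E d) :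
    fderiv ℝ (corr (P.ker h q) (comp v j)) y (EuclideanSpace.single k 1) =
      corr (P.ker h q) (fun y => fderiv ℝ (comp v j) y (EuclideanSpace.single k 1)) y := by
  have hc : Differentiable ℝ (comp v j) := fun y => (hasFDerivAt_comp (hv y) j).differentiableAt
  rw [(hT j).fderiv_corr, corr_fderiv hc (hT j) k (hT' j k)]

end

/-- For q ≤ 0, Bernstein from L^ρ gives 2^(qd/ρ) ≤ 2^(κq), as κ ≤ d/ρ. For q > 0 the L^∞ norm of the
vorticity is enough, as 2^(κq) ≥ 1. -/
theorem exists_enorm_corr_ker_vort_le {ρ : ℝ≥0∞} (hρ : 1 ≤ ρ) {κ : ℝ} (hκ : 0 ≤ κ)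
    (hκρ : κ ≤ d / ρ.toReal) (h : Sym d) : ∃ C : ℝ≥0, ∀ v : E d → E d, ContDiff ℝ 1 v →
      ∀ i j q y, ‖corr (P.ker h q) (vort v i j) y‖ₑ ≤ C * (two (κ * q) * vortSize v ρ) := by
  have hpp : ρ.HolderConjugate (1 - ρ⁻¹)⁻¹ :=
    have := ENNReal.HolderConjugate.inv_one_sub_inv' hρ
    ENNReal.HolderTriple.symm
  have h1 : eLpNorm (P.ker h 0) (1 - ρ⁻¹)⁻¹ volume ≠ ⊤ := ((P.ker h 0).memLp _ volume).2.ne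
  have h2 : eLpNorm (P.ker h 0) 1 volume ≠ ⊤ := ((P.ker h 0).memLp _ volume).2.ne
  refine ⟨max (eLpNorm (P.ker h 0) (1 - ρ⁻¹)⁻¹ volume).toNNReal
    (eLpNorm (P.ker h 0) 1 volume).toNNReal, fun v hv i j q y => ?_⟩
  rw [ENNReal.coe_max, ENNReal.coe_toNNReal h1, ENNReal.coe_toNNReal h2]
  have hm := (continuous_vort hv i j).aestronglyMeasurable (μ := volume)
  have hle : ∀ p, eLpNorm (vort v i j) p volume ≤ eLpNorm (vorticity v) p volume := fun p =>
    eLpNorm_mono fun x => norm_vort_le v i j x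
  rcases le_or_gt q 0 with hq | hq
  · refine (P.enorm_corr_ker_le_low (p := ρ) (p' := (1 - ρ⁻¹)⁻¹) hm h q y).trans ?_
    refine mul_le_mul' (le_max_left _ _) (mul_le_mul' ?_ ((hle ρ).trans le_add_self))
    refine two_mono ?_
    have : (q : ℝ) ≤ 0 := by exact_mod_cast hq
    nlinarith
  · refine (P.enorm_corr_ker_le_low (p := ⊤) (p' := 1) hm h q y).trans ?_
    refine mul_le_mul' (le_max_right _ _) (mul_le_mul' ?_ ((hle ⊤).trans le_self_add))
    refine two_mono ?_
    have : (0 : ℝ) ≤ q := by exact_mod_cast hq.le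
    simp only [ENNReal.toReal_top, div_zero, mul_zero]
    positivity

theorem exists_enorm_corr_ker_fderiv_le {ρ : ℝ≥0∞} (hρ : 1 ≤ ρ) {κ : ℝ} (hκ : 0 ≤ κ)
    (hκρ : κ ≤ d / ρ.toReal) (h : Sym d) : ∃ C : ℝ≥0, ∀ v : E d → E d, ContDiff ℝ 1 v →
      (∀ i, TemperateInt (comp v i)) →
      (∀ i j, TemperateInt fun y => fderiv ℝ (comp v i) y (EuclideanSpace.single j 1)) →
      DivergenceFree v → ∀ j k q y,
      ‖corr (P.ker h q) (fun y => fderiv ℝ (comp v j) y (EuclideanSpace.single k 1)) y‖ₑ ≤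
        C * (two (κ * q) * vortSize v ρ) := by
  choose C hC using fun i k => P.exists_enorm_corr_ker_vort_le hρ hκ hκρ ((h.divX i).mulX k)
  refine ⟨∑ k, ∑ i, C i k, fun v hv hT hT' hdiv j k q y => ?_⟩
  rw [P.corr_ker_fderiv (hv.differentiable (by simp)) hT hT' hdiv]
  calc _ ≤ ∑ i, (C i k : ℝ≥0∞) * (two (κ * q) * vortSize v ρ) :=
        (enorm_sum_le _ _).trans (Finset.sum_le_sum fun i _ => hC i k v hv i j q y)
    _ = ((∑ i, C i k : ℝ≥0) : ℝ≥0∞) * (two (κ * q) * vortSize v ρ) := by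
        rw [ENNReal.ofNNReal_finsetSum, Finset.sum_mul]
    _ ≤ _ := by
        exact mul_le_mul_left (ENNReal.coe_le_coe.2 (Finset.single_le_sum
          (f := fun k => ∑ i, C i k) (fun _ _ => zero_le) (Finset.mem_univ k))) _

end DyadicPartition

theorem temperateInt_fderiv_comp_of_memLp {v : E d → E d} (hv : Differentiable ℝ v) {p : ℝ≥0∞}
    (hp : 1 ≤ p) (hvp : MemLp (fderiv ℝ v) p volume) (i j : Fin d) :
    TemperateInt fun y => fderiv ℝ (comp v i) y (EuclideanSpace.single j 1) := by
  refine temperateInt_of_memLp hp ?_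
  simp only [fderiv_comp_apply (hv _)]
  exact ((EuclideanSpace.proj (𝕜 := ℝ) i).comp
    (ContinuousLinearMap.apply ℝ (E d) (EuclideanSpace.single j (1 : ℝ)))).comp_memLp' hvp
    |>.ofReal

/-- The increments of a field with gradient in a Lebesgue space are in this space. -/
theorem memLp_comp_increment {v : E d → E d} (hv : ContDiff ℝ 1 v) {p : ℝ≥0∞} (hp : 1 ≤ p)
    (hvp : MemLp (fderiv ℝ v) p volume) (j : Fin d) (w : E d) :
    MemLp (fun x => comp v j (x + w) - comp v j x) p volume := by
  have hc : Continuous (fderiv ℝ v) := hv.continuous_fderiv (by simp)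
  have hcj : Continuous (comp v j) := by
    have := hv.continuous
    unfold comp; fun_prop
  have h1 : Continuous fun z : E d × ℝ => fderiv ℝ v (z.1 + z.2 • w) := by fun_prop
  have h := eLpNorm_lintegral_le (μ := (volume : Measure (E d)))
    (ν := volume.restrict (Set.Ioc (0 : ℝ) 1)) hp
    (F := fun x t => ‖fderiv ℝ v (x + t • w)‖ₑ * ‖w‖ₑ) (h1.measurable.enorm.mul_const _)
    (A := ‖w‖ₑ * eLpNorm (fderiv ℝ v) p volume) (fun t => by
      have e := eLpNorm_ennreal_const_mul_le (μ := volume) (enorm_ne_top (x := w))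
        (fun x => ‖fderiv ℝ v (x + t • w)‖ₑ) p
      simp only [mul_comm _ ‖w‖ₑ]
      refine e.trans (le_of_eq ?_)
      rw [eLpNorm_enorm (fun x => fderiv ℝ v (x + t • w))]
      congr 1
      exact eLpNorm_comp_const_add hc.aestronglyMeasurable _ _)
  refine ⟨(Continuous.aestronglyMeasurable (by fun_prop)), ?_⟩
  refine lt_of_le_of_lt (eLpNorm_mono_enorm fun x => ?_) (h.trans_lt ?_)
  · rw [enorm_eq_self]
    exact (enorm_le_iff_norm_le.2 (norm_comp_sub_le v j _ _)).trans (enorm_sub_le_lintegral hv x w)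
  · exact ENNReal.mul_lt_top (by simp) (ENNReal.mul_lt_top enorm_lt_top hvp.2)

/-- A continuous function is bounded by its norm as a functional on integrable functions. -/
theorem norm_le_of_forall_integral_le {D : E d → ℂ} (hD : Continuous D) {M : ℝ}
    (h : ∀ F : 𝓢(E d, ℂ), ‖∫ x, D x * F x‖ ≤ M * ∫ x, ‖F x‖) (x : E d) : ‖D x‖ ≤ M := by
  refine le_of_forall_pos_le_add fun ε hε => ?_
  obtain ⟨δ, hδ0, hδ⟩ := Metric.continuousAt_iff.1 hD.continuousAt ε hε
  let φ : ContDiffBump (0 : E d) := ⟨δ / 2, δ, by positivity, by linarith⟩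
  have h1 := φ.dist_normed_convolution_le (μ := (volume : Measure (E d))) (g := D) (x₀ := x)
    (ε := ε) hD.aestronglyMeasurable fun y hy => (hδ hy).le
  have hs : HasCompactSupport fun y => ((φ.normed volume (x - y) : ℝ) : ℂ) :=
    (φ.hasCompactSupport_normed.comp_homeomorph (Homeomorph.subLeft x)).comp_left
      (g := fun r : ℝ => (r : ℂ)) rfl
  have hc : ContDiff ℝ ∞ fun y => ((φ.normed (volume : Measure (E d)) (x - y) : ℝ) : ℂ) :=
    Complex.ofRealCLM.contDiff.comp (φ.contDiff_normed.comp (contDiff_const.sub contDiff_id))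
  have h2 := h (hs.toSchwartzMap hc)
  have e1 : ∀ y, hs.toSchwartzMap hc y = ((φ.normed (volume : Measure (E d)) (x - y) : ℝ) : ℂ) :=
    fun y => rfl
  have e2 : ∫ y, ‖hs.toSchwartzMap hc y‖ = 1 := by
    simp only [e1, Complex.norm_real, Real.norm_of_nonneg (φ.nonneg_normed _)]
    rw [integral_sub_left_eq_self (fun y => φ.normed volume y)]
    exact φ.integral_normed
  have e3 : ∫ y, D y * hs.toSchwartzMap hc y =
      (MeasureTheory.convolution (φ.normed volume) D (ContinuousLinearMap.lsmul ℝ ℝ) volume) x := by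
    rw [convolution_def, ← integral_sub_left_eq_self _ _ x]
    refine integral_congr_ae (Filter.Eventually.of_forall fun y => ?_)
    simp [e1, mul_comm]
  rw [e2, mul_one, e3] at h2
  rw [dist_comm, dist_eq_norm] at h1
  calc ‖D x‖ = ‖(D x - _) + _‖ := by rw [sub_add_cancel]
    _ ≤ ε + M := (norm_add_le _ _).trans (add_le_add h1 h2)
    _ = _ := add_comm _ _

/-! ### From bounds on the blocks to Hölder continuity -/

namespace DyadicPartition

variable (P : DyadicPartition d)

/-- The decomposition of D converges weakly against Schwartz functions since D ∈ L^p with 1 < p < ∞;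
this excludes a polynomial remainder. Continuity of D turns the weak bound into a pointwise one. -/
theorem enorm_le_tsum_of_corr_ker [Nonempty (Fin d)] {p : ℝ≥0∞} (hp : 1 < p) (hpt : p ≠ ⊤)
    {D : E d → ℂ} (hDc : Continuous D) (hD : MemLp D p volume) {M : ℤ → ℝ≥0∞}
    (hM : ∀ q x, ‖corr (P.ker Sym.one q) D x‖ₑ ≤ M q) (x : E d) : ‖D x‖ₑ ≤ ∑' q, M q := by
  by_cases hMt : ∑' q, M q = ⊤
  · rw [hMt]; exact le_top
  have hMq : ∀ q, M q ≠ ⊤ := fun q => ENNReal.ne_top_of_tsum_ne_top hMt q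
  have hpp : p.HolderConjugate (1 - p⁻¹)⁻¹ :=
    have := ENNReal.HolderConjugate.inv_one_sub_inv' hp.le
    ENNReal.HolderTriple.symm
  have hle : ‖D x‖ ≤ (∑' q, M q).toReal := by
    refine norm_le_of_forall_integral_le hDc (fun F => ?_) x
    have ht := P.tendsto_sum_integral_corr_mul hp hpt hDc hD (F.memLp (1 - p⁻¹)⁻¹ volume)
    refine le_of_tendsto ht.norm (Filter.Eventually.of_forall fun Q => ?_)
    have hq : ∀ q, ‖∫ x, corr (P.ker Sym.one q) D x * F x‖ ≤ (M q).toReal * ∫ x, ‖F x‖ :=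
      fun q => by
        rw [← integral_const_mul]
        refine norm_integral_le_of_norm_le (F.integrable.norm.const_mul _)
          (Filter.Eventually.of_forall fun x => ?_)
        rw [norm_mul]
        gcongr
        rw [← toReal_enorm]
        exact ENNReal.toReal_mono (hMq q) (hM q x)
    calc _ ≤ ∑ q ∈ Finset.Ico (-(Q : ℤ)) Q, (M q).toReal * ∫ x, ‖F x‖ :=
          (norm_sum_le _ _).trans (Finset.sum_le_sum fun q _ => hq q)
      _ = (∑ q ∈ Finset.Ico (-(Q : ℤ)) Q, M q).toReal * ∫ x, ‖F x‖ := by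
          rw [ENNReal.toReal_sum fun q _ => hMq q, Finset.sum_mul]
      _ ≤ _ := by
          gcongr
          exact ENNReal.sum_le_tsum _
  rw [← ENNReal.ofReal_toReal hMt, ← ofReal_norm]
  exact ENNReal.ofReal_le_ofReal hle

/-- The two entries of the minimum cross where 2^(-q) is comparable to ℓ. On either side of that
index the terms decay geometrically, with ratios governed by 1 − κ and κ, so the sum is comparable
to its largest term ℓ^(1-κ). -/
theorem tsum_min_two_le {κ : ℝ} (hκ : 0 < κ) (hκ1 : κ < 1) {ℓ : ℝ} (hℓ : 0 < ℓ) :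
    ∑' q : ℤ, min (two (-q)) (ENNReal.ofReal ℓ) * two (κ * q) ≤
      2 * (∑' n : ℤ, two (-(min κ (1 - κ) * |(n : ℝ)|))) * ENNReal.ofReal ℓ ^ (1 - κ) := by
  obtain ⟨m, hm1, hm2⟩ := exists_mem_Ico_zpow hℓ one_lt_two
  have hμ1 := min_le_left κ (1 - κ)
  have hμ2 := min_le_right κ (1 - κ)
  have hμ0 : 0 < min κ (1 - κ) := lt_min hκ (by linarith)
  set μ := min κ (1 - κ)
  have h2m : ENNReal.ofReal ℓ ≤ 2 * two m := by
    have : (2 : ℝ≥0∞) = ENNReal.ofReal 2 := by simp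
    rw [two, this, ← ENNReal.ofReal_mul (by norm_num), Real.rpow_intCast]
    refine ENNReal.ofReal_le_ofReal (hm2.le.trans (le_of_eq ?_))
    rw [zpow_add₀ two_ne_zero, zpow_one, mul_comm]
  have h2l : two (m * (1 - κ)) ≤ ENNReal.ofReal ℓ ^ (1 - κ) := by
    rw [two, ENNReal.ofReal_rpow_of_nonneg hℓ.le (by linarith)]
    refine ENNReal.ofReal_le_ofReal ?_
    rw [Real.rpow_mul (by norm_num), Real.rpow_intCast]
    exact Real.rpow_le_rpow (by positivity) hm1 (by linarith)
  have hq : ∀ q : ℤ, min (two (-q)) (ENNReal.ofReal ℓ) * two (κ * q) ≤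
      2 * (two (m * (1 - κ)) * two (-(μ * |((q : ℝ) - (-m : ℤ))|))) := fun q => by
    push_cast
    rw [sub_neg_eq_add]
    rcases le_total 0 ((q : ℝ) + m) with h | h
    · rw [abs_of_nonneg h]
      calc _ ≤ two (-q) * two (κ * q) := mul_le_mul_left (min_le_left _ _) _
        _ ≤ two (m * (1 - κ)) * two (-(μ * ((q : ℝ) + m))) := by
            rw [← two_add, ← two_add]
            exact two_mono (by nlinarith)
        _ ≤ _ := le_mul_of_one_le_left' (by norm_num)
    · rw [abs_of_nonpos h]
      calc _ ≤ 2 * two m * two (κ * q) := mul_le_mul_left ((min_le_right _ _).trans h2m) _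
        _ ≤ _ := by
            rw [mul_assoc, ← two_add, ← two_add]
            exact mul_le_mul_right (two_mono (by nlinarith)) _
  refine (ENNReal.tsum_le_tsum hq).trans ?_
  rw [ENNReal.tsum_mul_left, ENNReal.tsum_mul_left]
  have e : ∑' q : ℤ, two (-(μ * |((q : ℝ) - (-m : ℤ))|)) = ∑' n : ℤ, two (-(μ * |(n : ℝ)|)) := by
    rw [← (Equiv.subRight (-m : ℤ)).tsum_eq fun n : ℤ => two (-(μ * |(n : ℝ)|))]
    simp
  rw [e]
  calc _ = 2 * (∑' n : ℤ, two (-(μ * |(n : ℝ)|))) * two (m * (1 - κ)) := by ring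
    _ ≤ _ := mul_le_mul_right h2l _

theorem norm_sub_le_of_norm_fderiv_single_le {f : E d → ℂ} (hf : Differentiable ℝ f) {B : ℝ}
    (hB : ∀ k x, ‖fderiv ℝ f x (EuclideanSpace.single k 1)‖ ≤ B) (x w : E d) :
    ‖f (x + w) - f x‖ ≤ d * B * ‖w‖ := by
  have h : ∀ x, ‖fderiv ℝ f x‖ ≤ d * B := fun x => by
    have hB0 : 0 ≤ d * B := by
      rcases isEmpty_or_nonempty (Fin d) with h | ⟨⟨k⟩⟩
      · have : d = 0 := Nat.eq_zero_of_not_pos fun h0 => h.false ⟨0, h0⟩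
        simp [this]
      · have := (norm_nonneg _).trans (hB k x)
        positivity
    refine ContinuousLinearMap.opNorm_le_bound _ hB0 fun w => ?_
    have e : w = ∑ k, w k • EuclideanSpace.single k (1 : ℝ) := by
      ext i; simp [Finset.sum_apply, Pi.single_apply]
    conv_lhs => rw [e]
    rw [map_sum]
    calc _ ≤ ∑ k : Fin d, ‖w‖ * B := by
          refine (norm_sum_le _ _).trans (Finset.sum_le_sum fun k _ => ?_)
          rw [map_smul, norm_smul]
          gcongr
          · exact PiLp.norm_apply_le _ _
          · exact hB k x
      _ = _ := by
          rw [Finset.sum_const, Finset.card_univ, Fintype.card_fin, nsmul_eq_mul]; ring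
  have := Convex.norm_image_sub_le_of_norm_fderiv_le (𝕜 := ℝ) (s := Set.univ) (f := f)
    (fun x _ => hf x) (fun x _ => h x) convex_univ (Set.mem_univ x) (Set.mem_univ (x + w))
  simpa using this

include P in
/-- A vector field with integrable gradient and bounded vorticity is Hölder continuous. -/
theorem exists_enorm_sub_le_vortSize (hd : 0 < d) {ρ : ℝ≥0∞} (hρ : 1 < ρ) (hρt : ρ ≠ ⊤) {κ : ℝ}
    (hκ : 0 < κ) (hκ1 : κ < 1) (hκρ : κ ≤ d / ρ.toReal) : ∃ C : ℝ≥0, ∀ v : E d → E d,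
      ContDiff ℝ 1 v → DivergenceFree v → MemLp (fderiv ℝ v) ρ volume → vortSize v ρ ≠ ⊤ →
      ∀ x w, ‖v (x + w) - v x‖ₑ ≤ C * vortSize v ρ * ‖w‖ₑ ^ (1 - κ) := by
  have : Nonempty (Fin d) := ⟨⟨0, hd⟩⟩
  obtain ⟨C₁, hC₁⟩ := P.exists_enorm_corr_ker_fderiv_le hρ.le hκ.le hκρ Sym.one
  choose C₂ hC₂ using fun k =>
    P.exists_enorm_corr_ker_fderiv_le hρ.le hκ.le hκρ (Sym.one.divX k)
  set S : ℝ≥0∞ := ∑' n : ℤ, two (-(min κ (1 - κ) * |(n : ℝ)|)) with hS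
  have hSt : S ≠ ⊤ := tsum_two_neg_abs_ne_top (lt_min hκ (by linarith))
  -- The first summand bounds the increment of a block by twice its size, the second by its gradient
  -- times |w|.
  set B : ℝ≥0 := 2 * ∑ k, C₂ k + d * C₁ with hB
  refine ⟨d * (B * (2 * S.toNNReal)), fun v hv hdiv hvp hΩ x w => ?_⟩
  have hvd : Differentiable ℝ v := hv.differentiable (by simp)
  have hT := temperateInt_comp_of_memLp_fderiv hv hd hρ.le hρt hvp
  have hT' := temperateInt_fderiv_comp_of_memLp hvd hρ.le hvp
  set Ω := vortSize v ρ
  have hw0 : w = 0 ∨ 0 < ‖w‖ := by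
    rcases eq_or_ne w 0 with h | h
    · exact .inl h
    · exact .inr (norm_pos_iff.2 h)
  rcases hw0 with rfl | hw
  · simp
  have hg1 : ∀ j q y, ‖corr (P.ker Sym.one q) (comp v j) y‖ₑ ≤
      two (-q) * (∑ k, C₂ k : ℝ≥0) * (two (κ * q) * Ω) := fun j q y => by
    rw [P.corr_ker_comp_eq hvd hT hT', enorm_neg, enorm_smul, Real.enorm_of_nonneg (by positivity),
      mul_assoc]
    refine mul_le_mul' (le_of_eq ?_) ?_
    · rw [two, ← Int.cast_neg, Real.rpow_intCast]
    · rw [ENNReal.ofNNReal_finsetSum, Finset.sum_mul]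
      exact (enorm_sum_le _ _).trans
        (Finset.sum_le_sum fun k _ => hC₂ k v hv hT hT' hdiv j k q y)
  have hg2 : ∀ j q y, ‖corr (P.ker Sym.one q) (comp v j) (y + w)
      - corr (P.ker Sym.one q) (comp v j) y‖ₑ ≤
      ENNReal.ofReal ‖w‖ * (d * C₁) * (two (κ * q) * Ω) := fun j q y => by
    have ht : (C₁ : ℝ≥0∞) * (two (κ * q) * Ω) ≠ ⊤ :=
      ENNReal.mul_ne_top ENNReal.coe_ne_top (ENNReal.mul_ne_top (two_ne_top _) hΩ)
    have h := norm_sub_le_of_norm_fderiv_single_le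
      ((hT j).differentiable_corr (P.ker Sym.one q)) (B := (C₁ * (two (κ * q) * Ω)).toReal)
      (fun k x => by
        rw [P.fderiv_corr_ker_comp hvd hT hT', ← toReal_enorm]
        exact ENNReal.toReal_mono ht (hC₁ v hv hT hT' hdiv j k q x)) y w
    have h' := ENNReal.ofReal_le_ofReal h
    rw [ofReal_norm, ENNReal.ofReal_mul (by positivity), ENNReal.ofReal_mul (by positivity),
      ENNReal.ofReal_toReal ht, ENNReal.ofReal_natCast] at h'
    exact h'.trans (le_of_eq (by ring))
  have hcj : ∀ j, Continuous (comp v j) := fun j => by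
    have := hv.continuous
    unfold comp; fun_prop
  have hj : ∀ j, ‖comp v j (x + w) - comp v j x‖ₑ ≤
      B * (2 * S) * Ω * ‖w‖ₑ ^ (1 - κ) := fun j => by
    -- The decomposition is applied to an increment of v and not to v itself: increments belong to
    -- L^ρ, whereas v may grow.
    have h := P.enorm_le_tsum_of_corr_ker hρ hρt
      (D := fun x => comp v j (x + w) - comp v j x) (by have := hcj j; fun_prop)
      (memLp_comp_increment hv hρ.le hvp j w)
      (M := fun q => B * Ω * (min (two (-q)) (ENNReal.ofReal ‖w‖) * two (κ * q)))
      (fun q y => by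
        have e : corr (P.ker Sym.one q) (fun x => comp v j (x + w) - comp v j x) y =
            corr (P.ker Sym.one q) (comp v j) (y + w) - corr (P.ker Sym.one q) (comp v j) y := by
          simp only [corr_eq_integral_add]
          rw [← integral_sub]
          · refine integral_congr_ae (Filter.Eventually.of_forall fun z => ?_)
            simp only [show y + z + w = y + w + z by abel]
            ring
          · refine (((hT j).integrable_mul_sub (P.ker Sym.one q) (y + w)).comp_add_left
              (y + w)).congr (Filter.Eventually.of_forall fun z => ?_)
            simp
          · refine (((hT j).integrable_mul_sub (P.ker Sym.one q) y).comp_add_left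
              y).congr (Filter.Eventually.of_forall fun z => ?_)
            simp
        rw [e]
        have hB1 : ((2 * ∑ k, C₂ k : ℝ≥0) : ℝ≥0∞) ≤ B := ENNReal.coe_le_coe.2 le_self_add
        have hB2 : ((d * C₁ : ℝ≥0) : ℝ≥0∞) ≤ B := ENNReal.coe_le_coe.2 le_add_self
        rcases min_choice (two (-q)) (ENNReal.ofReal ‖w‖) with hm | hm
        · rw [hm]
          calc _ ≤ two (-q) * (∑ k, C₂ k : ℝ≥0) * (two (κ * q) * Ω) +
                two (-q) * (∑ k, C₂ k : ℝ≥0) * (two (κ * q) * Ω) :=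
                enorm_sub_le.trans (add_le_add (hg1 j q _) (hg1 j q _))
            _ = ((2 * ∑ k, C₂ k : ℝ≥0) : ℝ≥0∞) * Ω * (two (-q) * two (κ * q)) := by
                push_cast; ring
            _ ≤ _ := by gcongr
        · rw [hm]
          calc _ ≤ _ := hg2 j q y
            _ = ((d * C₁ : ℝ≥0) : ℝ≥0∞) * Ω * (ENNReal.ofReal ‖w‖ * two (κ * q)) := by
                push_cast; ring
            _ ≤ _ := by gcongr) x
    rw [ENNReal.tsum_mul_left] at h
    refine h.trans ((mul_le_mul_right (tsum_min_two_le hκ hκ1 hw) _).trans (le_of_eq ?_))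
    rw [ofReal_norm]; ring
  have hsum : ‖v (x + w) - v x‖ₑ ≤ ∑ j, ‖comp v j (x + w) - comp v j x‖ₑ := by
    have e : v (x + w) - v x = ∑ j, (v (x + w) - v x) j • EuclideanSpace.single j (1 : ℝ) := by
      ext i; simp [Finset.sum_apply, Pi.single_apply]
    rw [e]
    refine (enorm_sum_le _ _).trans (Finset.sum_le_sum fun j _ => ?_)
    refine enorm_le_iff_norm_le.2 ?_
    rw [norm_smul, comp, comp, ← Complex.ofReal_sub, Complex.norm_real]
    simp
  refine hsum.trans ((Finset.sum_le_sum fun j _ => hj j).trans (le_of_eq ?_))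
  rw [Finset.sum_const, Finset.card_univ, Fintype.card_fin, nsmul_eq_mul]
  push_cast
  rw [ENNReal.coe_toNNReal hSt]
  ring

end DyadicPartition

/-! ### The commutator estimates -/

theorem eLpNorm_vorticity_le (v : E d → E d) (p : ℝ≥0∞) :
    eLpNorm (vorticity v) p volume ≤ 2 * eLpNorm (fderiv ℝ v) p volume := by
  have h : ∀ x, ‖vorticity v x‖ ≤ 2 * ‖fderiv ℝ v x‖ := fun x => by
    have h1 : ∀ i j : Fin d, ‖(fderiv ℝ v x (EuclideanSpace.single i 1)) j‖ ≤ ‖fderiv ℝ v x‖ :=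
      fun i j => by
        refine (PiLp.norm_apply_le _ _).trans ((ContinuousLinearMap.le_opNorm _ _).trans ?_)
        simp
    refine (pi_norm_le_iff_of_nonneg (by positivity)).2 fun i =>
      (pi_norm_le_iff_of_nonneg (by positivity)).2 fun j => ?_
    rw [vorticity]
    exact (norm_sub_le _ _).trans (by linarith [h1 i j, h1 j i])
  exact eLpNorm_le_nnreal_smul_eLpNorm_of_ae_le_mul (c := 2)
    (Filter.Eventually.of_forall fun x => by exact_mod_cast h x) p

theorem distLpNorm_block_ne_top {P : DyadicPartition d} {s : ℝ} {r : ℝ≥0∞} (hr : 1 ≤ r)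
    {Θ : 𝓢'(E d, ℂ)} (h : besovNorm P s ⊤ r Θ ≠ ⊤) (m : ℕ) :
    distLpNorm ⊤ (P.block m Θ) ≠ ⊤ := fun hm => by
  refine h (top_le_iff.1 (le_trans ?_ (le_seqNorm hr _ m)))
  rw [hm, ENNReal.mul_top]
  exact (ENNReal.ofReal_pos.2 (by positivity)).ne'

theorem admissible_of_memLp {P : DyadicPartition d} (hd : 0 < d) {p : ℝ≥0∞} (hp : 1 ≤ p)
    (hpt : p ≠ ⊤) {v : E d → E d} {θ : E d → ℝ} {Θ : 𝓢'(E d, ℂ)} (hv : ContDiff ℝ ∞ v)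
    (hdiv : DivergenceFree v) (hvp : MemLp (fderiv ℝ v) p volume) (hθ : ContDiff ℝ ∞ θ)
    (hθp : MemLp θ p volume) (hΘ : IsFunction Θ fun x => (θ x : ℂ)) {s : ℝ} {r : ℝ≥0∞}
    (hr : 1 ≤ r) (h : besovNorm P s ⊤ r Θ ≠ ⊤) : P.Admissible v p (fun x => (θ x : ℂ)) Θ where
  smooth := hv
  div := hdiv
  temp := temperateInt_comp_of_memLp_fderiv (hv.of_le (by simp)) hd hp hpt hvp
  temp_fderiv := temperateInt_fderiv_comp_of_memLp (hv.differentiable (by simp)) hp hvp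
  cont := Complex.continuous_ofReal.comp hθ.continuous
  memLp := hθp.ofReal
  isFunction := hΘ
  finite := distLpNorm_block_ne_top hr h

theorem eLpNorm_ofReal_comp (θ : E d → ℝ) (p : ℝ≥0∞) :
    eLpNorm (fun x => (θ x : ℂ)) p volume = eLpNorm θ p volume :=
  eLpNorm_congr_norm_ae (Filter.Eventually.of_forall fun _ => Complex.norm_real _)

theorem exists_besovNorm_commutator_le (hd : 0 < d) (P : DyadicPartition d) (i₀ : Fin d)
    {p r : ℝ≥0∞} (hp : 2 ≤ p) (hpt : p ≠ ⊤) (hr : 1 ≤ r) :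
    ∃ C : ℝ≥0, ∀ (v : E d → E d) (θ : E d → ℝ) (Θ : 𝓢'(E d, ℂ)),
      ContDiff ℝ ∞ v → DivergenceFree v → MemLp (fderiv ℝ v) p volume →
      ContDiff ℝ ∞ θ → MemLp θ p volume → IsFunction Θ (fun x => (θ x : ℂ)) →
      besovNorm P 0 ⊤ r Θ ≠ ⊤ →
      ∃ T : 𝓢'(E d, ℂ), IsCommutator i₀ v θ T ∧ besovNorm P 0 p r T ≤
        C * eLpNorm (fderiv ℝ v) p volume * (besovNorm P 0 ⊤ r Θ + eLpNorm θ p volume) := by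
  have hp1' : 1 < p := lt_of_lt_of_le (by norm_num) hp
  have hp1 : 1 ≤ p := hp1'.le
  have hpp : p.HolderConjugate (1 - p⁻¹)⁻¹ :=
    have := ENNReal.HolderConjugate.inv_one_sub_inv' hp1
    ENNReal.HolderTriple.symm
  obtain ⟨C₁, h₁⟩ := DyadicPartition.exists_besovNorm_le P one_pos le_rfl hp1
  obtain ⟨C₂, h₂⟩ := DyadicPartition.exists_seqNorm_fold_le P hd hp1 hpt (le_refl (0 : ℝ)) (le_refl (0 : ℝ))
  obtain ⟨C₃, h₃⟩ := DyadicPartition.exists_eLpNorm_piece_le (P := P) hp1 i₀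
  refine ⟨C₁ * C₃ * C₂, fun v θ Θ hv hdiv hvp hθ hθp hΘ hb => ?_⟩
  have H := admissible_of_memLp hd hp1 hpt hv hdiv hvp hθ hθp hΘ hr hb
  have hF := h₂ r (fun x => (θ x : ℂ)) Θ hr
  rw [eLpNorm_ofReal_comp] at hF
  obtain ⟨T, hT, hTb⟩ := h₁ r p v _ Θ (C₃ * eLpNorm (fderiv ℝ v) p volume)
    (fun q => two (0 * q) * P.blockSize p (fun x => (θ x : ℂ)) Θ q) i₀ hr H hp1
    (ENNReal.mul_ne_top ENNReal.coe_ne_top hvp.2.ne)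
    (fun q => ENNReal.mul_ne_top (two_ne_top _) (P.blockSize_ne_top H.memLp H.finite q))
    (ne_top_of_le_ne_top (ENNReal.mul_ne_top ENNReal.coe_ne_top
      (ENNReal.add_ne_top.2 ⟨hb, hθp.2.ne⟩)) hF)
    (fun n q => (h₃ v _ Θ H n q).trans (le_of_eq (by
      rw [zero_mul, two_zero, one_mul, one_mul, two, mul_assoc, mul_assoc, mul_assoc])))
  -- The growth of v, and with it the condition p ≥ 2, matters only for identifying the distribution
  -- with the commutator; the norm estimate is already in `hTb`.
  obtain ⟨s, hs0, hsd, hs⟩ :=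
    exists_memLp_mul_of_memLp_fderiv (p' := (1 - p⁻¹)⁻¹) (hv.of_le (by simp)) hd hp hpt hvp
  refine ⟨T, H.isCommutator hp1' hpt hs0 hsd hs i₀ hT, hTb.trans ?_⟩
  calc _ ≤ C₁ * (C₃ * eLpNorm (fderiv ℝ v) p volume) *
        (C₂ * (besovNorm P 0 ⊤ r Θ + eLpNorm θ p volume)) := by gcongr
    _ = _ := by push_cast; ring

theorem exists_besovNorm_top_commutator_le (hd : 0 < d) (P : DyadicPartition d) (i₀ : Fin d)
    {r ρ : ℝ≥0∞} {ε : ℝ} (hr : 1 ≤ r) (hρ : 1 < ρ) (hρt : ρ ≠ ⊤) (hε : 0 < ε) :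
    ∃ C : ℝ≥0, ∀ (v : E d → E d) (θ : E d → ℝ) (Θ : 𝓢'(E d, ℂ)),
      ContDiff ℝ ∞ v → DivergenceFree v → MemLp (fderiv ℝ v) ρ volume →
      MemLp (vorticity v) ⊤ volume →
      ContDiff ℝ ∞ θ → MemLp θ ρ volume → IsFunction Θ (fun x => (θ x : ℂ)) →
      besovNorm P ε ⊤ r Θ ≠ ⊤ →
      ∃ T : 𝓢'(E d, ℂ), IsCommutator i₀ v θ T ∧ besovNorm P 0 ⊤ r T ≤
        C * (eLpNorm (vorticity v) ⊤ volume + eLpNorm (vorticity v) ρ volume) *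
          (besovNorm P ε ⊤ r Θ + eLpNorm θ ρ volume) := by
  have hpp : ρ.HolderConjugate (1 - ρ⁻¹)⁻¹ :=
    have := ENNReal.HolderConjugate.inv_one_sub_inv' hρ.le
    ENNReal.HolderTriple.symm
  have hρr : 0 < ρ.toReal := ENNReal.toReal_pos (by positivity) hρt
  -- The bound κ < 1 keeps a positive Hölder exponent, κ ≤ d/ρ serves the low frequencies of the
  -- vorticity, and κ ≤ ε lets the regularity of θ pay for 2^(κq).
  obtain ⟨κ, hκ, hκ1, hκρ, hκε⟩ : ∃ κ : ℝ, 0 < κ ∧ κ < 1 ∧ κ ≤ d / ρ.toReal ∧ κ ≤ ε :=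
    ⟨min (1 / 2) (min (d / ρ.toReal) ε), by positivity,
      (min_le_left _ _).trans_lt (by norm_num), (min_le_right _ _).trans (min_le_left _ _),
      (min_le_right _ _).trans (min_le_right _ _)⟩
  have hμ : 0 < min κ (1 - κ) := lt_min hκ (by linarith)
  obtain ⟨C₁, h₁⟩ := DyadicPartition.exists_besovNorm_le P hμ ((min_le_left _ _).trans hκ1.le) (p := ⊤) le_top
  obtain ⟨C₂, h₂⟩ := DyadicPartition.exists_seqNorm_fold_le P hd hρ.le hρt hκ.le hκε
  obtain ⟨C₃, h₃⟩ := DyadicPartition.exists_eLpNorm_top_piece_le (P := P) hρ.le hκ1.le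
    (min_le_left κ (1 - κ)) (min_le_right κ (1 - κ)) i₀
  obtain ⟨C₄, h₄⟩ := P.exists_enorm_sub_le_vortSize hd hρ hρt hκ hκ1 hκρ
  refine ⟨C₁ * C₃ * C₄ * C₂, fun v θ Θ hv hdiv hvp hω hθ hθp hΘ hb => ?_⟩
  have H := admissible_of_memLp hd hρ.le hρt hv hdiv hvp hθ hθp hΘ hr hb
  have hF := h₂ r (fun x => (θ x : ℂ)) Θ hr
  rw [eLpNorm_ofReal_comp] at hF
  have hΩ : vortSize v ρ ≠ ⊤ := ENNReal.add_ne_top.2 ⟨hω.2.ne, ne_top_of_le_ne_top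
    (ENNReal.mul_ne_top (by simp) hvp.2.ne) (eLpNorm_vorticity_le v ρ)⟩
  have hA : (C₄ : ℝ≥0∞) * vortSize v ρ ≠ ⊤ := ENNReal.mul_ne_top ENNReal.coe_ne_top hΩ
  have hH := h₄ v (hv.of_le (by simp)) hdiv hvp hΩ
  obtain ⟨T, hT, hTb⟩ := h₁ r ρ v _ Θ (C₃ * (C₄ * vortSize v ρ))
    (fun q => two (κ * q) * P.blockSize ρ (fun x => (θ x : ℂ)) Θ q) i₀ hr H hρ.le
    (ENNReal.mul_ne_top ENNReal.coe_ne_top hA)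
    (fun q => ENNReal.mul_ne_top (two_ne_top _) (P.blockSize_ne_top H.memLp H.finite q))
    (ne_top_of_le_ne_top (ENNReal.mul_ne_top ENNReal.coe_ne_top
      (ENNReal.add_ne_top.2 ⟨hb, hθp.2.ne⟩)) hF)
    (fun n q => (h₃ v _ Θ _ H hA hH n q).trans (le_of_eq (by
      change _ * (_ * two _ * _) = _
      rw [two_add]; ring)))
  obtain ⟨s, hs0, hsd, hs⟩ := exists_memLp_mul_of_holder (p' := (1 - ρ⁻¹)⁻¹) hv.continuous hd hρ
    hρt hA (by linarith : 0 ≤ 1 - κ) (by linarith) hH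
  refine ⟨T, H.isCommutator hρ hρt hs0 hsd hs i₀ hT, hTb.trans ?_⟩
  calc _ ≤ C₁ * (C₃ * (C₄ * vortSize v ρ)) *
        (C₂ * (besovNorm P ε ⊤ r Θ + eLpNorm θ ρ volume)) := by gcongr
    _ = _ := by rw [vortSize]; push_cast; ring

end RieszCommutator

theorem theorem3p1 (d : ℕ) (hd : 2 ≤ d) (P : DyadicPartition d) :
    (∀ p r : ℝ≥0∞, 2 ≤ p → p ≠ ⊤ → 1 ≤ r →
      ∃ C : ℝ≥0, ∀ (v : E d → E d)
        (θ : E d → ℝ) (Θ : 𝓢'(E d, ℂ)),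
        ContDiff ℝ ∞ v → DivergenceFree v → MemLp (fderiv ℝ v) p volume →
        ContDiff ℝ ∞ θ → MemLp θ p volume →
        IsFunction Θ (fun x => (θ x : ℂ)) →
        besovNorm P 0 ⊤ r Θ ≠ ⊤ →
        ∃ T : 𝓢'(E d, ℂ),
          IsCommutator (⟨0, by omega⟩ : Fin d) v θ T ∧
          besovNorm P 0 p r T ≤
            C * eLpNorm (fderiv ℝ v) p volume *
              (besovNorm P 0 ⊤ r Θ + eLpNorm θ p volume)) ∧
    (∀ (r ρ : ℝ≥0∞) (ε : ℝ), 1 ≤ r → 1 < ρ → ρ ≠ ⊤ → 0 < ε →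
      ∃ C : ℝ≥0, ∀ (v : E d → E d)
        (θ : E d → ℝ) (Θ : 𝓢'(E d, ℂ)),
        ContDiff ℝ ∞ v → DivergenceFree v → MemLp (fderiv ℝ v) ρ volume →
        MemLp (vorticity v) ⊤ volume →
        ContDiff ℝ ∞ θ → MemLp θ ρ volume →
        IsFunction Θ (fun x => (θ x : ℂ)) →
        besovNorm P ε ⊤ r Θ ≠ ⊤ →
        ∃ T : 𝓢'(E d, ℂ),
          IsCommutator (⟨0, by omega⟩ : Fin d) v θ T ∧
          besovNorm P 0 ⊤ r T ≤
            C * (eLpNorm (vorticity v) ⊤ volume +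
                eLpNorm (vorticity v) ρ volume) *
              (besovNorm P ε ⊤ r Θ + eLpNorm θ ρ volume)) := by
  have hd0 : 0 < d := by omega
  exact ⟨fun p r hp hpt hr => exists_besovNorm_commutator_le hd0 P _ hp hpt hr,
    fun r ρ ε hr hρ hρt hε => exists_besovNorm_top_commutator_le hd0 P _ hr hρ hρt hε⟩
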